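/- Trees are finite binary labelled trees: for a finite alphabet $\Sigma$, a $\Sigma$-tree is a finite partial map $t:\{0,1\}^*\to\Sigma$ (possibly empty) whose domain is prefix-closed and contains $u0$ whenever it contains $u1$. A (bottom-up) tree automaton over $\Sigma$ is a tuple $(Q,\iota,\Delta,F)$ with $Q$ a finite set of states, $\iota\in Q$, $\Delta\subseteq Q\times\Sigma\times Q^2$ and $F\subseteq Q$. A run on $t$ is a map $\rho:\mathrm{dom}(t)\to Q$ such that, with $\rho'$ denoting the extension of $\rho$ by the value $\iota$ outside $\mathrm{dom}(t)$, one has $(\rho(u),t(u),\rho'(u0),\rho'(u1))\in\Delta$ for all $u\in\mathrm{dom}(t)$; it is accepting if $\rho'(\varepsilon)\in F$. The language of the automaton is the set of trees that admit an accepting run. The convolution $s\otimes t$ of two $\Sigma$-trees is the tree with domain $\mathrm{dom}(s)\cup\mathrm{dom}(t)$ and label at $u$ the pair of the labels of $s$ and $t$ at $u$, where an undefined label is replaced by a new letter $\#$. A tree-automatic presentation of a linear order $\mathcal L$ consists of a finite alphabet $\Sigma$, a tree automaton over $\Sigma$ with some language $U$, and a tree automaton over $(\Sigma\cup\{\#\})^2$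 with language $\{s\otimes t\mid s,t\in U,\ s\,R\,t\}$ for some relation $R$ such that $(U;R)\cong\mathcal L$. Presentations are finite objects (letters and states being natural numbers), so computability of functions on them makes sense. A linear order is scattered if $(\mathbb Q;\le)$ does not embed into it. A set $S$ is $\Pi^0_1$-hard if every $\Pi^0_1$ set $A\subseteq\mathbb N$ (i.e. every $A$ with recursively enumerable complement) is many-one reducible to $S$ by a computable function. **Theorem.** 1. There is a scattered linear order $\mathcal L$ such that the set of tree-automatic presentations of $\mathcal L$ is $\Pi^0_1$-hard. 2. The isomorphism problem for tree-automatic scattered linear orders, i.e. the set of all pairs $(P_1,P_2)$ of tree-automatic presentations of scattered linear orders $\mathcal L_1$ and $\mathcal L_2$ with $\mathcal L_1\cong\mathcal L_2$, is $\Pi^0_1$-hard. 3. Let $X$ be any set of pairs of tree-automatic presentations such that, for all tree-automatic presentations $P_1$ and $P_2$ of scattered linear orders $\mathcal L_1$ and $\mathcal L_2$, one has $(P_1,P_2)\in X$ if and only if $\mathcal L_1\cong\mathcal L_2$. Then $X$ is $\Pi^0_1$-hard. -/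

import Mathlib

/-! ### Trees

A finite partial map `t : {0,1}* → α` with prefix-closed domain is a `BinaryTree α`: `nil` is the
empty tree, and in `node a l r` the letter `a` is `t(ε)`, `l` is the subtree rooted at `0` and `r`
the subtree rooted at `1`. -/

namespace TreeAutomatic

/-- The remaining condition on the domain of a tree: `u1 ∈ dom(t)` implies `u0 ∈ dom(t)`. -/
def IsProper {α : Type} : BinaryTree α → Prop
  | .nil => True
  | .node _ l r => (l = .nil → r = .nil) ∧ IsProper l ∧ IsProper r

/-- The convolution `s ⊗ t`: its domain is the union of the domains, and the padding letter `#` is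
`none`. -/
def conv {α : Type} : BinaryTree α → BinaryTree α → BinaryTree (Option α × Option α)
  | .nil, .nil => .nil
  | .nil, .node b l r => .node (none, some b) (conv .nil l) (conv .nil r)
  | .node a l r, .nil => .node (some a, none) (conv l .nil) (conv r .nil)
  | .node a l r, .node b l' r' => .node (some a, some b) (conv l l') (conv r r')

/-! ### Tree automata -/

/-- A (nondeterministic, bottom-up) tree automaton `(Q, ι, Δ, F)` over the letters `α`, written as
finite data: `Q = {0, …, numStates - 1}`, and the finite sets `Δ` and `F` are listed. -/
structure TreeAutomaton (α : Type) where
  numStates : ℕ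
  init : ℕ
  trans : List (ℕ × α × ℕ × ℕ)
  final : List ℕ

namespace TreeAutomaton

variable {α : Type}

/-- The data form a tree automaton with alphabet `Γ`: `ι ∈ Q`, `Δ ⊆ Q × Γ × Q²` and `F ⊆ Q`. -/
def IsOver (A : TreeAutomaton α) (Γ : Set α) : Prop :=
  A.init < A.numStates ∧
  (∀ q a p₀ p₁, (q, a, p₀, p₁) ∈ A.trans →
    q < A.numStates ∧ a ∈ Γ ∧ p₀ < A.numStates ∧ p₁ < A.numStates) ∧
  (∀ q ∈ A.final, q < A.numStates)

/-- `A.Reaches t q`: some run `ρ` of `A` on `t` has `ρ'(ε) = q`, where `ρ'` extends `ρ` by the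
initial state outside the domain of `t`. -/
def Reaches (A : TreeAutomaton α) : BinaryTree α → ℕ → Prop
  | .nil, q => q = A.init
  | .node a l r, q => ∃ p₀ p₁, A.Reaches l p₀ ∧ A.Reaches r p₁ ∧ (q, a, p₀, p₁) ∈ A.trans

/-- The language of `A`: all trees that admit an accepting run. -/
def language (A : TreeAutomaton α) : Set (BinaryTree α) :=
  {t | IsProper t ∧ ∃ q ∈ A.final, A.Reaches t q}

/-- A tree automaton as a tuple of finite data. -/
def equivTuple : TreeAutomaton α ≃ ℕ × ℕ × List (ℕ × α × ℕ × ℕ) × List ℕ where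
  toFun A := (A.numStates, A.init, A.trans, A.final)
  invFun x := ⟨x.1, x.2.1, x.2.2.1, x.2.2.2⟩
  left_inv _ := rfl
  right_inv _ := rfl

instance [Primcodable α] : Primcodable (TreeAutomaton α) := Primcodable.ofEquiv _ equivTuple

end TreeAutomaton

/-! ### Presentations of linear orders -/

/-- The finite data of a presentation of a structure with one binary relation: the size of the
alphabet `Σ = {0, …, alphabetSize - 1}`, an automaton for the universe and an automaton for the
convolutions of the related pairs. -/
structure Presentation where
  alphabetSize : ℕ
  univAut : TreeAutomaton ℕ
  relAut : TreeAutomaton (Option ℕ × Option ℕ)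

namespace Presentation

/-- A presentation as a tuple of finite data. -/
def equivTuple : Presentation ≃ ℕ × TreeAutomaton ℕ × TreeAutomaton (Option ℕ × Option ℕ) where
  toFun P := (P.alphabetSize, P.univAut, P.relAut)
  invFun x := ⟨x.1, x.2.1, x.2.2⟩
  left_inv _ := rfl
  right_inv _ := rfl

instance : Primcodable Presentation := Primcodable.ofEquiv _ equivTuple

/-- The alphabet `Σ`. -/
def alphabet (P : Presentation) : Set ℕ := {a | a < P.alphabetSize}

/-- The alphabet `Σ_# × Σ_#` of convolutions, where `# = none`. -/
def convAlphabet (P : Presentation) : Set (Option ℕ × Option ℕ) :=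
  {x | (∀ a ∈ x.1, a ∈ P.alphabet) ∧ (∀ b ∈ x.2, b ∈ P.alphabet)}

/-- `P` is a tree automatic presentation of the structure `(U; R)` whose elements are trees. -/
def IsPresentationOf (P : Presentation) (U : Set (BinaryTree ℕ))
    (R : BinaryTree ℕ → BinaryTree ℕ → Prop) : Prop :=
  P.univAut.IsOver P.alphabet ∧ P.relAut.IsOver P.convAlphabet ∧
  P.univAut.language = U ∧
  P.relAut.language = {w | ∃ s ∈ U, ∃ t ∈ U, R s t ∧ w = conv s t}

/-- `P` is a tree automatic presentation of (an isomorphic copy of) the linear order `L`. -/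
def Presents (P : Presentation) (L : Type) [LinearOrder L] : Prop :=
  ∃ (U : Set (BinaryTree ℕ)) (R : BinaryTree ℕ → BinaryTree ℕ → Prop) (e : L ≃ U),
    (∀ x y : L, x ≤ y ↔ R (e x) (e y)) ∧ P.IsPresentationOf U R

end Presentation

/-- A linear order is scattered if the rational line does not embed into it. -/
def Scattered (L : Type) [LinearOrder L] : Prop := IsEmpty (ℚ ↪o L)

/-! ### Hardness -/

/-- A set of natural numbers is `Π⁰₁` if its complement is recursively enumerable. -/
def IsPi01 (A : Set ℕ) : Prop := REPred fun n => n ∉ A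

/-- A set `S` is `Π⁰₁`-hard if every `Π⁰₁` set is many-one reducible to it by a computable
function. -/
def Pi01Hard {β : Type} [Primcodable β] (S : Set β) : Prop :=
  ∀ A : Set ℕ, IsPi01 A → ManyOneReducible (fun n => n ∈ A) (fun b => b ∈ S)

/-- The isomorphism problem for tree automatic scattered linear orders. -/
def scatteredIsoProblem : Set (Presentation × Presentation) :=
  {p | ∃ (L₁ L₂ : Type) (_ : LinearOrder L₁) (_ : LinearOrder L₂),
    Scattered L₁ ∧ Scattered L₂ ∧ p.1.Presents L₁ ∧ p.2.Presents L₂ ∧ Nonempty (L₁ ≃o L₂)}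

end TreeAutomatic

/-! ### Closure properties of regular languages -/

namespace Language

open scoped Computability

/-! The non-halting problem is reduced to isomorphism with one fixed scattered order. Every
computation is simulated by a nondeterministic counter program whose control is a regular language
of actions (`exists_program_halts`). Words 1ⁿ # v, with v admitted by the control, form a regular
language, and such a word is a halting run on n exactly when every zero test in it finds its counter
equal to 0. No finite automaton can check this, so order types do the checking.

Each word w receives a block ω* + X_w, and the blocks are arranged along the length-lexicographic
order. X_w is a finite sum of powers of ω. One summand is ω^|w|. For each sign and each position of
a zero test there is a further summand, to which a letter before the test contributes the exponent 1
± (its effect on the tested counter), a number in {0, 1, 2}, and every other letter contributes 1.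
Its exponent exceeds |w| exactly when the signed counter is positive at the test. Hence ω^(|w|+1) ≤
X_w if and only if some test fails (`exists_hasType_search`, `bad_programErrors_iff`).

For the input n, a copy of ω^|w| is inserted between ω* and X_w in the blocks of all words with # at
position n. Since ω^a + X = X is equivalent to ω^(a+1) ≤ X, the insertion is invisible exactly for
failing runs. So the resulting order is isomorphic to the order without insertions if and only if n
does not halt (`nonempty_orderIso_carrier_iff`). For the converse direction the blocks must be
recovered from the order: an interval is well-founded only inside one block, and the blocks are
indexed by a well-order, so an isomorphism preserves the index. This gives k + ω^|w| + X = m + X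
with finite k and m (`exists_natCast_add_eq`), which are absorbed.

The orders are tree automatic because an element is a word on the leftmost branch with bit words
("slots") hanging off it. Slots range over regular languages of type 1, ω or ω², and the
lexicographic product of the slots has type ω to the sum of the weights. The input n enters only
through the depth of a marked letter, which is checked by stacking n + 2 layers of states, so the
presentations are computable in n (`exists_presentation_slottedWord`). -/

theorem IsRegular.mul {α : Type} {L₁ L₂ : Language α} (h₁ : L₁.IsRegular) (h₂ : L₂.IsRegular) :
    (L₁ * L₂).IsRegular := by
  apply IsRegular.of_finite_range_leftQuotient
  let F : Language α × Set (Language α) → Language α :=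
    fun p => {y | y ∈ p.1 * L₂ ∨ ∃ q ∈ p.2, y ∈ q}
  refine Set.Finite.subset (((h₁.finite_range_leftQuotient).prod
    (h₂.finite_range_leftQuotient.powerset)).image F) ?_
  rintro _ ⟨x, rfl⟩
  -- The quotient of the product by x is x⁻¹L₁ · L₂ together with the quotients x'⁻¹L₂ over all
  -- splittings x = u x' with u in L₁. Both ingredients range over finite sets.
  refine ⟨(L₁.leftQuotient x, {q | ∃ u x', u ++ x' = x ∧ u ∈ L₁ ∧ q = L₂.leftQuotient x'}),
    ⟨⟨x, rfl⟩, ?_⟩, ?_⟩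
  · rintro _ ⟨u, x', -, -, rfl⟩
    exact ⟨x', rfl⟩
  · ext y
    constructor
    · rintro (hy | ⟨_, ⟨u, x', rfl, hu, rfl⟩, hy⟩)
      · obtain ⟨a, ha, b, hb, rfl⟩ := mem_mul.1 hy
        exact mem_mul.2 ⟨x ++ a, ha, b, hb, by simp⟩
      · exact mem_mul.2 ⟨u, hu, x' ++ y, hy, by simp⟩
    · intro hy
      obtain ⟨a, ha, b, hb, hab⟩ := mem_mul.1 hy
      rcases List.append_eq_append_iff.1 hab with ⟨c, rfl, rfl⟩ | ⟨c, rfl, rfl⟩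
      · exact Or.inr ⟨_, ⟨a, c, rfl, ha, rfl⟩, hb⟩
      · exact Or.inl (mem_mul.2 ⟨c, ha, b, hb, rfl⟩)

/-- The cut between x and y falls into some factor, whose part in x is x', or there is no later
factor. The second alternative covers words that end at the cut. -/
theorem append_mem_kstar_iff {α : Type} {L : Language α} {x y : List α} :
    x ++ y ∈ L∗ ↔ (∃ u x', u ++ x' = x ∧ u ∈ L∗ ∧ y ∈ L.leftQuotient x' * L∗) ∨
      (x ∈ L∗ ∧ y = []) := by
  constructor
  · intro h
    obtain ⟨S, hS, hL⟩ := mem_kstar.1 h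
    clear h
    induction S generalizing x with
    | nil =>
      simp only [List.flatten_nil, List.append_eq_nil_iff] at hS
      exact Or.inr ⟨hS.1 ▸ nil_mem_kstar L, hS.2⟩
    | cons z S ih =>
      have hz := hL z (by simp)
      have hS' : ∀ y ∈ S, y ∈ L := fun y hy => hL y (by simp [hy])
      rw [List.flatten_cons] at hS
      rcases List.append_eq_append_iff.1 hS with ⟨c, rfl, rfl⟩ | ⟨c, rfl, hc⟩
      · exact Or.inl ⟨[], x, rfl, nil_mem_kstar L,
          mem_mul.2 ⟨c, hz, S.flatten, join_mem_kstar hS', rfl⟩⟩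
      · rcases ih hc.symm hS' with ⟨u, x', rfl, hu, hy⟩ | ⟨hx, rfl⟩
        · refine Or.inl ⟨z ++ u, x', by simp, ?_, hy⟩
          rw [← one_add_self_mul_kstar_eq_kstar]
          exact Or.inr (append_mem_mul hz hu)
        · refine Or.inr ⟨?_, rfl⟩
          rw [← one_add_self_mul_kstar_eq_kstar]
          exact Or.inr (append_mem_mul hz hx)
  · rintro (⟨u, x', rfl, hu, hy⟩ | ⟨hx, rfl⟩)
    · obtain ⟨a, ha, b, hb, rfl⟩ := mem_mul.1 hy
      rw [← kstar_mul_kstar L, ← one_add_self_mul_kstar_eq_kstar L, mul_add,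
        one_add_self_mul_kstar_eq_kstar L]
      refine Or.inr (mem_mul.2 ⟨u, hu, (x' ++ a) ++ b, append_mem_mul ha hb, by simp⟩)
    · simpa using hx

theorem IsRegular.kstar {α : Type} {L : Language α} (h : L.IsRegular) : (L∗).IsRegular := by
  apply IsRegular.of_finite_range_leftQuotient
  let F : Set (Language α) × Prop → Language α :=
    fun p => {y | (∃ q ∈ p.1, y ∈ q * L∗) ∨ (p.2 ∧ y = [])}
  refine Set.Finite.subset (((h.finite_range_leftQuotient.powerset).prod
    (Set.finite_univ (α := Prop))).image F) ?_
  rintro _ ⟨x, rfl⟩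
  refine ⟨({q | ∃ u x', u ++ x' = x ∧ u ∈ L∗ ∧ q = L.leftQuotient x'}, x ∈ L∗),
    ⟨?_, trivial⟩, ?_⟩
  · rintro _ ⟨u, x', -, -, rfl⟩
    exact ⟨x', rfl⟩
  · ext y
    rw [mem_leftQuotient, append_mem_kstar_iff]
    constructor
    · rintro (⟨_, ⟨u, x', hx, hu, rfl⟩, hy⟩ | h)
      · exact Or.inl ⟨u, x', hx, hu, hy⟩
      · exact Or.inr h
    · rintro (⟨u, x', hx, hu, hy⟩ | h)
      · exact Or.inl ⟨_, ⟨u, x', hx, hu, rfl⟩, hy⟩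
      · exact Or.inr h

theorem isRegular_one {α : Type} : (1 : Language α).IsRegular := by
  apply IsRegular.of_finite_range_leftQuotient
  refine Set.Finite.subset (s := {0, 1}) (by simp) ?_
  rintro _ ⟨x, rfl⟩
  rcases x with _ | ⟨a, x⟩
  · exact Or.inr rfl
  · refine Or.inl ?_
    ext y
    simp [mem_one]

/-- The language of all one-letter words with a letter in `s`. -/
def ofLetters {α : Type} (s : Set α) : Language α := {w | ∃ a ∈ s, w = [a]}

theorem isRegular_ofLetters {α : Type} (s : Set α) : (ofLetters s).IsRegular := by
  apply IsRegular.of_finite_range_leftQuotient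
  refine Set.Finite.subset (s := {0, 1, ofLetters s}) (by simp) ?_
  rintro _ ⟨x, rfl⟩
  rcases x with _ | ⟨a, _ | ⟨b, x⟩⟩
  · exact Or.inr (Or.inr rfl)
  · by_cases ha : a ∈ s
    · refine Or.inr (Or.inl ?_)
      ext y
      simp only [mem_leftQuotient, mem_one]
      exact ⟨fun ⟨b, _, h⟩ => by simpa using (List.cons.inj h).2,
        fun h => ⟨a, ha, by simp [h]⟩⟩
    · refine Or.inl ?_
      ext y
      simp only [mem_leftQuotient, notMem_zero, iff_false]
      rintro ⟨b, hb, h⟩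
      exact ha ((List.cons.inj h).1 ▸ hb)
  · refine Or.inl ?_
    ext y
    simp only [mem_leftQuotient, notMem_zero, iff_false]
    rintro ⟨b, hb, h⟩
    simp at h

theorem mem_kstar_ofLetters {α : Type} {s : Set α} {w : List α} :
    w ∈ (ofLetters s)∗ ↔ ∀ a ∈ w, a ∈ s := by
  constructor
  · intro h
    obtain ⟨S, rfl, hS⟩ := mem_kstar.1 h
    intro a ha
    obtain ⟨l, hl, hal⟩ := List.mem_flatten.1 ha
    obtain ⟨b, hb, rfl⟩ := hS l hl
    simpa [List.mem_singleton.1 hal] using hb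
  · intro h
    refine mem_kstar.2 ⟨w.map fun a => [a], (List.flatMap_singleton' w).symm, ?_⟩
    intro y hy
    obtain ⟨a, ha, rfl⟩ := List.mem_map.1 hy
    exact ⟨a, h a ha, rfl⟩

theorem IsRegular.preimage_map {α β : Type} {L : Language α} (h : L.IsRegular) (f : β → α) :
    IsRegular ({w | w.map f ∈ L} : Language β) := by
  obtain ⟨σ, _, M, rfl⟩ := h
  refine ⟨σ, inferInstance, M.comap f, ?_⟩
  rw [DFA.accepts_comap]
  rfl

/-- A regular language is recognized by a finite algebra that reads words from right to left. -/
theorem IsRegular.exists_foldr {α : Type} {L : Language α} (h : L.IsRegular) :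
    ∃ (M : Type) (_ : Fintype M) (step : α → M → M) (init : M) (acc : M → Prop),
      ∀ w, w ∈ L ↔ acc (w.foldr step init) := by
  obtain ⟨σ, _, D, rfl⟩ := h
  classical
  -- The value of a suffix is the set of states from which it is accepted. This backward reading
  -- fits trees that carry the end of the word at the deepest node.
  refine ⟨Set σ, inferInstance, fun a p => {q | D.step q a ∈ p}, D.accept,
    fun p => D.start ∈ p, fun w => ?_⟩
  have key : ∀ (w : List α) (q : σ), q ∈ w.foldr (fun a p => {q | D.step q a ∈ p}) D.accept ↔
      D.evalFrom q w ∈ D.accept := by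
    intro w
    induction w with
    | nil => intro q; rfl
    | cons a w ih => intro q; exact ih (D.step q a)
  exact (key w D.start).symm

end Language

/-! ### Counter programs as regular languages of actions -/

namespace CounterProgram

open scoped Computability

/-- The elementary actions on integer counters indexed by `ℕ`. -/
inductive Act where
  | inc (j : ℕ)
  | dec (j : ℕ)
  | test (j : ℕ)

namespace Act

/-- The counter that an action refers to. -/
def index : Act → ℕ
  | inc j => j
  | dec j => j
  | test j => j

/-- The change of the counters effected by an action. -/
def effect : Act → ℕ → ℤ
  | inc j => Pi.single j 1
  | dec j => Pi.single j (-1)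
  | test _ => 0

/-- An action is enabled unless it is a zero test of a counter that is not zero. -/
def Enabled : Act → (ℕ → ℤ) → Prop
  | test j, c => c j = 0
  | _, _ => True

end Act

/-- The word of actions `w` leads from `c` to `d`. -/
def Exec : List Act → (ℕ → ℤ) → (ℕ → ℤ) → Prop
  | [], c, d => d = c
  | a :: w, c, d => a.Enabled c ∧ Exec w (c + a.effect) d

theorem exec_append {u v : List Act} {c d : ℕ → ℤ} :
    Exec (u ++ v) c d ↔ ∃ e, Exec u c e ∧ Exec v e d := by
  induction u generalizing c with
  | nil => simp [Exec]
  | cons a u ih => simp [Exec, ih, and_assoc]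

/-- Some word in `L` leads from `c` to `d`. -/
def Reach (L : Language Act) (c d : ℕ → ℤ) : Prop := ∃ w ∈ L, Exec w c d

theorem reach_mul {L₁ L₂ : Language Act} {c d : ℕ → ℤ} :
    Reach (L₁ * L₂) c d ↔ ∃ e, Reach L₁ c e ∧ Reach L₂ e d := by
  constructor
  · rintro ⟨w, hw, h⟩
    obtain ⟨u, hu, v, hv, rfl⟩ := Language.mem_mul.1 hw
    obtain ⟨e, h₁, h₂⟩ := exec_append.1 h
    exact ⟨e, ⟨u, hu, h₁⟩, v, hv, h₂⟩
  · rintro ⟨e, ⟨u, hu, h₁⟩, v, hv, h₂⟩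
    exact ⟨u ++ v, Language.append_mem_mul hu hv, exec_append.2 ⟨e, h₁, h₂⟩⟩

theorem reach_one {c d : ℕ → ℤ} : Reach 1 c d ↔ d = c := by
  constructor
  · rintro ⟨w, rfl, h⟩
    exact h
  · exact fun h => ⟨[], rfl, h⟩

/-- The language that consists of the one-letter word `a`. -/
def act (a : Act) : Language Act := Language.ofLetters {a}

theorem reach_act {a : Act} {c d : ℕ → ℤ} :
    Reach (act a) c d ↔ a.Enabled c ∧ d = c + a.effect := by
  constructor
  · rintro ⟨w, ⟨b, rfl, rfl⟩, h⟩
    exact h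
  · exact fun h => ⟨[a], ⟨a, rfl, rfl⟩, h⟩

/-- From `c`, the language `L` leads exactly to `d`. -/
def Det (L : Language Act) (c d : ℕ → ℤ) : Prop := ∀ e, Reach L c e ↔ e = d

theorem Det.mul {L₁ L₂ : Language Act} {c d e : ℕ → ℤ} (h₁ : Det L₁ c d) (h₂ : Det L₂ d e) :
    Det (L₁ * L₂) c e := by
  intro x
  rw [reach_mul]
  constructor
  · rintro ⟨y, hy, hx⟩
    rw [h₁ y] at hy
    subst hy
    exact (h₂ x).1 hx
  · rintro rfl
    exact ⟨d, (h₁ d).2 rfl, (h₂ x).2 rfl⟩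

theorem det_one {c : ℕ → ℤ} : Det 1 c c := fun _ => reach_one

theorem det_inc {j : ℕ} {c : ℕ → ℤ} : Det (act (.inc j)) c (c + Pi.single j 1) :=
  fun _ => by simp [reach_act, Act.Enabled, Act.effect]

theorem det_dec {j : ℕ} {c : ℕ → ℤ} : Det (act (.dec j)) c (c + Pi.single j (-1)) :=
  fun _ => by simp [reach_act, Act.Enabled, Act.effect]

theorem reach_kstar_of_det {L : Language Act} {C : ℕ → ℕ → ℤ}
    (h : ∀ k, Det L (C k) (C (k + 1))) {d : ℕ → ℤ} : Reach L∗ (C 0) d ↔ ∃ k, d = C k := by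
  constructor
  · rintro ⟨w, hw, hd⟩
    obtain ⟨S, rfl, hS⟩ := Language.mem_kstar.1 hw
    have : ∀ (S : List (List Act)) (i : ℕ), (∀ y ∈ S, y ∈ L) → Exec S.flatten (C i) d →
        ∃ k, d = C k := by
      intro S
      induction S with
      | nil => exact fun i _ hd => ⟨i, hd⟩
      | cons z S ih =>
        intro i hS hd
        rw [List.flatten_cons, exec_append] at hd
        obtain ⟨e, he, hd⟩ := hd
        have : e = C (i + 1) := (h i e).1 ⟨z, hS z (by simp), he⟩
        subst this
        exact ih (i + 1) (fun y hy => hS y (by simp [hy])) hd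
    exact this S 0 hS hd
  · rintro ⟨k, rfl⟩
    induction k with
    | zero => exact ⟨[], Language.nil_mem_kstar L, rfl⟩
    | succ k ih =>
      have h' : Reach (L∗ * L) (C 0) (C (k + 1)) := reach_mul.2 ⟨_, ih, (h k _).2 rfl⟩
      obtain ⟨w, hw, hd⟩ := h'
      refine ⟨w, ?_, hd⟩
      rw [← Language.one_add_kstar_mul_self_eq_kstar]
      exact Or.inr hw

/-- The loop that repeats `L` and ends with a zero test of the counter `j`. -/
def loop (L : Language Act) (j : ℕ) : Language Act := L∗ * act (.test j)

/-- The star may stop too early or run too long. The counters are integers, so overshooting makes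
the counter `j` negative, and only the exit after exactly m rounds passes the test. -/
theorem det_loop {L : Language Act} {j m : ℕ} {C : ℕ → ℕ → ℤ}
    (h : ∀ k, Det L (C k) (C (k + 1))) (hC : ∀ k, C k j = m - k) : Det (loop L j) (C 0) (C m) := by
  intro e
  rw [loop, reach_mul]
  simp only [reach_kstar_of_det h, reach_act, Act.Enabled, Act.effect, add_zero]
  constructor
  · rintro ⟨_, ⟨k, rfl⟩, hk, rfl⟩
    rw [hC] at hk
    have : k = m := by omega
    rw [this]
  · rintro rfl
    exact ⟨_, ⟨m, rfl⟩, by rw [hC]; simp, rfl⟩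

/-- A regular language of actions on finitely many counters. -/
structure IsProgram (L : Language Act) : Prop where
  regular : L.IsRegular
  bounded : ∃ K, ∀ w ∈ L, ∀ a ∈ w, a.index < K

theorem isProgram_one : IsProgram 1 :=
  ⟨Language.isRegular_one, 0, by rintro w rfl a ha; simp at ha⟩

theorem isProgram_act (a : Act) : IsProgram (act a) :=
  ⟨Language.isRegular_ofLetters _, a.index + 1, by
    rintro w ⟨b, rfl, rfl⟩ c hc
    rw [List.mem_singleton.1 hc]
    exact Nat.lt_succ_self _⟩

theorem IsProgram.mul {L₁ L₂ : Language Act} (h₁ : IsProgram L₁) (h₂ : IsProgram L₂) :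
    IsProgram (L₁ * L₂) := by
  obtain ⟨r₁, K₁, b₁⟩ := h₁
  obtain ⟨r₂, K₂, b₂⟩ := h₂
  refine ⟨r₁.mul r₂, max K₁ K₂, fun w hw a ha => ?_⟩
  obtain ⟨u, hu, v, hv, rfl⟩ := Language.mem_mul.1 hw
  rcases List.mem_append.1 ha with h | h
  · exact lt_max_of_lt_left (b₁ u hu a h)
  · exact lt_max_of_lt_right (b₂ v hv a h)

theorem IsProgram.kstar {L : Language Act} (h : IsProgram L) : IsProgram L∗ := by
  obtain ⟨r, K, b⟩ := h
  refine ⟨r.kstar, K, fun w hw a ha => ?_⟩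
  obtain ⟨S, rfl, hS⟩ := Language.mem_kstar.1 hw
  obtain ⟨l, hl, hal⟩ := List.mem_flatten.1 ha
  exact b l (hS l hl) a hal

theorem IsProgram.loop {L : Language Act} (h : IsProgram L) (j : ℕ) : IsProgram (loop L j) :=
  h.kstar.mul (isProgram_act _)

/-- The program that moves the content of the counter `i` to `j`. -/
def move (i j : ℕ) : Language Act := loop (act (.dec i) * act (.inc j)) i

theorem isProgram_move (i j : ℕ) : IsProgram (move i j) :=
  ((isProgram_act _).mul (isProgram_act _)).loop _

theorem det_move {i j m : ℕ} (hij : i ≠ j) {c : ℕ → ℤ} (hc : c i = m) :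
    Det (move i j) c (c + Pi.single i (-m : ℤ) + Pi.single j (m : ℤ)) := by
  have := det_loop (L := act (.dec i) * act (.inc j)) (j := i) (m := m)
    (C := fun k => c + Pi.single i (-k : ℤ) + Pi.single j (k : ℤ)) (fun k => ?_) (fun k => ?_)
  · simpa [move] using this
  · convert det_dec.mul det_inc using 1
    funext r
    simp only [Pi.add_apply, Pi.single_apply]
    push_cast
    split_ifs <;> ring
  · simp [hij, hc]
    ring

/-- The program that resets the counter `i` to zero. -/
def clear (i : ℕ) : Language Act := loop (act (.dec i)) i

theorem isProgram_clear (i : ℕ) : IsProgram (clear i) := (isProgram_act _).loop _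

theorem det_clear {i m : ℕ} {c : ℕ → ℤ} (hc : c i = m) :
    Det (clear i) c (c + Pi.single i (-m : ℤ)) := by
  have := det_loop (L := act (.dec i)) (j := i) (m := m)
    (C := fun k => c + Pi.single i (-k : ℤ)) (fun k => ?_) (fun k => ?_)
  · simpa [clear] using this
  · convert det_dec using 1
    funext r
    simp only [Pi.add_apply, Pi.single_apply]
    push_cast
    split_ifs <;> ring
  · simp [hc]
    ring

/-- The program that adds the content of the counter `i` to `o`, with the auxiliary counter `s`. -/
def copy (i o s : ℕ) : Language Act :=
  move i s * loop (act (.dec s) * (act (.inc i) * act (.inc o))) s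

theorem isProgram_copy (i o s : ℕ) : IsProgram (copy i o s) :=
  (isProgram_move _ _).mul
    (((isProgram_act _).mul ((isProgram_act _).mul (isProgram_act _))).loop _)

theorem det_copy {i o s m : ℕ} (hi : i < s) (ho : o < s) {c : ℕ → ℤ} (hc : c i = m)
    (hs : c s = 0) : Det (copy i o s) c (c + Pi.single o (m : ℤ)) := by
  refine (det_move hi.ne hc).mul ?_
  have := det_loop (L := act (.dec s) * (act (.inc i) * act (.inc o))) (j := s) (m := m)
    (C := fun k => c + Pi.single i (-m : ℤ) + Pi.single s (m : ℤ) + Pi.single s (-k : ℤ)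
      + Pi.single i (k : ℤ) + Pi.single o (k : ℤ)) (fun k => ?_) (fun k => ?_)
  · convert this using 1
    · simp
    · funext r
      simp only [Pi.add_apply, Pi.single_apply]
      split_ifs <;> ring
  · convert det_dec.mul (det_inc.mul det_inc) using 1
    funext r
    simp only [Pi.add_apply, Pi.single_apply]
    push_cast
    split_ifs <;> ring
  · simp [hi.ne', ho.ne', hs]
    ring

/-! ### Programs for primitive recursive functions -/

/-- The program `L` adds `f v` to the counter `o` if the counters `ins` contain `v` and the counters
from `s` on, which are auxiliary, contain zero. -/
def Adds {n : ℕ} (f : List.Vector ℕ n → ℕ) (ins : Fin n → ℕ) (o s : ℕ) (L : Language Act) : Prop :=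
  ∀ (c : ℕ → ℤ) (v : List.Vector ℕ n), (∀ r, s ≤ r → c r = 0) → (∀ k, c (ins k) = v.get k) →
    Det L c (c + Pi.single o (f v : ℤ))

/-- For every choice of the input counters, of the output counter and of the auxiliary counters,
some program computes `f`. -/
def Programmable {n : ℕ} (f : List.Vector ℕ n → ℕ) : Prop :=
  ∀ (ins : Fin n → ℕ) (o s : ℕ), (∀ k, ins k < s) → o < s → (∀ k, ins k ≠ o) →
    ∃ L, IsProgram L ∧ Adds f ins o s L

theorem programmable_zero : Programmable (fun _ : List.Vector ℕ 0 => 0) := fun _ _ _ _ _ _ =>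
  ⟨1, isProgram_one, fun c v _ _ => by simpa using det_one⟩

theorem programmable_get {n : ℕ} (i : Fin n) :
    Programmable (fun v : List.Vector ℕ n => v.get i) := fun ins o s hi ho _ =>
  ⟨copy (ins i) o s, isProgram_copy _ _ _, fun _ _ hc hv =>
    det_copy (hi i) ho (hv i) (hc s le_rfl)⟩

theorem programmable_succ : Programmable (fun v : List.Vector ℕ 1 => Nat.succ v.head) :=
  fun ins o s hi ho _ =>
  ⟨copy (ins 0) o s * act (.inc o), (isProgram_copy _ _ _).mul (isProgram_act _), by
    intro c v hc hv
    convert (det_copy (hi 0) ho (hv 0) (hc s le_rfl)).mul det_inc using 1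
    rw [List.Vector.get_zero, add_assoc, ← Pi.single_add, Nat.cast_succ]⟩

/-- The counters `c` with the values `G 0, …, G (p - 1)` added to the counters from `s` on. -/
def fill (c : ℕ → ℤ) (s p : ℕ) (G : ℕ → ℕ) : ℕ → ℤ :=
  fun r => c r + if s ≤ r ∧ r < s + p then (G (r - s) : ℤ) else 0

theorem fill_zero (c : ℕ → ℤ) (s : ℕ) (G : ℕ → ℕ) : fill c s 0 G = c := by
  funext r
  simp only [fill]
  rw [if_neg (by omega), add_zero]

theorem fill_succ (c : ℕ → ℤ) (s p : ℕ) (G : ℕ → ℕ) :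
    fill c s (p + 1) G = fill c s p G + Pi.single (s + p) (G p : ℤ) := by
  funext r
  simp only [fill, Pi.add_apply, Pi.single_apply]
  by_cases hr : r = s + p
  · subst hr
    simp
  · rw [if_neg hr, add_zero]
    congr 1
    apply if_congr _ rfl rfl
    omega

theorem exists_det_fill {m : ℕ} (Ls : ℕ → Language Act) (hL : ∀ k < m, IsProgram (Ls k)) (s p : ℕ)
    (hp : p ≤ m) : ∃ L, IsProgram L ∧ ∀ (c : ℕ → ℤ) (G : ℕ → ℕ),
      (∀ k < m, Det (Ls k) (fill c s k G) (fill c s (k + 1) G)) → Det L c (fill c s p G) := by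
  induction p with
  | zero => exact ⟨1, isProgram_one, fun c G _ => by rw [fill_zero]; exact det_one⟩
  | succ p ih =>
    obtain ⟨L, hL', h⟩ := ih (by omega)
    exact ⟨L * Ls p, hL'.mul (hL p hp), fun c G hG => (h c G hG).mul (hG p hp)⟩

theorem exists_det_unfill (s p : ℕ) : ∃ L, IsProgram L ∧ ∀ (c : ℕ → ℤ) (G : ℕ → ℕ),
    (∀ r, s ≤ r → c r = 0) → Det L (fill c s p G) c := by
  induction p with
  | zero => exact ⟨1, isProgram_one, fun c G _ => by rw [fill_zero]; exact det_one⟩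
  | succ p ih =>
    obtain ⟨L, hL, h⟩ := ih
    refine ⟨clear (s + p) * L, (isProgram_clear _).mul hL, fun c G hc => ?_⟩
    refine Det.mul ?_ (h c G hc)
    convert det_clear (m := G p) _ using 1
    · rw [fill_succ, add_assoc, ← Pi.single_add]
      simp
    · simp [fill, hc]

/-- The inner values are stored in the counters `s, …, s + n - 1`, the outer program reads them
there with its auxiliary counters from `s + n` on, and they are then erased. -/
theorem Programmable.comp {m n : ℕ} {f : List.Vector ℕ n → ℕ}
    {g : Fin n → List.Vector ℕ m → ℕ} (hf : Programmable f) (hg : ∀ i, Programmable (g i)) :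
    Programmable (fun a => f (List.Vector.ofFn fun i => g i a)) := by
  intro ins o s hi ho hio
  have h₁ : ∀ k : Fin n, ∃ L, IsProgram L ∧ Adds (g k) ins (s + k) (s + n) L := fun k =>
    hg k ins (s + k) (s + n) (fun i => (hi i).trans_le (by omega)) (by omega)
      (fun i => by have := hi i; omega)
  choose Ls hLs hadd using h₁
  let Ls' : ℕ → Language Act := fun k => if h : k < n then Ls ⟨k, h⟩ else 1
  obtain ⟨L₁, p₁, d₁⟩ := exists_det_fill (m := n) Ls'
    (fun k hk => by simp only [Ls', hk, dite_true]; exact hLs _) s n le_rfl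
  obtain ⟨L₂, p₂, d₂⟩ := hf (fun k => s + k) o (s + n) (fun k => by omega) (by omega)
    (fun k => by omega)
  obtain ⟨L₃, p₃, d₃⟩ := exists_det_unfill s n
  refine ⟨L₁ * (L₂ * L₃), p₁.mul (p₂.mul p₃), fun c v hc hv => ?_⟩
  let G : ℕ → ℕ := fun k => if h : k < n then g ⟨k, h⟩ v else 0
  set u := List.Vector.ofFn fun i => g i v with hu
  refine (d₁ c G fun k hk => ?_).mul ((d₂ (fill c s n G) u (fun r hr => ?_) fun k => ?_).mul ?_)
  · have hk' : Ls' k = Ls ⟨k, hk⟩ := by simp [Ls', hk]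
    rw [hk', fill_succ]
    have : G k = g ⟨k, hk⟩ v := by simp [G, hk]
    rw [this]
    refine hadd ⟨k, hk⟩ (fill c s k G) v (fun r hr => ?_) (fun i => ?_)
    · simp only [fill]
      rw [hc r (by omega), if_neg (by omega), add_zero]
    · simp only [fill]
      have := hi i
      rw [hv, if_neg (by omega), add_zero]
  · simp only [fill]
    rw [hc r (by omega), if_neg (by omega), add_zero]
  · simp only [fill, G, hu]
    rw [hc _ (by omega), if_pos (by omega)]
    simp
  -- The output counter lies below `s`, so its update commutes with erasing the stored values.
  · have : fill c s n G + Pi.single o (f u : ℤ) = fill (c + Pi.single o (f u : ℤ)) s n G := by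
      funext r
      simp only [fill, Pi.add_apply]
      ring
    rw [this]
    refine d₃ _ G fun r hr => ?_
    simp [hc r hr, show r ≠ o by omega]

theorem Programmable.prec {n : ℕ} {f : List.Vector ℕ n → ℕ} {g : List.Vector ℕ (n + 2) → ℕ}
    (hf : Programmable f) (hg : Programmable g) :
    Programmable (fun v : List.Vector ℕ (n + 1) =>
      v.head.rec (f v.tail) fun y IH => g (y ::ᵥ IH ::ᵥ v.tail)) := by
  intro ins o s hi ho hio
  -- The counters `s`, `s + 1`, `s + 2`, `s + 3` hold the value, the index, the remaining number of
  -- rounds and the next value.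
  obtain ⟨L₁, p₁, d₁⟩ := hf (fun k => ins k.succ) s (s + 4) (fun k => (hi _).trans_le (by omega))
    (by omega) (fun k => (hi _).ne)
  obtain ⟨L₂, p₂, d₂⟩ := hg (Fin.cons (s + 1) (Fin.cons s fun k => ins k.succ)) (s + 3) (s + 4)
    (fun k => by
      refine Fin.cases (by simp) (fun k => Fin.cases (by simp) (fun k => ?_) k) k
      simpa using (hi k.succ).trans_le (by omega))
    (by omega) (fun k => by
      refine Fin.cases (by simp) (fun k => Fin.cases (by simp) (fun k => ?_) k) k
      have := hi k.succ
      simpa using (by omega : ins k.succ ≠ s + 3))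
  let body := act (.dec (s + 2)) * (L₂ * (clear s * (move (s + 3) s * act (.inc (s + 1)))))
  refine ⟨L₁ * (copy (ins 0) (s + 2) (s + 4) * (loop body (s + 2) *
    (move s o * clear (s + 1)))), ?_, fun c v hc hv => ?_⟩
  · exact p₁.mul ((isProgram_copy _ _ _).mul ((((isProgram_act _).mul (p₂.mul
      ((isProgram_clear _).mul ((isProgram_move _ _).mul (isProgram_act _))))).loop _).mul
      ((isProgram_move _ _).mul (isProgram_clear _))))
  · set R : ℕ → ℕ := fun k => k.rec (f v.tail) fun y IH => g (y ::ᵥ IH ::ᵥ v.tail) with hR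
    have hR0 : R 0 = f v.tail := rfl
    have hRs : ∀ k, R (k + 1) = g (k ::ᵥ R k ::ᵥ v.tail) := fun k => rfl
    set m := v.head with hm
    -- Loop invariant: after k rounds the value is `R k`, the index is k, and m - k rounds remain.
    let C : ℕ → ℕ → ℤ := fun k => c + Pi.single s (R k : ℤ) + Pi.single (s + 1) (k : ℤ) +
      Pi.single (s + 2) (m - k : ℤ)
    have hin : ∀ k r, s ≤ r → ins k ≠ r := fun k r hr => by have := hi k; omega
    have hCin : ∀ k i, C k (ins i) = v.get i := by
      intro k i
      simp [C, hin, hv]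
    have e₁ : Det L₁ c (c + Pi.single s (R 0 : ℤ)) :=
      d₁ c v.tail (fun r hr => hc r (by omega)) (fun k => by rw [hv, List.Vector.get_tail_succ])
    have e₂ : Det (copy (ins 0) (s + 2) (s + 4)) (c + Pi.single s (R 0 : ℤ)) (C 0) := by
      have := det_copy (i := ins 0) (o := s + 2) (s := s + 4) (m := m)
        (c := c + Pi.single s (R 0 : ℤ)) ((hi 0).trans_le (by omega)) (by omega)
        (by simp [hin, hv, hm]) (by simp [hc])
      simpa [C] using this
    have e₃ : Det (loop body (s + 2)) (C 0) (C m) := by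
      refine det_loop (fun k => ?_) (fun k => by simp [C, hc])
      have b₁ := det_dec (j := s + 2) (c := C k)
      have b₂ := d₂ (C k + Pi.single (s + 2) (-1)) (k ::ᵥ R k ::ᵥ v.tail)
        (fun r hr => by
          simp [C, hc r (by omega), show r ≠ s by omega,
            show r ≠ s + 1 by omega, show r ≠ s + 2 by omega])
        (fun i => by
          refine Fin.cases ?_ (fun i => Fin.cases ?_ (fun i => ?_) i) i
          · simp [C, hc]
          · rw [List.Vector.get_cons_succ]
            simp [C, hc]
          · rw [Pi.add_apply, Fin.cons_succ, Fin.cons_succ, hCin, List.Vector.get_cons_succ,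
              List.Vector.get_cons_succ, List.Vector.get_tail_succ, Pi.single_apply,
              if_neg (hin _ _ (by omega)), add_zero])
      rw [← hRs] at b₂
      have b₃ := det_clear (i := s) (m := R k)
        (c := C k + Pi.single (s + 2) (-1) + Pi.single (s + 3) (R (k + 1) : ℤ)) (by simp [C, hc])
      have b₄ := det_move (i := s + 3) (j := s) (m := R (k + 1)) (by omega)
        (c := C k + Pi.single (s + 2) (-1) + Pi.single (s + 3) (R (k + 1) : ℤ) +
          Pi.single s (-(R k : ℤ))) (by simp [C, hc])
      convert b₁.mul (b₂.mul (b₃.mul (b₄.mul (det_inc (j := s + 1))))) using 1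
      funext r
      simp only [C, Pi.add_apply, Pi.single_apply]
      push_cast
      split_ifs <;> ring
    have e₄ := det_move (i := s) (j := o) (m := R m) (by omega) (c := C m) (by simp [C, hc])
    have e₅ := det_clear (i := s + 1) (m := m)
      (c := C m + Pi.single s (-(R m : ℤ)) + Pi.single o (R m : ℤ))
      (by simp [C, hc, show s + 1 ≠ o by omega])
    convert e₁.mul (e₂.mul (e₃.mul (e₄.mul e₅))) using 1
    funext r
    simp only [C, Pi.add_apply, Pi.single_apply]
    split_ifs <;> ring

theorem programmable_of_primrec {n : ℕ} {f : List.Vector ℕ n → ℕ} (h : Nat.Primrec' f) :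
    Programmable f := by
  induction h with
  | zero => exact programmable_zero
  | succ => exact programmable_succ
  | get i => exact programmable_get i
  | comp g _ _ hf hg => exact hf.comp hg
  | prec _ _ hf hg => exact hf.prec hg

/-- The halting problem for pairs of a code and an input. -/
def Halts (n : ℕ) : Prop :=
  ((Denumerable.ofNat Nat.Partrec.Code n.unpair.1).eval n.unpair.2).Dom

/-- Evaluation with a bound k on the resources is primitive recursive, and a computation halts if
and only if it does so within some bound. -/
theorem exists_primrec_halts : ∃ f : ℕ → ℕ → ℕ, Primrec₂ f ∧ ∀ n, Halts n ↔ ∃ k, f n k = 0 := by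
  refine ⟨fun n k => bif (Nat.Partrec.Code.evaln k (Denumerable.ofNat Nat.Partrec.Code n.unpair.1)
    n.unpair.2).isSome then 0 else 1, ?_, fun n => ?_⟩
  · refine Primrec.cond (Primrec.option_isSome.comp (Nat.Partrec.Code.primrec_evaln.comp
      ((Primrec.snd.pair ((Primrec.ofNat Nat.Partrec.Code).comp
        (Primrec.fst.comp (Primrec.unpair.comp Primrec.fst)))).pair
        (Primrec.snd.comp (Primrec.unpair.comp Primrec.fst))))) (Primrec.const 0) (Primrec.const 1)
  · rw [Halts, Part.dom_iff_mem]
    constructor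
    · rintro ⟨x, hx⟩
      obtain ⟨k, hk⟩ := Nat.Partrec.Code.evaln_complete.1 hx
      refine ⟨k, ?_⟩
      simp [Option.mem_def.1 hk]
    · rintro ⟨k, hk⟩
      rcases h : Nat.Partrec.Code.evaln k (Denumerable.ofNat Nat.Partrec.Code n.unpair.1)
        n.unpair.2 with _ | x
      · simp [h] at hk
      · exact ⟨x, Nat.Partrec.Code.evaln_sound h⟩

theorem exec_replicate_inc (n : ℕ) (c : ℕ → ℤ) (d : ℕ → ℤ) (w : List Act) :
    Exec (List.replicate n (Act.inc 0) ++ w) c d ↔ Exec w (c + Pi.single 0 (n : ℤ)) d := by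
  induction n generalizing c with
  | zero => simp
  | succ n ih =>
    rw [List.replicate_succ, List.cons_append, Exec, ih]
    simp only [Act.Enabled, true_and, Act.effect, add_assoc, ← Pi.single_add]
    rw [Nat.cast_succ, add_comm (1 : ℤ)]

theorem exists_program_halts : ∃ L, IsProgram L ∧
    ∀ n, Halts n ↔ ∃ w ∈ L, ∃ d, Exec (List.replicate n (Act.inc 0) ++ w) 0 d := by
  obtain ⟨f, hf, h⟩ := exists_primrec_halts
  obtain ⟨L, hL, hadd⟩ := programmable_of_primrec (Nat.Primrec'.prim_iff₂.2 hf)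
    (fun k => k) 2 3 (fun k => by omega) (by omega) (fun k => by omega)
  -- The star guesses the witness k in the counter 1, `L` puts f n k into the counter 2, and the
  -- final zero test accepts. The unbounded search is thus left to nondeterminism.
  refine ⟨(act (.inc 1))∗ * (L * act (.test 2)),
    (isProgram_act _).kstar.mul (hL.mul (isProgram_act _)), fun n => ?_⟩
  have key : ∀ k : ℕ, Det L (Pi.single 0 (n : ℤ) + Pi.single 1 (k : ℤ))
      (Pi.single 0 (n : ℤ) + Pi.single 1 (k : ℤ) + Pi.single 2 (f n k : ℤ)) := by
    intro k
    refine hadd (Pi.single 0 (n : ℤ) + Pi.single 1 (k : ℤ)) (n ::ᵥ k ::ᵥ .nil) (fun r hr => ?_)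
      (fun i => ?_)
    · simp [show r ≠ 0 by omega, show r ≠ 1 by omega]
    · refine Fin.cases ?_ (fun i => Fin.cases ?_ (fun i => i.elim0) i) i
      · simp
      · rw [List.Vector.get_cons_succ]
        simp
  have star : ∀ e, Reach (act (.inc 1))∗ (Pi.single 0 (n : ℤ)) e ↔
      ∃ k : ℕ, e = Pi.single 0 (n : ℤ) + Pi.single 1 (k : ℤ) := by
    intro e
    have := reach_kstar_of_det (L := act (.inc 1))
      (C := fun k => Pi.single 0 (n : ℤ) + Pi.single 1 (k : ℤ)) (fun k => ?_) (d := e)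
    · simpa using this
    · convert det_inc using 1
      rw [add_assoc, ← Pi.single_add, Nat.cast_succ]
  rw [h]
  have h₁ : (∃ w ∈ (act (.inc 1))∗ * (L * act (.test 2)), ∃ d,
      Exec (List.replicate n (Act.inc 0) ++ w) 0 d) ↔
      ∃ d, Reach ((act (.inc 1))∗ * (L * act (.test 2))) (Pi.single 0 (n : ℤ)) d := by
    simp only [exec_replicate_inc, zero_add, Reach]
    exact ⟨fun ⟨w, hw, d, hd⟩ => ⟨d, w, hw, hd⟩, fun ⟨d, w, hw, hd⟩ => ⟨w, hw, d, hd⟩⟩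
  rw [h₁]
  simp only [reach_mul, star, reach_act]
  constructor
  · rintro ⟨k, hk⟩
    exact ⟨_, _, ⟨k, rfl⟩, _, (key k _).2 rfl, by simp [Act.Enabled, hk], rfl⟩
  · rintro ⟨d, _, ⟨k, rfl⟩, e, he, hen, -⟩
    rw [key k] at he
    subst he
    refine ⟨k, ?_⟩
    simpa [Act.Enabled] using hen

end CounterProgram

/-! ### Deterministic bottom-up recognition -/

namespace TreeAutomatic

/-- The operations of a deterministic bottom-up tree automaton with states `S`. -/
structure TreeAlgebra (α S : Type) where
  leaf : S
  node : α → S → S → S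

namespace TreeAlgebra

variable {α S S' : Type}

/-- The state that is reached at the root of a tree. -/
def fold (A : TreeAlgebra α S) : BinaryTree α → S
  | .nil => A.leaf
  | .node a l r => A.node a (A.fold l) (A.fold r)

/-- The product of two algebras. -/
def prod (A : TreeAlgebra α S) (B : TreeAlgebra α S') : TreeAlgebra α (S × S') where
  leaf := (A.leaf, B.leaf)
  node a x y := (A.node a x.1 y.1, B.node a x.2 y.2)

theorem fold_prod (A : TreeAlgebra α S) (B : TreeAlgebra α S') (t : BinaryTree α) :
    (A.prod B).fold t = (A.fold t, B.fold t) := by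
  induction t with
  | nil => rfl
  | node a l r hl hr =>
    rw [fold, hl, hr]
    rfl

end TreeAlgebra

/-! ### Marked positions on the leftmost branch -/

section Letters

variable {α : Type}

/-- All labels of the tree lie in `Γ`. -/
def LettersIn (Γ : Set α) : BinaryTree α → Prop
  | .nil => True
  | .node a l r => a ∈ Γ ∧ LettersIn Γ l ∧ LettersIn Γ r

/-- The position `0ⁿ` is the only one whose label lies in `M`. -/
def MarkAt (M : Set α) : ℕ → BinaryTree α → Prop
  | _, .nil => False
  | 0, .node a l r => a ∈ M ∧ LettersIn Mᶜ l ∧ LettersIn Mᶜ r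
  | n + 1, .node a l r => a ∉ M ∧ MarkAt M n l ∧ LettersIn Mᶜ r

/-- No label at a position other than `0ⁿ` lies in `M`. -/
def MarkOnlyAt (M : Set α) : ℕ → BinaryTree α → Prop
  | _, .nil => True
  | 0, .node _ l r => LettersIn Mᶜ l ∧ LettersIn Mᶜ r
  | n + 1, .node a l r => a ∉ M ∧ MarkOnlyAt M n l ∧ LettersIn Mᶜ r

theorem markOnlyAt_iff {M : Set α} {n : ℕ} {t : BinaryTree α} :
    MarkOnlyAt M n t ↔ LettersIn Mᶜ t ∨ MarkAt M n t := by
  induction t generalizing n with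
  | nil => simp [MarkOnlyAt, LettersIn]
  | node a l r hl _ =>
    cases n with
    | zero =>
      simp only [MarkOnlyAt, LettersIn, MarkAt, Set.mem_compl_iff]
      tauto
    | succ n =>
      simp only [MarkOnlyAt, LettersIn, MarkAt, Set.mem_compl_iff, hl]
      tauto

end Letters

/-! ### Automata that measure the depth of a mark -/

section CounterAutomaton

variable {α : Type}

/-- The automaton that simulates transitions `T₀` and `T₁` with states below `m` and accepts only if
the transitions in `T₁` are used at most at the position `0ⁿ`. The state `q + m * (d + 1)` expresses
that a transition in `T₁` was used at depth `d` below the current node. -/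
def counterAutomaton (m ι : ℕ) (T₀ T₁ : List (ℕ × α × ℕ × ℕ)) (F : List ℕ) (n : ℕ) :
    TreeAutomaton α where
  numStates := m * (n + 2)
  init := ι
  trans := T₀ ++ (T₁.map fun τ => (τ.1 + m, τ.2)) ++
    (List.range n).flatMap fun i =>
      T₀.map fun τ => (τ.1 + m * (i + 2), τ.2.1, τ.2.2.1 + m * (i + 1), τ.2.2.2)
  final := F ++ F.map fun q => q + m * (n + 1)

theorem computable_counterAutomaton [Primcodable α] (m ι : ℕ) (T₀ T₁ : List (ℕ × α × ℕ × ℕ))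
    (F : List ℕ) : Computable (counterAutomaton m ι T₀ T₁ F) := by
  have h : Primrec fun n : ℕ => (m * (n + 2), ι, T₀ ++ (T₁.map fun τ => (τ.1 + m, τ.2)) ++
      ((List.range n).flatMap fun i =>
        T₀.map fun τ => (τ.1 + m * (i + 2), τ.2.1, τ.2.2.1 + m * (i + 1), τ.2.2.2)),
      F ++ F.map fun q => q + m * (n + 1)) := by
    have hadd : ∀ k, Primrec fun n : ℕ => m * (n + k) := fun k =>
      Primrec.nat_mul.comp (Primrec.const m) (Primrec.nat_add.comp Primrec.id (Primrec.const k))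
    refine (hadd 2).pair ((Primrec.const ι).pair (Primrec.pair ?_ ?_))
    · refine Primrec.list_append.comp (Primrec.const _) (Primrec.list_flatMap Primrec.list_range ?_)
      refine Primrec.list_map (Primrec.const T₀) ?_
      have hi : Primrec fun x : (ℕ × ℕ) × (ℕ × α × ℕ × ℕ) => x.1.2 :=
        Primrec.snd.comp Primrec.fst
      refine Primrec.pair (Primrec.nat_add.comp (Primrec.fst.comp Primrec.snd)
        ((hadd 2).comp hi)) (Primrec.pair (Primrec.fst.comp (Primrec.snd.comp Primrec.snd))
          (Primrec.pair (Primrec.nat_add.comp (Primrec.fst.comp (Primrec.snd.comp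
            (Primrec.snd.comp Primrec.snd))) ((hadd 1).comp hi))
            (Primrec.snd.comp (Primrec.snd.comp (Primrec.snd.comp Primrec.snd)))))
    · refine Primrec.list_append.comp (Primrec.const F) (Primrec.list_map (Primrec.const F) ?_)
      exact Primrec.nat_add.comp Primrec.snd ((hadd 1).comp Primrec.fst)
  exact ((Primrec.of_equiv_symm (e := TreeAutomaton.equivTuple (α := α))).comp h).to_comp

theorem exists_list_of_finite {β : Type} {s : Set β} (hs : s.Finite) : ∃ l : List β, ∀ x, x ∈ l ↔ x ∈ s :=
  ⟨hs.toFinset.toList, by simp⟩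

theorem exists_counterAutomaton [Primcodable α] {S : Type} [Finite S] (Γ M : Set α) (hΓ : Γ.Finite)
    (B : TreeAlgebra α S) (acc : Set S) : ∃ A : ℕ → TreeAutomaton α, Computable A ∧
      ∀ n, (A n).IsOver Γ ∧ ∀ t, t ∈ (A n).language ↔
        IsProper t ∧ LettersIn Γ t ∧ B.fold t ∈ acc ∧ MarkOnlyAt M n t := by
  obtain ⟨m, ⟨σ⟩⟩ := Finite.exists_equiv_fin S
  let f : α × S × S → ℕ × α × ℕ × ℕ := fun x => (σ (B.node x.1 x.2.1 x.2.2), x.1, σ x.2.1, σ x.2.2)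
  obtain ⟨T₀, hT₀⟩ := exists_list_of_finite
    (((hΓ.inter_of_left Mᶜ).prod (Set.finite_univ (α := S × S))).image f)
  obtain ⟨T₁, hT₁⟩ := exists_list_of_finite
    (((hΓ.inter_of_left M).prod (Set.finite_univ (α := S × S))).image f)
  obtain ⟨F, hF⟩ := exists_list_of_finite ((Set.toFinite acc).image fun s => (σ s : ℕ))
  have hlt : ∀ s, (σ s : ℕ) < m := fun s => (σ s).2
  -- Remainder and quotient modulo m recover the simulated state and the layer.
  have huniq : ∀ s s' k k', (σ s : ℕ) + m * k = σ s' + m * k' → s = s' ∧ k = k' := by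
    intro s s' k k' h
    have h₁ := congrArg (· % m) h
    have h₂ := congrArg (· / m) h
    have hm : 0 < m := (Nat.zero_le _).trans_lt (hlt s)
    simp only [Nat.add_mul_mod_self_left, Nat.mod_eq_of_lt (hlt _)] at h₁
    simp only [Nat.add_mul_div_left _ _ hm, Nat.div_eq_of_lt (hlt _), zero_add] at h₂
    exact ⟨σ.injective (Fin.ext h₁), h₂⟩
  refine ⟨counterAutomaton m (σ B.leaf) T₀ T₁ F, computable_counterAutomaton _ _ _ _ _,
    fun n => ?_⟩
  set A := counterAutomaton m (σ B.leaf) T₀ T₁ F n with hA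
  -- Here k₀ and k are the layers of the left child and of the node. The right child must lie in
  -- layer 0, so a mark can be passed upwards along left edges only.
  have htrans : ∀ q a p₀ p₁, (q, a, p₀, p₁) ∈ A.trans ↔ a ∈ Γ ∧ ∃ s₀ s₁ k k₀,
      q = σ (B.node a s₀ s₁) + m * k ∧ p₀ = σ s₀ + m * k₀ ∧ p₁ = σ s₁ ∧
      ((a ∉ M ∧ (k = 0 ∧ k₀ = 0 ∨ ∃ i < n, k₀ = i + 1 ∧ k = i + 2)) ∨ (a ∈ M ∧ k₀ = 0 ∧ k = 1)) := by
    intro q a p₀ p₁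
    simp only [hA, counterAutomaton, List.mem_append, List.mem_map, List.mem_flatMap, hT₀, hT₁,
      Set.mem_image, Set.mem_prod, Set.mem_inter_iff, Set.mem_univ, and_true, Set.mem_compl_iff,
      List.mem_range, f, Prod.mk.injEq]
    constructor
    · rintro ((⟨⟨b, s₀, s₁⟩, ⟨hb, hM⟩, rfl, rfl, rfl, rfl⟩ |
        ⟨_, ⟨⟨b, s₀, s₁⟩, ⟨hb, hM⟩, rfl⟩, rfl, rfl, rfl, rfl⟩) |
        ⟨i, hi, _, ⟨⟨b, s₀, s₁⟩, ⟨hb, hM⟩, rfl⟩, rfl, rfl, rfl, rfl⟩)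
      · exact ⟨hb, s₀, s₁, 0, 0, by simp, by simp, rfl, Or.inl ⟨hM, Or.inl ⟨rfl, rfl⟩⟩⟩
      · exact ⟨hb, s₀, s₁, 1, 0, by simp, by simp, rfl, Or.inr ⟨hM, rfl, rfl⟩⟩
      · exact ⟨hb, s₀, s₁, i + 2, i + 1, rfl, rfl, rfl, Or.inl ⟨hM, Or.inr ⟨i, hi, rfl, rfl⟩⟩⟩
    · rintro ⟨ha, s₀, s₁, k, k₀, rfl, rfl, rfl, ⟨hM, ⟨rfl, rfl⟩ | ⟨i, hi, rfl, rfl⟩⟩ | ⟨hM, rfl, rfl⟩⟩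
      · exact Or.inl (Or.inl ⟨(a, s₀, s₁), ⟨ha, hM⟩, by simp⟩)
      · exact Or.inr ⟨i, hi, _, ⟨(a, s₀, s₁), ⟨ha, hM⟩, rfl⟩, by simp⟩
      · exact Or.inl (Or.inr ⟨_, ⟨(a, s₀, s₁), ⟨ha, hM⟩, rfl⟩, by simp⟩)
  -- Layer 0 means that there is no mark, layer d + 1 that the only mark is at 0ᵈ. There is no layer
  -- above n + 1, so no run exists on a tree with a mark deeper than n.
  have hreach : ∀ t q, A.Reaches t q ↔ LettersIn Γ t ∧ ∃ k, q = σ (B.fold t) + m * k ∧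
      ((k = 0 ∧ LettersIn Mᶜ t) ∨ ∃ d ≤ n, k = d + 1 ∧ MarkAt M d t) := by
    intro t
    induction t with
    | nil =>
      intro q
      simp [TreeAutomaton.Reaches, LettersIn, MarkAt, TreeAlgebra.fold, hA, counterAutomaton]
    | node a l r hl hr =>
      intro q
      simp only [TreeAutomaton.Reaches, hl, hr, htrans, LettersIn, TreeAlgebra.fold,
        Set.mem_compl_iff]
      constructor
      · rintro ⟨_, _, ⟨hΓl, kl, rfl, hkl⟩, ⟨hΓr, kr, rfl, hkr⟩, ha, s₀, s₁, k, k₀, rfl, h₀, h₁, hk⟩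
        obtain ⟨rfl, rfl⟩ := huniq _ _ _ _ h₀
        obtain ⟨rfl, rfl⟩ := huniq _ _ _ 0 (by simpa using h₁)
        refine ⟨⟨ha, hΓl, hΓr⟩, k, rfl, ?_⟩
        have hr' : LettersIn Mᶜ r := by
          rcases hkr with ⟨-, h⟩ | ⟨d, _, h, _⟩
          · exact h
          · omega
        rcases hk with ⟨hM, ⟨rfl, rfl⟩ | ⟨i, hi, rfl, rfl⟩⟩ | ⟨hM, rfl, rfl⟩
        · rcases hkl with ⟨-, h⟩ | ⟨d, _, h, _⟩
          · exact Or.inl ⟨rfl, hM, h, hr'⟩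
          · omega
        · rcases hkl with ⟨h, -⟩ | ⟨d, hd, h, h'⟩
          · omega
          · obtain rfl : i = d := by omega
            exact Or.inr ⟨i + 1, hi, rfl, hM, h', hr'⟩
        · rcases hkl with ⟨-, h⟩ | ⟨d, _, h, _⟩
          · exact Or.inr ⟨0, Nat.zero_le _, rfl, hM, h, hr'⟩
          · omega
      · rintro ⟨⟨ha, hΓl, hΓr⟩, k, rfl, ⟨rfl, hM, hMl, hMr⟩ | ⟨d, hd, rfl, h⟩⟩
        · exact ⟨_, _, ⟨hΓl, 0, rfl, Or.inl ⟨rfl, hMl⟩⟩, ⟨hΓr, 0, rfl, Or.inl ⟨rfl, hMr⟩⟩, ha,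
            _, _, 0, 0, rfl, rfl, by simp, Or.inl ⟨hM, Or.inl ⟨rfl, rfl⟩⟩⟩
        · cases d with
          | zero =>
            exact ⟨_, _, ⟨hΓl, 0, rfl, Or.inl ⟨rfl, h.2.1⟩⟩, ⟨hΓr, 0, rfl, Or.inl ⟨rfl, h.2.2⟩⟩,
              ha, _, _, 1, 0, rfl, rfl, by simp, Or.inr ⟨h.1, rfl, rfl⟩⟩
          | succ d =>
            exact ⟨_, _, ⟨hΓl, d + 1, rfl, Or.inr ⟨d, by omega, rfl, h.2.1⟩⟩,
              ⟨hΓr, 0, rfl, Or.inl ⟨rfl, h.2.2⟩⟩, ha, _, _, d + 2, d + 1, rfl, rfl, by simp,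
              Or.inl ⟨h.1, Or.inr ⟨d, by omega, rfl, rfl⟩⟩⟩
  have hstate : ∀ s k, k < n + 2 → (σ s : ℕ) + m * k < m * (n + 2) := by
    intro s k hk
    calc (σ s : ℕ) + m * k < m + m * k := by have := hlt s; omega
      _ = m * (k + 1) := by ring
      _ ≤ m * (n + 2) := Nat.mul_le_mul_left _ hk
  have hfinal : ∀ q, q ∈ A.final ↔ ∃ s ∈ acc, q = σ s + m * 0 ∨ q = σ s + m * (n + 1) := by
    intro q
    simp only [hA, counterAutomaton, List.mem_append, List.mem_map, hF, Set.mem_image]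
    constructor
    · rintro (⟨s, hs, rfl⟩ | ⟨_, ⟨s, hs, rfl⟩, rfl⟩)
      · exact ⟨s, hs, Or.inl (by simp)⟩
      · exact ⟨s, hs, Or.inr rfl⟩
    · rintro ⟨s, hs, rfl | rfl⟩
      · exact Or.inl ⟨s, hs, by simp⟩
      · exact Or.inr ⟨_, ⟨s, hs, rfl⟩, rfl⟩
  refine ⟨⟨?_, ?_, ?_⟩, fun t => ?_⟩
  · simpa [hA, counterAutomaton] using hstate B.leaf 0 (by omega)
  · intro q a p₀ p₁ h
    obtain ⟨ha, s₀, s₁, k, k₀, rfl, rfl, rfl, hk⟩ := (htrans _ _ _ _).1 h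
    refine ⟨hstate _ _ ?_, ha, hstate _ _ ?_, by simpa [hA, counterAutomaton] using hstate s₁ 0 (by omega)⟩
    · rcases hk with ⟨_, ⟨_, _⟩ | ⟨i, _, _, _⟩⟩ | ⟨_, _, _⟩ <;> omega
    · rcases hk with ⟨_, ⟨_, _⟩ | ⟨i, _, _, _⟩⟩ | ⟨_, _, _⟩ <;> omega
  · intro q hq
    obtain ⟨s, -, rfl | rfl⟩ := (hfinal q).1 hq
    · exact hstate _ _ (by omega)
    · exact hstate _ _ (by omega)
  · simp only [TreeAutomaton.language, Set.mem_ofPred_eq, hreach, markOnlyAt_iff]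
    refine and_congr_right fun _ => ?_
    constructor
    · rintro ⟨q, hq, hΓt, k, rfl, hk⟩
      obtain ⟨s, hs, h | h⟩ := (hfinal _).1 hq
      · obtain ⟨rfl, rfl⟩ := huniq _ _ _ _ h
        refine ⟨hΓt, hs, ?_⟩
        rcases hk with ⟨-, h⟩ | ⟨d, _, h, _⟩
        · exact Or.inl h
        · omega
      · obtain ⟨rfl, rfl⟩ := huniq _ _ _ _ h
        refine ⟨hΓt, hs, ?_⟩
        rcases hk with ⟨h, -⟩ | ⟨d, _, h, h'⟩
        · omega
        · obtain rfl : n = d := by omega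
          exact Or.inr h'
    · rintro ⟨hΓt, hs, h | h⟩
      · exact ⟨_, (hfinal _).2 ⟨_, hs, Or.inl rfl⟩, hΓt, 0, rfl, Or.inl ⟨rfl, h⟩⟩
      · exact ⟨_, (hfinal _).2 ⟨_, hs, Or.inr rfl⟩, hΓt, n + 1, rfl, Or.inr ⟨n, le_rfl, rfl, h⟩⟩

end CounterAutomaton

/-! ### Recognition of convolutions -/

section Conv

variable {α S : Type}

@[simp]
theorem conv_nil_nil : conv (.nil : BinaryTree α) .nil = .nil := by
  simp [conv]

@[simp]
theorem conv_nil_node (b : α) (l r : BinaryTree α) :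
    conv .nil (.node b l r) = .node (none, some b) (conv .nil l) (conv .nil r) := by
  simp [conv]

@[simp]
theorem conv_node_nil (a : α) (l r : BinaryTree α) :
    conv (.node a l r) .nil = .node (some a, none) (conv l .nil) (conv r .nil) := by
  simp [conv]

@[simp]
theorem conv_node_node (a b : α) (l r l' r' : BinaryTree α) :
    conv (.node a l r) (.node b l' r') = .node (some a, some b) (conv l l') (conv r r') := by
  simp [conv]

theorem conv_eq_nil {s t : BinaryTree α} : conv s t = .nil ↔ s = .nil ∧ t = .nil := by
  cases s <;> cases t <;> simp

theorem isProper_conv {s t : BinaryTree α} (hs : IsProper s) (ht : IsProper t) :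
    IsProper (conv s t) := by
  induction s generalizing t with
  | nil =>
    induction t with
    | nil =>
      rw [conv_nil_nil]
      trivial
    | node b l r hl hr =>
      rw [conv_nil_node]
      refine ⟨fun h => ?_, hl ht.2.1, hr ht.2.2⟩
      exact conv_eq_nil.2 ⟨rfl, ht.1 (conv_eq_nil.1 h).2⟩
  | node a l r hl hr =>
    cases t with
    | nil =>
      rw [conv_node_nil]
      refine ⟨fun h => ?_, hl hs.2.1 trivial, hr hs.2.2 trivial⟩
      exact conv_eq_nil.2 ⟨hs.1 (conv_eq_nil.1 h).1, rfl⟩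
    | node b l' r' =>
      rw [conv_node_node]
      refine ⟨fun h => ?_, hl hs.2.1 ht.2.1, hr hs.2.2 ht.2.2⟩
      exact conv_eq_nil.2 ⟨hs.1 (conv_eq_nil.1 h).1, ht.1 (conv_eq_nil.1 h).2⟩

/-- The pairs of letters or padding letters with both letters in `Γ`. -/
def padded (Γ : Set α) : Set (Option α × Option α) := {x | (∀ a ∈ x.1, a ∈ Γ) ∧ ∀ b ∈ x.2, b ∈ Γ}

@[simp]
theorem none_some_mem_padded {Γ : Set α} {b : α} : (none, some b) ∈ padded Γ ↔ b ∈ Γ := by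
  simp [padded]

@[simp]
theorem some_none_mem_padded {Γ : Set α} {a : α} : (some a, none) ∈ padded Γ ↔ a ∈ Γ := by
  simp [padded]

@[simp]
theorem some_some_mem_padded {Γ : Set α} {a b : α} :
    (some a, some b) ∈ padded Γ ↔ a ∈ Γ ∧ b ∈ Γ := by
  simp [padded]

theorem lettersIn_conv {Γ : Set α} {s t : BinaryTree α} :
    LettersIn (padded Γ) (conv s t) ↔ LettersIn Γ s ∧ LettersIn Γ t := by
  induction s generalizing t with
  | nil =>
    induction t with
    | nil => simp [LettersIn]
    | node b l r hl hr => simp_all [LettersIn]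
  | node a l r hl hr =>
    cases t with
    | nil => simp [LettersIn, hl, hr]
    | node b l' r' =>
      simp only [conv_node_node, LettersIn, some_some_mem_padded, hl, hr]
      tauto

/-- A pair counts as marked as soon as one of its components is, so marks confined to 0ⁿ in the
convolution are confined to 0ⁿ in both trees. -/
theorem markOnlyAt_conv {M : Set α} {n : ℕ} {s t : BinaryTree α} :
    MarkOnlyAt (padded Mᶜ)ᶜ n (conv s t) ↔ MarkOnlyAt M n s ∧ MarkOnlyAt M n t := by
  induction s generalizing t n with
  | nil =>
    induction t generalizing n with
    | nil => simp [MarkOnlyAt]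
    | node b l r hl hr =>
      cases n <;> simp_all [MarkOnlyAt, lettersIn_conv, LettersIn]
  | node a l r hl hr =>
    cases t with
    | nil => cases n <;> simp [MarkOnlyAt, lettersIn_conv, LettersIn, hl]
    | node b l' r' =>
      cases n with
      | zero =>
        simp only [conv_node_node, MarkOnlyAt, lettersIn_conv, compl_compl]
        tauto
      | succ n =>
        simp only [conv_node_node, MarkOnlyAt, lettersIn_conv, compl_compl, hl, Set.mem_compl_iff,
          some_some_mem_padded, not_not]
        tauto

/-- The algebra that evaluates the first component of a convolution. -/
def TreeAlgebra.onFst (B : TreeAlgebra α S) : TreeAlgebra (Option α × Option α) S where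
  leaf := B.leaf
  node x p q := x.1.elim B.leaf fun a => B.node a p q

/-- The algebra that evaluates the second component of a convolution. -/
def TreeAlgebra.onSnd (B : TreeAlgebra α S) : TreeAlgebra (Option α × Option α) S where
  leaf := B.leaf
  node x p q := x.2.elim B.leaf fun a => B.node a p q

theorem TreeAlgebra.fold_onFst (B : TreeAlgebra α S) (s t : BinaryTree α) :
    B.onFst.fold (conv s t) = B.fold s := by
  induction s generalizing t with
  | nil => cases t <;> simp [fold, onFst]
  | node a l r hl hr => cases t <;> simp_all [fold, onFst]

theorem TreeAlgebra.fold_onSnd (B : TreeAlgebra α S) (s t : BinaryTree α) :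
    B.onSnd.fold (conv s t) = B.fold t := by
  induction t generalizing s with
  | nil => cases s <;> simp [fold, onSnd]
  | node a l r hl hr => cases s <;> simp_all [fold, onSnd]

/-- The algebra that recognizes convolutions: the state records whether the two components are empty
and whether the tree is a convolution. -/
def convAlgebra : TreeAlgebra (Option α × Option α) (Prop × Prop × Prop) where
  leaf := (True, True, True)
  node x p q := (x.1 = none, x.2 = none, p.2.2 ∧ q.2.2 ∧ (x.1 = none → p.1 ∧ q.1) ∧
    (x.2 = none → p.2.1 ∧ q.2.1) ∧ ¬(x.1 = none ∧ x.2 = none))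

theorem fold_convAlgebra (w : BinaryTree (Option α × Option α)) :
    (convAlgebra.fold w).2.2 → ∃ s t, w = conv s t ∧ ((convAlgebra.fold w).1 ↔ s = .nil) ∧
      ((convAlgebra.fold w).2.1 ↔ t = .nil) := by
  induction w with
  | nil => exact fun _ => ⟨.nil, .nil, by simp, by simp [TreeAlgebra.fold, convAlgebra]⟩
  | node x l r hl hr =>
    rintro ⟨hpl, hpr, h₁, h₂, h₃⟩
    obtain ⟨s, t, rfl, hs, ht⟩ := hl hpl
    obtain ⟨s', t', rfl, hs', ht'⟩ := hr hpr
    rcases x with ⟨_ | a, _ | b⟩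
    · simp at h₃
    · obtain ⟨rfl, rfl⟩ : s = .nil ∧ s' = .nil := by simpa [hs, hs'] using h₁ rfl
      exact ⟨.nil, .node b t t', by simp, by simp [TreeAlgebra.fold, convAlgebra]⟩
    · obtain ⟨rfl, rfl⟩ : t = .nil ∧ t' = .nil := by simpa [ht, ht'] using h₂ rfl
      exact ⟨.node a s s', .nil, by simp, by simp [TreeAlgebra.fold, convAlgebra]⟩
    · exact ⟨.node a s s', .node b t t', by simp, by simp [TreeAlgebra.fold, convAlgebra]⟩

theorem fold_convAlgebra_conv (s t : BinaryTree α) : (convAlgebra.fold (conv s t)).2.2 ∧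
    ((convAlgebra.fold (conv s t)).1 ↔ s = .nil) ∧
      ((convAlgebra.fold (conv s t)).2.1 ↔ t = .nil) := by
  induction s generalizing t with
  | nil =>
    induction t with
    | nil => simp [TreeAlgebra.fold, convAlgebra]
    | node b l r hl hr => simp_all [TreeAlgebra.fold, convAlgebra]
  | node a l r hl hr =>
    cases t with
    | nil =>
      have h₁ := hl .nil
      have h₂ := hr .nil
      simp_all [TreeAlgebra.fold, convAlgebra]
    | node b l' r' =>
      have h₁ := hl l'
      have h₂ := hr r'
      simp_all [TreeAlgebra.fold, convAlgebra]

/-- A recognizable structure gives rise to a computable family of presentations of the substructures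
of all trees with marked letters at most at the position `0ⁿ`. -/
theorem exists_presentation {C : Type} [Finite S] [Finite C] (k : ℕ) (M : Set ℕ)
    (B : TreeAlgebra ℕ S) (acc : Set S) (D : TreeAlgebra (Option ℕ × Option ℕ) C) (le : Set C)
    (hproper : ∀ t, LettersIn {a | a < k} t → B.fold t ∈ acc → IsProper t) :
    ∃ P : ℕ → Presentation, Computable P ∧ ∀ n, (P n).IsPresentationOf
      {t | LettersIn {a | a < k} t ∧ B.fold t ∈ acc ∧ MarkOnlyAt M n t}
      (fun s t => D.fold (conv s t) ∈ le) := by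
  obtain ⟨A₁, c₁, h₁⟩ := exists_counterAutomaton {a | a < k} M (Set.finite_lt_nat k) B acc
  have hfin : (padded {a | a < k}).Finite := by
    have h : (insert none (some '' {a | a < k})).Finite :=
      ((Set.finite_lt_nat k).image some).insert none
    refine (h.prod h).subset ?_
    rintro ⟨_ | a, _ | b⟩ ⟨ha, hb⟩ <;> simp_all
  -- One product algebra checks that both components lie in the universe, that the tree really is a
  -- convolution, and that the relation holds.
  obtain ⟨A₂, c₂, h₂⟩ := exists_counterAutomaton (padded {a | a < k}) (padded Mᶜ)ᶜ hfin
    (B.onFst.prod (B.onSnd.prod (convAlgebra.prod D)))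
    {x | x.1 ∈ acc ∧ x.2.1 ∈ acc ∧ x.2.2.1.2.2 ∧ x.2.2.2 ∈ le}
  refine ⟨fun n => ⟨k, A₁ n, A₂ n⟩, ?_, fun n => ⟨(h₁ n).1, (h₂ n).1, ?_, ?_⟩⟩
  · exact ((Primrec.of_equiv_symm (e := Presentation.equivTuple)).to_comp).comp
      ((Computable.const k).pair (c₁.pair c₂))
  · ext t
    rw [(h₁ n).2]
    exact ⟨fun h => h.2, fun h => ⟨hproper t h.1 h.2.1, h⟩⟩
  · ext w
    rw [(h₂ n).2]
    simp only [TreeAlgebra.fold_prod, Set.mem_ofPred_eq]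
    constructor
    · rintro ⟨-, hΓ, ⟨h₁, h₂, h₃, h₄⟩, hM⟩
      obtain ⟨s, t, rfl, -⟩ := fold_convAlgebra w h₃
      rw [TreeAlgebra.fold_onFst] at h₁
      rw [TreeAlgebra.fold_onSnd] at h₂
      rw [lettersIn_conv] at hΓ
      rw [markOnlyAt_conv] at hM
      exact ⟨s, ⟨hΓ.1, h₁, hM.1⟩, t, ⟨hΓ.2, h₂, hM.2⟩, h₄, rfl⟩
    · rintro ⟨s, ⟨hs₁, hs₂, hs₃⟩, t, ⟨ht₁, ht₂, ht₃⟩, hle, rfl⟩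
      rw [TreeAlgebra.fold_onFst, TreeAlgebra.fold_onSnd, lettersIn_conv, markOnlyAt_conv]
      exact ⟨isProper_conv (hproper s hs₁ hs₂) (hproper t ht₁ ht₂), ⟨hs₁, ht₁⟩,
        ⟨hs₂, ht₂, (fold_convAlgebra_conv s t).1, hle⟩, hs₃, ht₃⟩

end Conv

end TreeAutomatic

/-! ### Words with labels and slots, and their coding by trees -/

namespace TreeAutomatic

/-- A word over `A` whose letters carry labels in `G` and slots, which are words of bits. -/
structure SlottedWord (A G : Type) where
  toList : List (A × G × List Bool)

namespace SlottedWord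

variable {A G : Type}

/-- The underlying word over `A`. -/
def word (x : SlottedWord A G) : List A := x.toList.map fun y => y.1

/-- The sequence of labels. -/
def labels (x : SlottedWord A G) : List G := x.toList.map fun y => y.2.1

/-- The sequence of slots. -/
def slots (x : SlottedWord A G) : List (List Bool) := x.toList.map fun y => y.2.2

/-- The length-lexicographic key of a word. -/
abbrev lenKey (w : List A) : ℕ ×ₗ List A := toLex (w.length, w)

theorem ext_of_maps {x y : SlottedWord A G} (h₁ : x.word = y.word) (h₂ : x.labels = y.labels)
    (h₃ : x.slots = y.slots) : x = y := by
  obtain ⟨l⟩ := x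
  obtain ⟨m⟩ := y
  congr 1
  simp only [word, labels, slots] at *
  induction l generalizing m with
  | nil =>
    cases m with
    | nil => rfl
    | cons b m => simp at h₁
  | cons a l ih =>
    cases m with
    | nil => simp at h₁
    | cons b m =>
      simp only [List.map_cons, List.cons.injEq] at h₁ h₂ h₃
      rw [ih m h₁.2 h₂.2 h₃.2, Prod.ext h₁.1 (Prod.ext h₂.1 h₃.1)]

variable [LinearOrder A] [LinearOrder G]

/-- The key that determines the order: length, word, labels, slots. -/
def key (x : SlottedWord A G) : (ℕ ×ₗ List A) ×ₗ (List G ×ₗ List (List Bool)) :=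
  toLex (lenKey x.word, toLex (x.labels, x.slots))

omit [LinearOrder A] [LinearOrder G] in
theorem key_injective : Function.Injective (key (A := A) (G := G)) := by
  intro x y h
  simp only [key, lenKey, EmbeddingLike.apply_eq_iff_eq, Prod.mk.injEq] at h
  exact ext_of_maps h.1.2 h.2.1 h.2.2

noncomputable instance : LinearOrder (SlottedWord A G) := LinearOrder.lift' key key_injective

theorem le_iff_key {x y : SlottedWord A G} : x ≤ y ↔ x.key ≤ y.key := Iff.rfl

end SlottedWord

open Classical in
/-- The comparison result of two elements of a linear order. -/
noncomputable def ordering {α : Type} [LinearOrder α] (a b : α) : Ordering :=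
  if a < b then .lt else if b < a then .gt else .eq

section Ordering

variable {α β : Type} [LinearOrder α] [LinearOrder β]

theorem ordering_eq_lt {a b : α} (h : a < b) : ordering a b = .lt := by
  simp [ordering, h]

theorem ordering_eq_gt {a b : α} (h : b < a) : ordering a b = .gt := by
  simp [ordering, h, h.not_gt]

@[simp]
theorem ordering_self (a : α) : ordering a a = .eq := by
  simp [ordering]

theorem ordering_ne_gt_iff {a b : α} : ordering a b ≠ .gt ↔ a ≤ b := by
  rcases lt_trichotomy a b with h | rfl | h
  · simp [ordering_eq_lt h, h.le]
  · simp
  · simp [ordering_eq_gt h, h]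

/-- This and its analogue for lists turn lexicographic comparison into composition of comparison
results, which an automaton can carry out node by node. -/
theorem ordering_toLex (a a' : α) (b b' : β) :
    ordering (toLex (a, b)) (toLex (a', b')) = (ordering a a').then (ordering b b') := by
  rcases lt_trichotomy a a' with h | rfl | h
  · rw [ordering_eq_lt h, ordering_eq_lt (Prod.Lex.toLex_lt_toLex.2 (Or.inl h))]
    rfl
  · rw [ordering_self]
    rcases lt_trichotomy b b' with h | rfl | h
    · rw [ordering_eq_lt h, ordering_eq_lt (Prod.Lex.toLex_lt_toLex.2 (by simpa using h))]
      rfl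
    · simp
    · rw [ordering_eq_gt h, ordering_eq_gt (Prod.Lex.toLex_lt_toLex.2 (by simpa using h))]
      rfl
  · rw [ordering_eq_gt h, ordering_eq_gt (Prod.Lex.toLex_lt_toLex.2 (Or.inl h))]
    rfl

theorem ordering_cons_cons (a b : α) (l m : List α) :
    ordering (a :: l) (b :: m) = (ordering a b).then (ordering l m) := by
  rcases lt_trichotomy a b with h | rfl | h
  · rw [ordering_eq_lt h, ordering_eq_lt (List.cons_lt_cons_iff.2 (Or.inl h))]
    rfl
  · rw [ordering_self]
    rcases lt_trichotomy l m with h | rfl | h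
    · rw [ordering_eq_lt h, ordering_eq_lt (List.cons_lt_cons_iff.2 (Or.inr ⟨rfl, h⟩))]
      rfl
    · simp
    · rw [ordering_eq_gt h, ordering_eq_gt (List.cons_lt_cons_iff.2 (Or.inr ⟨rfl, h⟩))]
      rfl
  · rw [ordering_eq_gt h, ordering_eq_gt (List.cons_lt_cons_iff.2 (Or.inl h))]
    rfl

theorem ordering_nil_cons (a : α) (l : List α) : ordering [] (a :: l) = .lt :=
  ordering_eq_lt (List.nil_lt_cons a l)

theorem ordering_cons_nil (a : α) (l : List α) : ordering (a :: l) [] = .gt :=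
  ordering_eq_gt (List.nil_lt_cons a l)

end Ordering

/-- A regular condition on slotted words: a finite algebra that reads the word with its labels from
right to left, and for every letter and label a condition on the slot that is recognized by a finite
algebra. -/
structure WordCondition (A G M N : Type) where
  step : A × G → M → M
  init : M
  acc : Set M
  slotStep : Bool → N → N
  slotInit : N
  slotAcc : A → G → Set N

namespace WordCondition

variable {A G M N : Type} (R : WordCondition A G M N)

/-- The value of a word in the algebra. -/
def value (l : List (A × G × List Bool)) : M :=
  (l.map fun y => (y.1, y.2.1)).foldr R.step R.init

/-- The value of a slot in the algebra for slots. -/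
def slotValue (v : List Bool) : N := v.foldr R.slotStep R.slotInit

/-- All slots satisfy their condition. -/
def SlotsOk (l : List (A × G × List Bool)) : Prop := ∀ y ∈ l, R.slotValue y.2.2 ∈ R.slotAcc y.1 y.2.1

/-- The condition expressed by `R`. -/
def Holds (x : SlottedWord A G) : Prop := R.value x.toList ∈ R.acc ∧ R.SlotsOk x.toList

end WordCondition

/-- Letters with labels in `E` occur at most at position `n`. -/
def OnlyAt {A G : Type} (E : Set (A × G)) (n : ℕ) (x : SlottedWord A G) : Prop :=
  ∀ i y, x.toList[i]? = some y → (y.1, y.2.1) ∈ E → i = n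

/-- The labels of the trees that code slotted words: letters with labels, an end marker and bits. -/
abbrev TreeLetter (A G : Type) : Type := (A × G) ⊕ Option Bool

section Coding

variable {A G M N : Type} (code : TreeLetter A G → ℕ)

/-- The tree that codes a word of bits. -/
def bitTree : List Bool → BinaryTree ℕ
  | [] => .nil
  | b :: v => .node (code (.inr (some b))) (bitTree v) .nil

/-- The tree that codes a slotted word. -/
def wordTree : List (A × G × List Bool) → BinaryTree ℕ
  | [] => .node (code (.inr none)) .nil .nil
  | y :: l => .node (code (.inl (y.1, y.2.1))) (wordTree l) (bitTree code y.2.2)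

theorem isProper_bitTree (v : List Bool) : IsProper (bitTree code v) := by
  induction v with
  | nil => trivial
  | cons b v ih => exact ⟨fun _ => rfl, ih, trivial⟩

theorem wordTree_ne_nil (l : List (A × G × List Bool)) : wordTree code l ≠ .nil := by
  cases l <;> simp [wordTree]

theorem isProper_wordTree (l : List (A × G × List Bool)) : IsProper (wordTree code l) := by
  induction l with
  | nil => exact ⟨fun _ => rfl, trivial, trivial⟩
  | cons y l ih =>
    exact ⟨fun h => (wordTree_ne_nil code l h).elim, ih, isProper_bitTree code _⟩

variable {code}

theorem bitTree_injective (hcode : code.Injective) : (bitTree code).Injective := by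
  intro v
  induction v with
  | nil =>
    rintro (_ | ⟨b, w⟩) h
    · rfl
    · simp [bitTree] at h
  | cons a v ih =>
    rintro (_ | ⟨b, w⟩) h
    · simp [bitTree] at h
    · simp only [bitTree, BinaryTree.node.injEq, and_true] at h
      have h₁ := hcode h.1
      simp only [Sum.inr.injEq, Option.some.injEq] at h₁
      rw [h₁, ih h.2]

theorem wordTree_injective (hcode : code.Injective) : (wordTree code).Injective := by
  intro l
  induction l with
  | nil =>
    rintro (_ | ⟨b, m⟩) h
    · rfl
    · simp only [wordTree, BinaryTree.node.injEq] at h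
      exact (wordTree_ne_nil code m h.2.1.symm).elim
  | cons a l ih =>
    rintro (_ | ⟨b, m⟩) h
    · simp only [wordTree, BinaryTree.node.injEq] at h
      exact (wordTree_ne_nil code l h.2.1).elim
    · simp only [wordTree, BinaryTree.node.injEq] at h
      have h₁ := hcode h.1
      simp only [Sum.inl.injEq, Prod.mk.injEq] at h₁
      rw [ih h.2.1, Prod.ext h₁.1 (Prod.ext h₁.2 (bitTree_injective hcode h.2.2))]

theorem lettersIn_bitTree {Γ : Set ℕ} (h : ∀ b, code (.inr (some b)) ∈ Γ) (v : List Bool) :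
    LettersIn Γ (bitTree code v) := by
  induction v with
  | nil => trivial
  | cons b v ih => exact ⟨h b, ih, trivial⟩

theorem lettersIn_wordTree {Γ : Set ℕ} (h : ∀ c, code (.inr c) ∈ Γ) (l : List (A × G × List Bool)) :
    LettersIn Γ (wordTree code l) ↔ ∀ y ∈ l, code (.inl (y.1, y.2.1)) ∈ Γ := by
  induction l with
  | nil => simp [wordTree, LettersIn, h]
  | cons y l ih =>
    simp [wordTree, LettersIn, ih, lettersIn_bitTree (Γ := Γ) fun b => h (some b)]

theorem markOnlyAt_wordTree (hcode : code.Injective) (E : Set (A × G)) (n : ℕ)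
    (l : List (A × G × List Bool)) :
    MarkOnlyAt ((fun p => code (.inl p)) '' E) n (wordTree code l) ↔ OnlyAt E n ⟨l⟩ := by
  have hmem : ∀ p, code (.inl p) ∈ (fun p => code (.inl p)) '' E ↔ p ∈ E := fun p =>
    ⟨fun ⟨q, hq, h⟩ => Sum.inl.inj (hcode h) ▸ hq, fun h => ⟨p, h, rfl⟩⟩
  have hnot : ∀ c, code (.inr c) ∈ ((fun p => code (.inl p)) '' E)ᶜ := by
    rintro c ⟨p, -, h⟩
    exact Sum.inl_ne_inr (hcode h)
  induction l generalizing n with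
  | nil =>
    have := hnot none
    cases n <;> simp_all [wordTree, MarkOnlyAt, OnlyAt, LettersIn]
  | cons y l ih =>
    cases n with
    | zero =>
      simp only [wordTree, MarkOnlyAt, lettersIn_wordTree hnot,
        lettersIn_bitTree fun b => hnot (some b), and_true, Set.mem_compl_iff, hmem, OnlyAt]
      constructor
      · rintro h (_ | i) z hz hE
        · rfl
        · exact (h z (List.mem_of_getElem? hz) hE).elim
      · intro h z hz hE
        obtain ⟨i, hi⟩ := List.mem_iff_getElem?.1 hz
        exact absurd (h (i + 1) z (by simpa using hi) hE) (by omega)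
    | succ n =>
      simp only [wordTree, MarkOnlyAt, ih, lettersIn_bitTree fun b => hnot (some b), and_true,
        hmem, OnlyAt]
      constructor
      · rintro ⟨h₁, h₂⟩ (_ | i) z hz hE
        · simp only [List.getElem?_cons_zero, Option.some.injEq] at hz
          exact (h₁ (hz ▸ hE)).elim
        · rw [h₂ i z (by simpa using hz) hE]
      · intro h
        refine ⟨fun hE => ?_, fun i z hz hE => ?_⟩
        · exact absurd (h 0 y rfl hE) (by omega)
        · have := h (i + 1) z (by simpa using hz) hE
          omega

end Coding

/-- The states of the automaton that recognizes the codes of slotted words. -/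
inductive ScanState (M N : Type) where
  | empty
  | bits (n : N)
  | word (m : M)
  | failure

instance {M N : Type} [Finite M] [Finite N] : Finite (ScanState M N) := by
  let f : ScanState M N → Option (Option (M ⊕ N)) := fun
    | .empty => none
    | .failure => some none
    | .word m => some (some (.inl m))
    | .bits n => some (some (.inr n))
  refine Finite.of_injective f ?_
  rintro (_ | n | m | _) (_ | n' | m' | _) h <;> simp_all [f]

/-! ### Recognition of the codes of slotted words -/

section Recognition

variable {A G M N : Type} (R : WordCondition A G M N) (decode : ℕ → TreeLetter A G)

open Classical in
/-- The automaton that recognizes the codes of slotted words with the condition `R`. -/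
noncomputable def scanAlgebra : TreeAlgebra ℕ (ScanState M N) where
  leaf := .empty
  node c p q := match decode c, p, q with
    | .inr none, .empty, .empty => .word R.init
    | .inr (some b), .empty, .empty => .bits (R.slotStep b R.slotInit)
    | .inr (some b), .bits n, .empty => .bits (R.slotStep b n)
    | .inl (a, g), .word m, .empty =>
      if R.slotInit ∈ R.slotAcc a g then .word (R.step (a, g) m) else .failure
    | .inl (a, g), .word m, .bits n =>
      if n ∈ R.slotAcc a g then .word (R.step (a, g) m) else .failure
    | _, _, _ => .failure

variable {decode} {code : TreeLetter A G → ℕ} {k : ℕ}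

theorem fold_scanAlgebra_bitTree (hdc : ∀ c, decode (code c) = c) (v : List Bool) :
    (scanAlgebra R decode).fold (bitTree code v) =
      if v = [] then .empty else .bits (R.slotValue v) := by
  induction v with
  | nil => rfl
  | cons b v ih =>
    rw [bitTree, TreeAlgebra.fold, ih]
    simp only [scanAlgebra, hdc, TreeAlgebra.fold]
    cases v <;> simp [WordCondition.slotValue]

theorem fold_scanAlgebra_wordTree (hdc : ∀ c, decode (code c) = c) (l : List (A × G × List Bool))
    (h : R.SlotsOk l) : (scanAlgebra R decode).fold (wordTree code l) = .word (R.value l) := by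
  induction l with
  | nil => simp [wordTree, TreeAlgebra.fold, scanAlgebra, hdc, WordCondition.value]
  | cons y l ih =>
    have hy := h y (by simp)
    rw [wordTree, TreeAlgebra.fold, ih fun z hz => h z (by simp [hz]),
      fold_scanAlgebra_bitTree R hdc]
    obtain ⟨a, g, v⟩ := y
    simp only [scanAlgebra, hdc]
    cases v with
    | nil =>
      simp only [WordCondition.slotValue, List.foldr_nil] at hy
      simp [hy, WordCondition.value]
    | cons b v => simp [hy, WordCondition.value]

/-- Each state other than `failure` determines the shape of the tree below. The three claims need a
joint induction because a letter node combines a word on the left with a possibly empty slot on the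
right. -/
theorem eq_tree_of_fold_scanAlgebra (hcd : ∀ c < k, code (decode c) = c) (t : BinaryTree ℕ)
    (ht : LettersIn {c | c < k} t) :
    ((scanAlgebra R decode).fold t = .empty → t = .nil) ∧
    (∀ n, (scanAlgebra R decode).fold t = .bits n → ∃ v, t = bitTree code v ∧ n = R.slotValue v) ∧
    (∀ m, (scanAlgebra R decode).fold t = .word m →
      ∃ l, R.SlotsOk l ∧ t = wordTree code l ∧ m = R.value l) := by
  induction t with
  | nil => simp [TreeAlgebra.fold, scanAlgebra]
  | node c l r hl hr =>
    obtain ⟨hc, htl, htr⟩ := ht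
    have hl := hl htl
    have hr := hr htr
    have hcc := hcd c hc
    rw [TreeAlgebra.fold]
    generalize (scanAlgebra R decode).fold l = p at hl
    generalize (scanAlgebra R decode).fold r = q at hr
    simp only [scanAlgebra]
    generalize decode c = d at hcc
    subst hcc
    rcases d with ⟨a, g⟩ | _ | b
    · rcases p with _ | n | m | _ <;> rcases q with _ | n' | m' | _ <;> simp only [reduceCtorEq,
        false_implies, implies_true, true_and]
      · split_ifs with h
        · simp only [false_implies, implies_true, true_and, ScanState.word.injEq]
          rintro _ rfl
          obtain ⟨x, hx, rfl, rfl⟩ := hl.2.2 m rfl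
          refine ⟨(a, g, []) :: x, ?_, ?_, rfl⟩
          · intro y hy
            rcases List.mem_cons.1 hy with rfl | hy
            · exact h
            · exact hx y hy
          · rw [hr.1 rfl]
            rfl
        · simp
      · split_ifs with h
        · simp only [false_implies, implies_true, true_and, ScanState.word.injEq]
          rintro _ rfl
          obtain ⟨x, hx, rfl, rfl⟩ := hl.2.2 m rfl
          obtain ⟨v, rfl, rfl⟩ := hr.2.1 n' rfl
          refine ⟨(a, g, v) :: x, ?_, rfl, rfl⟩
          intro y hy
          rcases List.mem_cons.1 hy with rfl | hy
          · exact h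
          · exact hx y hy
        · simp
    · rcases p with _ | n | m | _ <;> rcases q with _ | n' | m' | _ <;> simp only [reduceCtorEq,
        false_implies, implies_true, true_and, ScanState.word.injEq]
      rintro _ rfl
      refine ⟨[], fun y hy => by simp at hy, ?_, rfl⟩
      rw [hl.1 rfl, hr.1 rfl]
      rfl
    · rcases p with _ | n | m | _ <;> rcases q with _ | n' | m' | _ <;> simp only [reduceCtorEq,
        false_implies, implies_true, true_and, and_true, ScanState.bits.injEq]
      · rintro _ rfl
        refine ⟨[b], ?_, rfl⟩
        rw [hl.1 rfl, hr.1 rfl]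
        rfl
      · rintro _ rfl
        obtain ⟨v, rfl, rfl⟩ := hl.2.1 n rfl
        refine ⟨b :: v, ?_, rfl⟩
        rw [hr.1 rfl]
        rfl

end Recognition

/-! ### Comparison of two slotted words by an automaton -/

section Comparison

variable {A G : Type} [LinearOrder A] [LinearOrder G] (decode : ℕ → TreeLetter A G)

/-- The automaton that compares lengths, words, labels and slots of two slotted words. -/
noncomputable def compareAlgebra :
    TreeAlgebra (Option ℕ × Option ℕ) (Ordering × Ordering × Ordering × Ordering) where
  leaf := (.eq, .eq, .eq, .eq)
  node x p q := match x.1.map decode, x.2.map decode with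
    | some (.inl y), some (.inl z) =>
      (p.1, (ordering y.1 z.1).then p.2.1, (ordering y.2 z.2).then p.2.2.1, q.2.2.2.then p.2.2.2)
    | some (.inr none), some (.inl _) => (.lt, .eq, .eq, .eq)
    | some (.inl _), some (.inr none) => (.gt, .eq, .eq, .eq)
    | some (.inr (some b)), some (.inr (some c)) => (.eq, .eq, .eq, (ordering b c).then p.2.2.2)
    | none, some (.inr (some _)) => (.eq, .eq, .eq, .lt)
    | some (.inr (some _)), none => (.eq, .eq, .eq, .gt)
    | _, _ => (.eq, .eq, .eq, .eq)

variable {decode} {code : TreeLetter A G → ℕ}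

theorem fold_compareAlgebra_bitTree (hdc : ∀ c, decode (code c) = c) (v w : List Bool) :
    ((compareAlgebra decode).fold (conv (bitTree code v) (bitTree code w))).2.2.2 = ordering v w := by
  induction v generalizing w with
  | nil =>
    cases w with
    | nil => simp [bitTree, TreeAlgebra.fold, compareAlgebra]
    | cons c w => simp [bitTree, TreeAlgebra.fold, compareAlgebra, hdc, ordering_nil_cons]
  | cons b v ih =>
    cases w with
    | nil => simp [bitTree, TreeAlgebra.fold, compareAlgebra, hdc, ordering_cons_nil]
    | cons c w =>
      simp only [bitTree, conv_node_node, TreeAlgebra.fold, ordering_cons_cons, ← ih]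
      simp [compareAlgebra, hdc]

/-- For equal lengths the end markers meet at the same node and letters are always paired with
letters. For different lengths the last three components carry no information, but the length
comparison decides before they are consulted. -/
theorem fold_compareAlgebra_wordTree (hdc : ∀ c, decode (code c) = c)
    (x y : List (A × G × List Bool)) :
    ((compareAlgebra decode).fold (conv (wordTree code x) (wordTree code y))).1 =
      ordering x.length y.length ∧ (x.length = y.length →
    ((compareAlgebra decode).fold (conv (wordTree code x) (wordTree code y))).2.1 =
      ordering (x.map fun y => y.1) (y.map fun y => y.1) ∧
    ((compareAlgebra decode).fold (conv (wordTree code x) (wordTree code y))).2.2.1 =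
      ordering (x.map fun y => y.2.1) (y.map fun y => y.2.1) ∧
    ((compareAlgebra decode).fold (conv (wordTree code x) (wordTree code y))).2.2.2 =
      ordering (x.map fun y => y.2.2) (y.map fun y => y.2.2)) := by
  induction x generalizing y with
  | nil =>
    cases y with
    | nil => simp [wordTree, TreeAlgebra.fold, compareAlgebra, hdc]
    | cons b y =>
      simp [wordTree, TreeAlgebra.fold, compareAlgebra, hdc]
      exact (ordering_eq_lt (by simp)).symm
  | cons a x ih =>
    cases y with
    | nil =>
      simp [wordTree, TreeAlgebra.fold, compareAlgebra, hdc]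
      exact (ordering_eq_gt (by simp)).symm
    | cons b y =>
      obtain ⟨h₁, h₂⟩ := ih y
      simp only [wordTree, conv_node_node, TreeAlgebra.fold, List.map_cons, ordering_cons_cons,
        List.length_cons, Nat.add_right_cancel_iff, ← fold_compareAlgebra_bitTree hdc]
      have hcmp : ordering (x.length + 1) (y.length + 1) = ordering x.length y.length := by
        simp [ordering]
      rw [hcmp, ← h₁]
      refine ⟨by simp [compareAlgebra, hdc], fun h => ?_⟩
      obtain ⟨h₃, h₄, h₅⟩ := h₂ h
      rw [← h₃, ← h₄, ← h₅]
      simp [compareAlgebra, hdc]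

theorem le_iff_fold_compareAlgebra (hdc : ∀ c, decode (code c) = c) (x y : SlottedWord A G) :
    x ≤ y ↔ (compareAlgebra decode).fold (conv (wordTree code x.toList) (wordTree code y.toList)) ∈
      {o : Ordering × Ordering × Ordering × Ordering |
        (o.1.then o.2.1).then (o.2.2.1.then o.2.2.2) ≠ .gt} := by
  obtain ⟨h₁, h₂⟩ := fold_compareAlgebra_wordTree hdc x.toList y.toList
  rw [SlottedWord.le_iff_key, ← ordering_ne_gt_iff, SlottedWord.key, SlottedWord.key,
    ordering_toLex, ordering_toLex, ordering_toLex]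
  have hw : ∀ z : SlottedWord A G, z.word.length = z.toList.length := fun z => by
    simp [SlottedWord.word]
  rw [Set.mem_ofPred_eq, h₁, hw, hw]
  by_cases h : x.toList.length = y.toList.length
  · obtain ⟨h₃, h₄, h₅⟩ := h₂ h
    rw [h₃, h₄, h₅]
    rfl
  · rcases lt_or_gt_of_ne h with h | h
    · rw [ordering_eq_lt h]
      simp
    · rw [ordering_eq_gt h]
      simp

end Comparison

/-- The slotted words with a regular condition and with marked letters at most at position `n` are
presented by a computable family of presentations. -/
theorem exists_presentation_slottedWord {A G M N : Type} [LinearOrder A] [LinearOrder G] [Finite A]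
    [Finite G] [Finite M] [Finite N] (R : WordCondition A G M N) (E : Set (A × G)) :
    ∃ P : ℕ → Presentation, Computable P ∧
      ∀ n, (P n).Presents {x : SlottedWord A G // R.Holds x ∧ OnlyAt E n x} := by
  obtain ⟨k, ⟨σ⟩⟩ := Finite.exists_equiv_fin (TreeLetter A G)
  let code : TreeLetter A G → ℕ := fun c => σ c
  -- The default for numbers from k on is irrelevant, since the trees considered have labels below
  -- k.
  let decode : ℕ → TreeLetter A G := fun c => if h : c < k then σ.symm ⟨c, h⟩ else .inr none
  have hcode : code.Injective := fun a b h => σ.injective (Fin.ext h)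
  have hlt : ∀ c, code c < k := fun c => (σ c).2
  have hdc : ∀ c, decode (code c) = c := fun c => by simp [decode, code]
  have hcd : ∀ c < k, code (decode c) = c := fun c hc => by simp [decode, code, hc]
  have hscan : ∀ t, LettersIn {c | c < k} t →
      (scanAlgebra R decode).fold t ∈ ScanState.word '' R.acc →
      ∃ l, R.SlotsOk l ∧ R.value l ∈ R.acc ∧ t = wordTree code l := by
    rintro t ht ⟨m, hm, h⟩
    obtain ⟨l, hl, rfl, rfl⟩ := (eq_tree_of_fold_scanAlgebra R hcd t ht).2.2 m h.symm
    exact ⟨l, hl, hm, rfl⟩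
  obtain ⟨P, hP, h⟩ := exists_presentation k ((fun p => code (.inl p)) '' E) (scanAlgebra R decode)
    (ScanState.word '' R.acc) (compareAlgebra decode)
    {o | (o.1.then o.2.1).then (o.2.2.1.then o.2.2.2) ≠ .gt} (fun t ht₁ ht₂ => by
      obtain ⟨l, -, -, rfl⟩ := hscan t ht₁ ht₂
      exact isProper_wordTree code l)
  refine ⟨P, hP, fun n => ⟨_, _, ?_, ?_, h n⟩⟩
  · refine Equiv.ofBijective (fun x => ⟨wordTree code x.1.toList, ?_, ?_, ?_⟩) ⟨?_, ?_⟩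
    · exact (lettersIn_wordTree (fun c => hlt _) _).2 fun y _ => hlt _
    · exact ⟨_, x.2.1.1, (fold_scanAlgebra_wordTree R hdc _ x.2.1.2).symm⟩
    · exact (markOnlyAt_wordTree hcode E n _).2 x.2.2
    · rintro ⟨⟨x⟩, hx⟩ ⟨⟨y⟩, hy⟩ hxy
      have := wordTree_injective hcode (congrArg Subtype.val hxy)
      simp only at this
      subst this
      rfl
    · rintro ⟨t, ht₁, ht₂, ht₃⟩
      obtain ⟨l, hl, hacc, rfl⟩ := hscan t ht₁ ht₂
      exact ⟨⟨⟨l⟩, ⟨hacc, hl⟩, (markOnlyAt_wordTree hcode E n l).1 ht₃⟩, rfl⟩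
  · intro x y
    exact le_iff_fold_compareAlgebra hdc x.1 y.1

end TreeAutomatic

/-! ### Sums of linear orders over a well-order -/

namespace TreeAutomatic

open Ordinal Set

universe u

/-- A linear order is the ordered sum of the fibers of a monotone map, so isomorphisms of
corresponding fibers can be glued. -/
theorem nonempty_orderIso_of_fibers {α β I : Type} [LinearOrder α] [LinearOrder β] [LinearOrder I]
    {c : α → I} {d : β → I} (hc : Monotone c) (hd : Monotone d)
    (h : ∀ i, Nonempty ({x // c x = i} ≃o {y // d y = i})) : Nonempty (α ≃o β) := by
  have f := fun i => (h i).some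
  let g : α → β := fun x => (f (c x) ⟨x, rfl⟩).1
  have hg : ∀ x, d (g x) = c x := fun x => (f (c x) ⟨x, rfl⟩).2
  have hgi : ∀ i x (hx : c x = i), g x = (f i ⟨x, hx⟩).1 := by
    rintro _ x rfl
    rfl
  have hmono : StrictMono g := by
    intro x y hxy
    rcases (hc hxy.le).lt_or_eq with hlt | heq
    · by_contra hle
      have := hd (not_lt.1 hle)
      rw [hg, hg] at this
      exact this.not_gt hlt
    · rw [hgi (c y) x heq, hgi (c y) y rfl]
      exact (f (c y)).strictMono hxy
  refine ⟨hmono.orderIsoOfSurjective g fun y => ?_⟩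
  refine ⟨((f (d y)).symm ⟨y, rfl⟩).1, ?_⟩
  rw [hgi (d y) _ ((f (d y)).symm ⟨y, rfl⟩).2]
  simp

/-- A copy of ℚ would be mapped monotonically into a well-order, hence not injectively, so a whole
rational interval would lie in one fiber. Such an interval is neither well-founded nor finite. -/
theorem scattered_of_fibers {L I : Type} [LinearOrder L] [LinearOrder I] [WellFoundedLT I]
    {c : L → I} (hc : Monotone c)
    (h : ∀ i, {x | c x = i}.IsWF ∨ ∀ x, c x = i → {y | c y = i ∧ x ≤ y}.Finite) : Scattered L := by
  refine ⟨fun f => ?_⟩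
  have hmono : Monotone (c ∘ f) := hc.comp f.monotone
  have hninj : ¬ Function.Injective (c ∘ f) := by
    intro hinj
    have hwf : WellFounded ((· < ·) : ℚ → ℚ → Prop) :=
      (hmono.strictMono_of_injective hinj).wellFoundedLT.wf
    have := hwf.min_le (s := univ) (mem_univ (hwf.min univ ⟨0, mem_univ 0⟩ - 1)) 
    linarith
  obtain ⟨q, r, hqr, hne⟩ : ∃ q r, c (f q) = c (f r) ∧ q < r := by
    simp only [Function.Injective, not_forall] at hninj
    obtain ⟨q, r, h, hne⟩ := hninj
    rcases lt_or_gt_of_ne hne with h' | h'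
    · exact ⟨q, r, h, h'⟩
    · exact ⟨r, q, h.symm, h'⟩
  have hIcc : ∀ p ∈ Icc q r, c (f p) = c (f r) := fun p hp =>
    le_antisymm (hmono hp.2) (hqr ▸ hmono hp.1)
  rcases h (c (f r)) with h | h
  · have hne' : (f '' Ioc q r).Nonempty := ⟨f r, r, ⟨hne, le_rfl⟩, rfl⟩
    have hwf : (f '' Ioc q r).IsWF := h.mono (by
      rintro _ ⟨p, hp, rfl⟩
      exact hIcc p ⟨hp.1.le, hp.2⟩)
    obtain ⟨p, hp, hpe⟩ := hwf.min_mem hne'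
    -- The midpoint lies below the supposed least element; the left endpoint is excluded from the
    -- interval, so it does not interfere.
    have h₁ : (q + p) / 2 ∈ Ioc q r := ⟨by linarith [hp.1], by linarith [hp.1, hp.2]⟩
    have h₂ := hwf.not_lt_min hne' (mem_image_of_mem f h₁)
    rw [← hpe, f.lt_iff_lt] at h₂
    linarith [hp.1]
  · have hfin : (f '' Icc q r).Finite := (h (f q) hqr).subset (by
      rintro _ ⟨p, hp, rfl⟩
      exact ⟨hIcc p hp, f.monotone hp.1⟩)
    exact (Set.Icc_infinite hne) (hfin.of_finite_image f.injective.injOn)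

/-- The linear order `α` is a well-order of type `o`. -/
def HasType (α : Type) [LinearOrder α] (o : Ordinal.{0}) : Prop := Nonempty (α ≃o o.ToType)

namespace HasType

variable {α β : Type} [LinearOrder α] [LinearOrder β] {a b o : Ordinal.{0}}

theorem wellFoundedLT (h : HasType α a) : WellFoundedLT α :=
  h.some.strictMono.wellFoundedLT

theorem typeLT_eq (h : HasType α a) [WellFoundedLT α] : typeLT α = a := by
  rw [← type_toType a, type_eq]
  exact ⟨h.some.toRelIsoLT⟩

theorem of_typeLT [WellFoundedLT α] (h : typeLT α = a) : HasType α a := by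
  rw [← type_toType a, type_eq] at h
  exact ⟨OrderIso.ofRelIsoLT h.some⟩

theorem congr (h : HasType α a) (e : β ≃o α) : HasType β a := ⟨e.trans h.some⟩

theorem orderIso (h₁ : HasType α a) (h₂ : HasType β a) : Nonempty (α ≃o β) :=
  ⟨h₁.some.trans h₂.some.symm⟩

theorem le_of_embedding (h₁ : HasType α a) (h₂ : HasType β b) (f : α ↪o β) : a ≤ b := by
  have := h₁.wellFoundedLT
  have := h₂.wellFoundedLT
  rw [← h₁.typeLT_eq, ← h₂.typeLT_eq, type_le_iff']
  exact ⟨f.ltEmbedding⟩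

theorem eq_of_orderIso (h₁ : HasType α a) (h₂ : HasType β b) (e : α ≃o β) : a = b :=
  (h₁.le_of_embedding h₂ e.toOrderEmbedding).antisymm
    (h₂.le_of_embedding h₁ e.symm.toOrderEmbedding)

theorem of_finite [Finite α] : ∃ n : ℕ, HasType α n := by
  have := Fintype.ofFinite α
  exact ⟨Fintype.card α, of_typeLT (type_fintype _)⟩

theorem add_of_upper (p : α → Prop) (hp : ∀ x y, x ≤ y → p x → p y) (h₁ : HasType {x // ¬ p x} a)
    (h₂ : HasType {x // p x} b) : HasType α (a + b) := by
  classical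
  have w₁ := h₁.wellFoundedLT
  have w₂ := h₂.wellFoundedLT
  have : WellFoundedLT ({x // ¬ p x} ⊕ₗ {x // p x}) := ⟨Sum.lex_wf w₁.wf w₂.wf⟩
  have e : {x // ¬ p x} ⊕ₗ {x // p x} ≃o α := by
    refine ⟨ofLex.trans ((Equiv.sumComm _ _).trans (Equiv.sumCompl p)), ?_⟩
    intro x y
    induction x using Lex.rec with | _ x => ?_
    induction y using Lex.rec with | _ y => ?_
    rcases x with ⟨x, hx⟩ | ⟨x, hx⟩ <;> rcases y with ⟨y, hy⟩ | ⟨y, hy⟩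
    · simp
    · have : x ≤ y := by
        by_contra h
        exact hx (hp y x (not_le.1 h).le hy)
      simp [this]
    · have : ¬ x ≤ y := fun h => hy (hp x y h hx)
      simp [this]
    · simp
  refine HasType.congr (α := {x // ¬ p x} ⊕ₗ {x // p x}) ?_ e.symm
  refine of_typeLT ?_
  rw [← h₁.typeLT_eq, ← h₂.typeLT_eq, ← type_sum_lex]
  rfl

/-- The first coordinate is the significant one, so the product consists of a copies of b; this
reverses the factors in ordinal multiplication. -/
theorem prod_lex (h₁ : HasType α a) (h₂ : HasType β b) : HasType (α ×ₗ β) (b * a) := by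
  have := h₁.wellFoundedLT
  have := h₂.wellFoundedLT
  refine of_typeLT ?_
  rw [← h₁.typeLT_eq, ← h₂.typeLT_eq, ← type_prod_lex]
  rfl

end HasType

theorem isWF_of_strictMono {α β : Type} [LinearOrder α] [LinearOrder β] {f : α → β}
    (hf : StrictMono f) {X : Set α} {Y : Set β} (hY : Y.IsWF) (h : MapsTo f X Y) : X.IsWF :=
  (hY.mapsTo f h).mono' fun _ _ _ _ hab => hf hab

/-- A set `X` in a linear order that is mapped monotonically into an index set by `c`. In each
nonempty fiber, the elements with the property `s` form an initial segment of order type `ω*`, and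
the remaining elements are well-ordered. -/
structure IsBlockSum {Ω I : Type} [LinearOrder Ω] [LinearOrder I] (c : Ω → I) (s : Ω → Prop)
    (X : Set Ω) : Prop where
  lower : ∀ x ∈ X, ∀ y ∈ X, c x = c y → x ≤ y → s y → s x
  exists_lt : ∀ x ∈ X, s x → ∃ y ∈ X, y < x ∧ c y = c x ∧ s y
  finite_above : ∀ x ∈ X, s x → {y ∈ X | s y ∧ c y = c x ∧ x ≤ y}.Finite
  isWF : ∀ i, {x ∈ X | c x = i ∧ ¬ s x}.IsWF
  exists_mem : ∀ x ∈ X, ∃ y ∈ X, c y = c x ∧ s y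

theorem finite_Icc_of_le {α : Type} [LinearOrder α] {x y : α} (h : x ≤ y) : (Icc y x).Finite :=
  (finite_singleton x).subset fun _ hz => le_antisymm hz.2 (h.trans hz.1)

namespace IsBlockSum

variable {Ω I : Type} [LinearOrder Ω] [LinearOrder I] {c : Ω → I} {s : Ω → Prop} {X Y : Set Ω}

theorem isWF_above (h : IsBlockSum c s X) {x : Ω} (hx : x ∈ X) :
    {y ∈ X | c y = c x ∧ x ≤ y}.IsWF := by
  by_cases hs : s x
  · refine ((h.finite_above x hx hs).isWF.union (h.isWF (c x))).mono ?_
    rintro y ⟨hy, hc, hxy⟩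
    by_cases hsy : s y
    · exact Or.inl ⟨hy, hsy, hc, hxy⟩
    · exact Or.inr ⟨hy, hc, hsy⟩
  · refine (h.isWF (c x)).mono ?_
    rintro y ⟨hy, hc, hxy⟩
    exact ⟨hy, hc, fun hsy => hs (h.lower x hx y hy hc.symm hxy hsy)⟩

/-- Within a block, what lies above a point is a finite piece of ω* followed by a well-order. An
interval that ends in a later block contains an infinite descent into the ω* at the bottom of that
block. -/
theorem isWF_Icc_iff (hc : Monotone c) (h : IsBlockSum c s X) {x y : X} (hxy : x ≤ y) :
    (Icc x y).IsWF ↔ c x = c y := by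
  constructor
  · intro hwf
    by_contra hne
    have hlt : c x < c y := (hc hxy).lt_of_ne hne
    obtain ⟨z, hz, hcz, hsz⟩ : ∃ z ∈ X, (c z = c y ∧ s z) ∧ z ≤ y := by
      obtain ⟨z, hz, hcz, hsz⟩ := h.exists_mem y y.2
      rcases le_total z y with hzy | hzy
      · exact ⟨z, hz, ⟨hcz, hsz⟩, hzy⟩
      · exact ⟨y, y.2, ⟨rfl, h.lower y y.2 z hz hcz.symm hzy hsz⟩, le_rfl⟩
    have hwf' : {w : X | (c w = c y ∧ s w) ∧ w ≤ y}.IsWF := hwf.mono fun w hw =>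
      ⟨le_of_not_gt fun hlt' => (hc hlt'.le).not_gt (hw.1.1 ▸ hlt), hw.2⟩
    have hne' : {w : X | (c w = c y ∧ s w) ∧ w ≤ y}.Nonempty := ⟨⟨z, hz⟩, hcz, hsz⟩
    obtain ⟨⟨hm₁, hm₂⟩, hm₃⟩ := hwf'.min_mem hne'
    obtain ⟨w, hw, hlt', hcw, hsw⟩ := h.exists_lt _ (hwf'.min hne').2 hm₂
    refine hwf'.not_lt_min hne' (a := ⟨w, hw⟩) ⟨⟨hcw.trans hm₁, hsw⟩, ?_⟩ hlt'
    exact le_trans (b := hwf'.min hne') hlt'.le hm₃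
  · intro he
    refine isWF_of_strictMono (f := Subtype.val) (fun _ _ h => h) (h.isWF_above x.2) ?_
    intro z hz
    exact ⟨z.2, le_antisymm (he ▸ hc hz.2) (hc hz.1), hz.1⟩

theorem eq_iff_isWF (hc : Monotone c) (h : IsBlockSum c s X) (x y : X) :
    c x = c y ↔ (Icc x y).IsWF ∧ (Icc y x).IsWF := by
  rcases le_total x y with hxy | hxy
  · rw [h.isWF_Icc_iff hc hxy]
    refine ⟨fun he => ⟨he, ?_⟩, fun he => he.1⟩
    exact (finite_Icc_of_le hxy).isWF
  · rw [h.isWF_Icc_iff hc hxy]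
    refine ⟨fun he => ⟨?_, he.symm⟩, fun he => he.2.symm⟩
    exact (finite_Icc_of_le hxy).isWF

/-- Lying in the same block is expressed by well-foundedness of intervals, so φ respects it. The
induced bijection of blocks is monotone between equal well-ordered index sets and therefore the
identity. -/
theorem apply_orderIso [WellFoundedLT I] (hc : Monotone c) (hX : IsBlockSum c s X)
    (hY : IsBlockSum c s Y) (hXY : c '' X = c '' Y) (φ : X ≃o Y) (x : X) : c (φ x) = c x := by
  have hφ : ∀ x y : X, c (φ x) = c (φ y) ↔ c x = c y := by
    intro x y
    have h : ∀ x y : X, (Icc (φ x) (φ y)).IsWF ↔ (Icc x y).IsWF := fun x y =>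
      ⟨fun h => isWF_of_strictMono φ.strictMono h fun z hz => ⟨φ.monotone hz.1, φ.monotone hz.2⟩,
        fun h => isWF_of_strictMono φ.symm.strictMono h fun z hz =>
          ⟨φ.le_symm_apply.2 hz.1, φ.symm_apply_le.2 hz.2⟩⟩
    rw [hX.eq_iff_isWF hc, hY.eq_iff_isWF hc, h, h]
  have key : ∀ i : I, ∀ x : X, c x = i → c (φ x) = i := by
    intro i
    induction i using WellFoundedLT.induction with
    | ind i ih =>
      rintro x rfl
      rcases lt_trichotomy (c (φ x)) (c x) with hlt | heq | hlt
      -- If the index drops, the lower block, which is fixed by induction, would also receive the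
      -- block of x.
      · obtain ⟨z, hz, hzc⟩ : c (φ x) ∈ c '' X := hXY ▸ mem_image_of_mem c (φ x).2
        have h₁ := ih _ hlt ⟨z, hz⟩ hzc
        have h₂ : c z = c x := (hφ ⟨z, hz⟩ x).1 h₁
        exact absurd (hzc.symm.trans h₂) hlt.ne
      · exact heq
      -- If the index rises, the block of Y with the index of x must be hit by some w below x:
      -- either w lies in an earlier block, which is fixed, or in the block of x, which was mapped
      -- higher.
      · obtain ⟨z, hz, hzc⟩ : c x ∈ c '' Y := hXY ▸ mem_image_of_mem c x.2
        obtain ⟨w, hw⟩ := φ.surjective ⟨z, hz⟩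
        have hcw : c (φ w) = c x := by rw [hw]; exact hzc
        have hwx : w < x := by
          rw [← φ.lt_iff_lt]
          by_contra hle
          have := hc (Subtype.coe_le_coe.2 (not_lt.1 hle))
          rw [hcw] at this
          exact this.not_gt hlt
        rcases (hc (Subtype.coe_le_coe.2 hwx.le)).lt_or_eq with h | h
        · have := ih _ h w rfl
          rw [hcw] at this
          exact absurd this.symm h.ne
        · have := (hφ w x).2 h
          rw [hcw] at this
          exact absurd this hlt.ne
  exact key _ x rfl

/-- Cutting the block at a point of ω* leaves finitely many points of ω* before the well-ordered
part. -/
theorem hasType_above (hX : IsBlockSum c s X) {x : Ω} (hx : x ∈ X) (hs : s x) {a : Ordinal.{0}}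
    (ha : HasType {y // y ∈ X ∧ c y = c x ∧ ¬ s y} a) :
    ∃ k : ℕ, HasType {y // y ∈ X ∧ c y = c x ∧ x ≤ y} (k + a) := by
  have hfin : Finite {y : {y // y ∈ X ∧ c y = c x ∧ x ≤ y} // ¬ ¬ s y} := by
    have := (hX.finite_above x hx hs).to_subtype
    refine Finite.of_injective (β := {y ∈ X | s y ∧ c y = c x ∧ x ≤ y})
      (fun y => ⟨y.1.1, y.1.2.1, not_not.1 y.2, y.1.2.2⟩) ?_
    intro y z h
    exact Subtype.ext (Subtype.ext (Subtype.mk.inj h))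
  obtain ⟨k, hk⟩ := HasType.of_finite (α := {y : {y // y ∈ X ∧ c y = c x ∧ x ≤ y} // ¬ ¬ s y})
  refine ⟨k, hk.add_of_upper _ ?_ (ha.congr ?_)⟩
  · rintro ⟨y, hy⟩ ⟨z, hz⟩ hyz hsy hsz
    exact hsy (hX.lower y hy.1 z hz.1 (hy.2.1.trans hz.2.1.symm) hyz hsz)
  · refine ⟨⟨fun y => ⟨y.1.1, y.1.2.1, y.1.2.2.1, y.2⟩,
      fun y => ⟨⟨y.1, y.2.1, y.2.2.1, ?_⟩, y.2.2.2⟩, fun _ => rfl, fun _ => rfl⟩, Iff.rfl⟩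
    by_contra hle
    exact y.2.2.2 (hX.lower y.1 y.2.1 x hx y.2.2.1 (not_le.1 hle).le hs)

/-- An isomorphism need not match the borders between ω* and the well-ordered parts. Cutting at a
point that lies in ω* on both sides compares the parts up to finite left summands. -/
theorem exists_natCast_add_eq [WellFoundedLT I] (hc : Monotone c) (hX : IsBlockSum c s X)
    (hY : IsBlockSum c s Y) (hXY : c '' X = c '' Y) (φ : X ≃o Y) {i : I} (hi : i ∈ c '' X)
    {a b : Ordinal.{0}} (ha : HasType {y // y ∈ X ∧ c y = i ∧ ¬ s y} a)
    (hb : HasType {y // y ∈ Y ∧ c y = i ∧ ¬ s y} b) : ∃ k m : ℕ, (k : Ordinal) + a = m + b := by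
  have hφ := hX.apply_orderIso hc hY hXY φ
  obtain ⟨x, hx, hci, hs, hφs⟩ : ∃ x, ∃ hx : x ∈ X, c x = i ∧ s x ∧ s (φ ⟨x, hx⟩) := by
    obtain ⟨x', hx', rfl⟩ := hi
    obtain ⟨y', hy', hcy'⟩ : c x' ∈ c '' Y := hXY ▸ mem_image_of_mem c hx'
    obtain ⟨x, hx, hcx, hsx⟩ := hX.exists_mem x' hx'
    obtain ⟨y, hy, hcy, hsy⟩ := hY.exists_mem y' hy'
    have hcφ : c (φ.symm ⟨y, hy⟩) = c x' := by
      rw [← hφ, OrderIso.apply_symm_apply, ← hcy', hcy]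
    -- The smaller of x and the preimage of y works, because the ω* parts are initial segments of
    -- their blocks.
    rcases le_total (⟨x, hx⟩ : X) (φ.symm ⟨y, hy⟩) with h | h
    · refine ⟨x, hx, hcx, hsx, hY.lower _ (φ ⟨x, hx⟩).2 y hy ?_ (φ.le_symm_apply.1 h) hsy⟩
      rw [hφ, hcy, hcy', hcx]
    · refine ⟨_, (φ.symm ⟨y, hy⟩).2, hcφ, hX.lower _ (φ.symm ⟨y, hy⟩).2 x hx ?_ h hsx, ?_⟩
      · rw [hcφ, hcx]
      · simpa using hsy
  subst hci
  obtain ⟨k, hk⟩ := hX.hasType_above hx hs ha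
  obtain ⟨m, hm⟩ := hY.hasType_above (φ ⟨x, hx⟩).2 hφs (a := b) (by rw [hφ]; exact hb)
  refine ⟨k, m, hk.eq_of_orderIso hm ?_⟩
  refine ⟨⟨fun y => ⟨φ ⟨y.1, y.2.1⟩, (φ _).2, ?_, ?_⟩, fun y => ⟨φ.symm ⟨y.1, y.2.1⟩, (φ.symm _).2,
    ?_, ?_⟩, fun y => ?_, fun y => ?_⟩, ?_⟩
  · rw [hφ, hφ]
    exact y.2.2.1
  · exact φ.monotone y.2.2.2
  · rw [← hφ, OrderIso.apply_symm_apply, y.2.2.1, hφ]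
  · exact φ.le_symm_apply (x := ⟨x, hx⟩) (y := ⟨y.1, y.2.1⟩) |>.2 y.2.2.2
  · simp
  · simp
  · intro y z
    exact φ.le_iff_le

/-- Two block sums are isomorphic if they differ only in the well-ordered parts of their fibers and
if these have equal types. -/
theorem nonempty_orderIso (hc : Monotone c) (hX : IsBlockSum c s X) (hY : IsBlockSum c s Y)
    (hs : ∀ x, s x → (x ∈ X ↔ x ∈ Y))
    (h : ∀ i, ∃ a, HasType {y // y ∈ X ∧ c y = i ∧ ¬ s y} a ∧
      HasType {y // y ∈ Y ∧ c y = i ∧ ¬ s y} a) : Nonempty (X ≃o Y) := by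
  classical
  -- Each block is split into its ω* part (`false`) and its well-ordered part (`true`), so that
  -- isomorphisms can be given separately for the two.
  have hmono : ∀ {Z : Set Ω}, IsBlockSum c s Z →
      Monotone fun x : Z => (toLex (c x, !decide (s x)) : I ×ₗ Bool) := by
    intro Z hZ x y hxy
    rw [Prod.Lex.toLex_le_toLex]
    rcases (hc hxy).lt_or_eq with h | h
    · exact Or.inl h
    · refine Or.inr ⟨h, ?_⟩
      by_cases hy : s y
      · simp [hZ.lower x x.2 y y.2 h hxy hy]
      · simp [hy]
  refine nonempty_orderIso_of_fibers (hmono hX) (hmono hY) fun i => ?_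
  induction i using Lex.rec with | _ i => ?_
  obtain ⟨i, b⟩ := i
  have e : ∀ (Z : Set Ω), {x : Z // (toLex (c x, !decide (s x)) : I ×ₗ Bool) = toLex (i, b)} ≃o
      {y // y ∈ Z ∧ c y = i ∧ (!decide (s y)) = b} := fun Z =>
    ⟨⟨fun x => ⟨x.1.1, x.1.2, by simpa using x.2⟩, fun y => ⟨⟨y.1, y.2.1⟩, by simpa using y.2.2⟩,
      fun _ => rfl, fun _ => rfl⟩, Iff.rfl⟩
  cases b with
  | true =>
    obtain ⟨a, h₁, h₂⟩ := h i
    have e' : ∀ (Z : Set Ω), {y // y ∈ Z ∧ c y = i ∧ (!decide (s y)) = true} ≃o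
        {y // y ∈ Z ∧ c y = i ∧ ¬ s y} := fun Z =>
      OrderIso.setCongr {y | y ∈ Z ∧ c y = i ∧ (!decide (s y)) = true}
        {y | y ∈ Z ∧ c y = i ∧ ¬ s y} (by ext; simp)
    exact (h₁.congr ((e X).trans (e' X))).orderIso (h₂.congr ((e Y).trans (e' Y)))
  | false =>
    have e' : {y // y ∈ X ∧ c y = i ∧ (!decide (s y)) = false} ≃o
        {y // y ∈ Y ∧ c y = i ∧ (!decide (s y)) = false} :=
      OrderIso.setCongr {y | y ∈ X ∧ c y = i ∧ (!decide (s y)) = false}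
        {y | y ∈ Y ∧ c y = i ∧ (!decide (s y)) = false} (by
          ext y
          simp only [mem_ofPred_eq, Bool.not_eq_false', decide_eq_true_eq]
          exact ⟨fun h => ⟨(hs y h.2.2).1 h.1, h.2⟩, fun h => ⟨(hs y h.2.2).2 h.1, h.2⟩⟩)
    exact ⟨((e X).trans e').trans (e Y).symm⟩

theorem scattered [WellFoundedLT I] (hc : Monotone c) (hX : IsBlockSum c s X) : Scattered X := by
  classical
  refine scattered_of_fibers (I := I ×ₗ Bool) (c := fun x : X => toLex (c x, !decide (s x))) ?_ ?_
  · intro x y hxy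
    rw [Prod.Lex.toLex_le_toLex]
    rcases (hc hxy).lt_or_eq with h | h
    · exact Or.inl h
    · refine Or.inr ⟨h, ?_⟩
      by_cases hy : s y
      · simp [hX.lower x x.2 y y.2 h hxy hy]
      · simp [hy]
  · intro i
    induction i using Lex.rec with | _ i => ?_
    obtain ⟨i, b⟩ := i
    cases b with
    | true =>
      refine Or.inl (isWF_of_strictMono (f := Subtype.val) (fun _ _ h => h) (hX.isWF i) ?_)
      intro x hx
      exact ⟨x.2, by simpa using hx⟩
    | false =>
      refine Or.inr fun x hx => ?_
      simp only [EmbeddingLike.apply_eq_iff_eq, Prod.mk.injEq, Bool.not_eq_false',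
        decide_eq_true_eq] at hx
      refine Finite.of_finite_image (f := Subtype.val) ((hX.finite_above x x.2 hx.2).subset ?_)
        Subtype.val_injective.injOn
      rintro _ ⟨y, ⟨hy, hxy⟩, rfl⟩
      simp only [EmbeddingLike.apply_eq_iff_eq, Prod.mk.injEq, Bool.not_eq_false',
        decide_eq_true_eq] at hy
      exact ⟨y.2, hy.2, hy.1.trans hx.1.symm, hxy⟩

end IsBlockSum

end TreeAutomatic

/-! ### Words in length-lexicographic order -/

namespace TreeAutomatic

open Ordinal Set
open scoped Computability

/-- Words with the length-lexicographic order. -/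
structure LenLex (A : Type) where
  toList : List A

namespace LenLex

variable {A : Type} [LinearOrder A]

noncomputable instance : LinearOrder (LenLex A) :=
  LinearOrder.lift' (fun w => SlottedWord.lenKey w.toList) (by
    rintro ⟨v⟩ ⟨w⟩ h
    simp only [SlottedWord.lenKey, EmbeddingLike.apply_eq_iff_eq, Prod.mk.injEq] at h
    rw [h.2])

/-- Only finitely many words over a finite alphabet have at most a given length. This makes the
index order of the blocks well-founded. -/
theorem finite_Iic [Finite A] (w : LenLex A) : (Iic w).Finite := by
  refine Finite.of_finite_image (f := toList) ((List.finite_length_le A w.toList.length).subset ?_)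
    (fun v _ w _ h => by
      obtain ⟨v⟩ := v
      obtain ⟨w⟩ := w
      exact congrArg LenLex.mk h)
  rintro _ ⟨v, hv, rfl⟩
  exact Prod.Lex.monotone_fst _ _ (show SlottedWord.lenKey v.toList ≤ SlottedWord.lenKey w.toList
    from hv)

instance [Finite A] : WellFoundedLT (LenLex A) := by
  have : StrictMono fun w : LenLex A => (Iic w).ncard := fun v w h =>
    ncard_lt_ncard (Iic_ssubset_Iic.2 h) (finite_Iic w)
  exact this.wellFoundedLT

end LenLex

/-- The word of a slotted word as an element of the length-lexicographic order. -/
def SlottedWord.lenLex {A G : Type} (x : SlottedWord A G) : LenLex A := ⟨x.word⟩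

theorem SlottedWord.monotone_lenLex {A G : Type} [LinearOrder A] [LinearOrder G] :
    Monotone (lenLex : SlottedWord A G → LenLex A) := fun _ _ h => Prod.Lex.monotone_fst _ _ h

theorem SlottedWord.le_iff_of_lenLex_eq {A G : Type} [LinearOrder A] [LinearOrder G]
    {x y : SlottedWord A G} (h : x.lenLex = y.lenLex) :
    x ≤ y ↔ (toLex (x.labels, x.slots) : List G ×ₗ List (List Bool)) ≤ toLex (y.labels, y.slots) := by
  have hw : x.word = y.word := congrArg LenLex.toList h
  rw [SlottedWord.le_iff_key, SlottedWord.key, SlottedWord.key, Prod.Lex.toLex_le_toLex, hw]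
  simp

theorem SlottedWord.lt_iff_of_lenLex_eq {A G : Type} [LinearOrder A] [LinearOrder G]
    {x y : SlottedWord A G} (h : x.lenLex = y.lenLex) :
    x < y ↔ (toLex (x.labels, x.slots) : List G ×ₗ List (List Bool)) < toLex (y.labels, y.slots) := by
  rw [← not_le, ← not_le, le_iff_of_lenLex_eq h.symm]

/-! ### Order types of sets of sequences of bit words -/

/-- The admissible slots of weight `k`; their order type is `ω ^ k` for `k ≤ 2`. -/
def slotLanguage : ℕ → Language Bool
  | 0 => 1
  | 1 => (Language.ofLetters {false})∗
  | _ => (Language.ofLetters {true})∗ * (Language.ofLetters {false})∗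

theorem isRegular_slotLanguage (k : ℕ) : (slotLanguage k).IsRegular := by
  match k with
  | 0 => exact Language.isRegular_one
  | 1 => exact (Language.isRegular_ofLetters _).kstar
  | k + 2 => exact (Language.isRegular_ofLetters _).kstar.mul (Language.isRegular_ofLetters _).kstar

theorem mem_kstar_ofLetters_singleton {b : Bool} {l : List Bool} :
    l ∈ (Language.ofLetters {b})∗ ↔ ∃ k, l = List.replicate k b := by
  rw [Language.mem_kstar_ofLetters]
  constructor
  · exact fun h => ⟨l.length, List.eq_replicate_iff.2 ⟨rfl, h⟩⟩
  · rintro ⟨k, rfl⟩ a ha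
    exact List.eq_of_mem_replicate ha

theorem replicate_append_lt_replicate_append {α : Type} [LinearOrder α] (b : α) (k : ℕ)
    {l m : List α} (h : l < m) : List.replicate k b ++ l < List.replicate k b ++ m :=
  List.append_left_lt h

theorem replicate_lt_replicate {α : Type} [LinearOrder α] (b : α) {k m : ℕ} (h : k < m) :
    List.replicate k b < List.replicate m b := by
  obtain ⟨d, rfl⟩ := Nat.exists_eq_add_of_lt h
  have := replicate_append_lt_replicate_append b k (l := []) (m := List.replicate (d + 1) b)
    (List.nil_lt_cons _ _)
  rwa [List.append_nil, List.replicate_append_replicate] at this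

theorem hasType_nat : HasType ℕ ω := HasType.of_typeLT type_nat_lt

theorem hasType_slotLanguage {k : ℕ} (hk : k ≤ 2) :
    HasType {l // l ∈ slotLanguage k} (ω ^ (k : Ordinal)) := by
  match k with
  | 0 =>
    have : Unique {l // l ∈ slotLanguage 0} := ⟨⟨⟨[], rfl⟩⟩, fun l => Subtype.ext l.2⟩
    refine HasType.of_typeLT ?_
    rw [Nat.cast_zero, opow_zero]
    exact type_eq_one_of_unique _
  | 1 =>
    rw [Nat.cast_one, opow_one]
    have hmono : StrictMono fun n : ℕ => (⟨List.replicate n false,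
        mem_kstar_ofLetters_singleton.2 ⟨n, rfl⟩⟩ : {l // l ∈ slotLanguage 1}) := fun n m h =>
      replicate_lt_replicate false h
    refine hasType_nat.congr (hmono.orderIsoOfSurjective _ ?_).symm
    rintro ⟨l, hl⟩
    obtain ⟨n, rfl⟩ := mem_kstar_ofLetters_singleton.1 hl
    exact ⟨n, rfl⟩
  | 2 =>
    have hmem : ∀ l, l ∈ slotLanguage 2 ↔
        ∃ n m, l = List.replicate n true ++ List.replicate m false := by
      intro l
      simp only [slotLanguage, Language.mem_mul, mem_kstar_ofLetters_singleton]
      constructor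
      · rintro ⟨_, ⟨n, rfl⟩, _, ⟨m, rfl⟩, rfl⟩
        exact ⟨n, m, rfl⟩
      · rintro ⟨n, m, rfl⟩
        exact ⟨_, ⟨n, rfl⟩, _, ⟨m, rfl⟩, rfl⟩
    have hmono : StrictMono fun p : ℕ ×ₗ ℕ => (⟨List.replicate (ofLex p).1 true ++
        List.replicate (ofLex p).2 false, (hmem _).2 ⟨_, _, rfl⟩⟩ :
          {l // l ∈ slotLanguage 2}) := by
      intro p q h
      induction p using Lex.rec with | _ p => ?_
      induction q using Lex.rec with | _ q => ?_
      obtain ⟨n, m⟩ := p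
      obtain ⟨n', m'⟩ := q
      rw [Subtype.mk_lt_mk]
      simp only [ofLex_toLex]
      rcases Prod.Lex.toLex_lt_toLex.1 h with h | ⟨h, h'⟩
      -- After the common prefix of n letters `true`, the shorter run ends or continues with
      -- `false`, and both are below `true`.
      · obtain ⟨d, rfl⟩ := Nat.exists_eq_add_of_lt h
        simp only at *
        rw [add_assoc, ← List.replicate_append_replicate, List.append_assoc]
        refine replicate_append_lt_replicate_append true n ?_
        rw [List.replicate_succ, List.cons_append]
        cases m with
        | zero => exact List.nil_lt_cons _ _
        | succ m => exact List.cons_lt_cons_iff.2 (Or.inl (by decide))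
      · simp only at h h'
        rw [h]
        exact replicate_append_lt_replicate_append true n' (replicate_lt_replicate false h')
    have := hasType_nat.prod_lex hasType_nat
    rw [show ((2 : ℕ) : Ordinal) = 1 + 1 by norm_num, opow_add, opow_one]
    refine this.congr (hmono.orderIsoOfSurjective _ ?_).symm
    rintro ⟨l, hl⟩
    obtain ⟨n, m, rfl⟩ := (hmem l).1 hl
    exact ⟨toLex (n, m), rfl⟩

/-- The sequences of slots with prescribed weights. -/
abbrev SlotSeq (ks : List ℕ) : Type :=
  {v : List (List Bool) // List.Forall₂ (fun k l => l ∈ slotLanguage k) ks v}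

/-- Lexicographic products of powers of ω add the exponents. The exponents are natural numbers, so
the reversed order of the factors is harmless. -/
theorem hasType_slotSeq (ks : List ℕ) (hks : ∀ k ∈ ks, k ≤ 2) :
    HasType (SlotSeq ks) (ω ^ ((ks.sum : ℕ) : Ordinal)) := by
  induction ks with
  | nil =>
    have : Unique (SlotSeq []) :=
      ⟨⟨⟨[], List.Forall₂.nil⟩⟩, fun v => Subtype.ext (List.forall₂_nil_left_iff.1 v.2)⟩
    refine HasType.of_typeLT ?_
    rw [List.sum_nil, Nat.cast_zero, opow_zero]
    exact type_eq_one_of_unique _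
  | cons k ks ih =>
    have h := (hasType_slotLanguage (hks k (by simp))).prod_lex
      (ih fun k hk => hks k (by simp [hk]))
    rw [← opow_add, ← Nat.cast_add, add_comm, ← List.sum_cons] at h
    have hmono : StrictMono fun p : {l // l ∈ slotLanguage k} ×ₗ SlotSeq ks =>
        (⟨(ofLex p).1.1 :: (ofLex p).2.1, List.Forall₂.cons (ofLex p).1.2 (ofLex p).2.2⟩ :
          SlotSeq (k :: ks)) := by
      intro p q h
      induction p using Lex.rec with | _ p => ?_
      induction q using Lex.rec with | _ q => ?_
      rw [Subtype.mk_lt_mk]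
      simp only [ofLex_toLex]
      rcases Prod.Lex.toLex_lt_toLex.1 h with h | ⟨h, h'⟩
      · exact List.cons_lt_cons_iff.2 (Or.inl h)
      · exact List.cons_lt_cons_iff.2 (Or.inr ⟨congrArg Subtype.val h, h'⟩)
    refine h.congr (hmono.orderIsoOfSurjective _ ?_).symm
    rintro ⟨v, hv⟩
    obtain ⟨l, v', hl, hv', rfl⟩ := List.forall₂_cons_left_iff.1 hv
    exact ⟨toLex (⟨l, hl⟩, ⟨v', hv'⟩), rfl⟩

/-! ### The labels -/

/-- The labels of the letters. Words whose labels are `sepHead` followed by `sep` form the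
initial segment of type `ω*` of a fiber, words with the label `flag` an optional segment, and words
with the labels `base` and `err x` search for an error of the kind `x`. -/
inductive Label (q : ℕ) where
  | sepHead
  | sep
  | flag
  | base
  | err (x : Fin q)

namespace Label

variable {q : ℕ}

/-- The rank of a label. -/
def rank : Label q → ℕ
  | sepHead => 0
  | sep => 1
  | flag => 2
  | base => 3
  | err x => 4 + x

theorem rank_injective : Function.Injective (rank (q := q)) := by
  rintro (_ | _ | _ | _ | x) (_ | _ | _ | _ | y) h <;> simp only [rank] at h <;>
    first | rfl | omega | skip
  rw [Fin.ext (by omega : (x : ℕ) = y)]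

instance : LinearOrder (Label q) := LinearOrder.lift' rank rank_injective

instance : Finite (Label q) := by
  refine Finite.of_injective (β := Fin (q + 4)) (fun g => ⟨g.rank, ?_⟩) fun g h hgh =>
    rank_injective (congrArg Fin.val hgh)
  cases g <;> simp only [rank] <;> omega

end Label

end TreeAutomatic

/-! ### Systems of errors -/

namespace Language

open scoped Computability

theorem IsRegular.of_mem_iff {α : Type} {L L' : Language α} (h : L.IsRegular)
    (hL : ∀ w, w ∈ L' ↔ w ∈ L) : L'.IsRegular := by
  rwa [show L' = L from Set.ext hL]

theorem isRegular_exists {α ι : Type} [Finite ι] {L : ι → Language α} (h : ∀ i, (L i).IsRegular) :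
    IsRegular ({w | ∃ i, w ∈ L i} : Language α) := by
  classical
  have := Fintype.ofFinite ι
  have : ∀ s : Finset ι, IsRegular ({w | ∃ i ∈ s, w ∈ L i} : Language α) := by
    intro s
    induction s using Finset.induction_on with
    | empty =>
      refine (isRegular_ofLetters (∅ : Set α)).of_mem_iff fun w => ?_
      change (∃ i ∈ (∅ : Finset ι), w ∈ L i) ↔ ∃ a ∈ (∅ : Set α), w = [a]
      simp
    | insert i s hi ih =>
      refine ((h i).add ih).of_mem_iff fun w => ?_
      change (∃ j ∈ insert i s, w ∈ L j) ↔ w ∈ L i ∨ ∃ j ∈ s, w ∈ L j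
      simp
  refine (this Finset.univ).of_mem_iff fun w => ?_
  change (∃ i, w ∈ L i) ↔ ∃ i ∈ Finset.univ, w ∈ L i
  simp

theorem mem_kstar_ofLetters_snd {α β : Type} {b : β} {l : List (α × β)} :
    l ∈ (ofLetters {y | y.2 = b})∗ ↔ l.map Prod.snd = List.replicate l.length b := by
  rw [mem_kstar_ofLetters, List.eq_replicate_iff]
  simp [forall_comm (α := α)]

end Language

namespace TreeAutomatic

open Ordinal Set
open scoped Computability

/-- A system of kinds of errors on a regular language of nonempty words: letters have a weight with
respect to every kind of error, and an error of the kind `x` occurs in a word before a letter in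
`trig x` if the sum of the weights of the preceding letters exceeds their number. -/
structure ErrorSystem (A : Type) (q : ℕ) where
  words : Language A
  isRegular_words : words.IsRegular
  nil_notMem : [] ∉ words
  wt : Fin q → A → ℕ
  wt_le : ∀ x a, wt x a ≤ 2
  trig : Fin q → Set A

namespace ErrorSystem

variable {A : Type} {q : ℕ} (S : ErrorSystem A q)

/-- The word contains an error. -/
def Bad (w : List A) : Prop :=
  ∃ x u a v, w = u ++ a :: v ∧ a ∈ S.trig x ∧ u.length < (u.map (S.wt x)).sum

/-- The labels form a separator. -/
def IsSep (w : List A) (γ : List (Label q)) : Prop :=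
  ∃ a v, w = a :: v ∧ γ = .sepHead :: List.replicate v.length .sep

/-- All labels are `flag`. -/
def IsFlag (w : List A) (γ : List (Label q)) : Prop := γ = List.replicate w.length .flag

/-- The labels describe the search for an error. -/
def IsSearch (w : List A) (γ : List (Label q)) : Prop :=
  γ = List.replicate w.length .base ∨ ∃ x u a v, w = u ++ a :: v ∧ a ∈ S.trig x ∧
    γ = List.replicate u.length (.err x) ++ List.replicate (v.length + 1) .base

/-- The weight of a letter with a label. -/
def labelWeight (a : A) : Label q → ℕ
  | .sepHead => 0
  | .sep => 0
  | .flag => 1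
  | .base => 1
  | .err x => S.wt x a

/-- The slots that are admissible for a letter with a label. -/
def slotCond (a : A) : Label q → Language Bool
  | .sepHead => (Language.ofLetters {false})∗ * Language.ofLetters {true}
  | g => slotLanguage (S.labelWeight a g)

/-- All slots are admissible. -/
def SlotsOk (x : SlottedWord A (Label q)) : Prop := ∀ y ∈ x.toList, y.2.2 ∈ S.slotCond y.1 y.2.1

/-- The labels and slots of a slotted word are admissible. -/
def Valid (x : SlottedWord A (Label q)) : Prop :=
  x.word ∈ S.words ∧ (IsSep x.word x.labels ∨ IsFlag x.word x.labels ∨ S.IsSearch x.word x.labels) ∧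
    S.SlotsOk x

theorem labelWeight_le (a : A) (g : Label q) : S.labelWeight a g ≤ 2 := by
  cases g <;> simp only [labelWeight] <;> first | omega | exact S.wt_le _ _

theorem isRegular_slotCond (a : A) (g : Label q) : (S.slotCond a g).IsRegular := by
  cases g with
  | sepHead => exact (Language.isRegular_ofLetters _).kstar.mul (Language.isRegular_ofLetters _)
  | sep => exact isRegular_slotLanguage 0
  | flag => exact isRegular_slotLanguage 1
  | base => exact isRegular_slotLanguage 1
  | err x => exact isRegular_slotLanguage (S.wt x a)

theorem isRegular_isSep :
    Language.IsRegular ({l | IsSep (l.map Prod.fst) (l.map Prod.snd)} : Language (A × Label q)) := by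
  refine Language.IsRegular.of_mem_iff ((Language.isRegular_ofLetters {y : A × Label q | y.2 = .sepHead}).mul
    (Language.isRegular_ofLetters {y : A × Label q | y.2 = .sep}).kstar) fun l => ?_
  rw [Language.mem_mul]
  simp only [Language.mem_kstar_ofLetters_snd]
  constructor
  · rintro ⟨a, v, h₁, h₂⟩
    obtain _ | ⟨y, l⟩ := l
    · simp at h₁
    simp only [List.map_cons, List.cons.injEq] at h₁ h₂
    refine ⟨[y], ⟨y, h₂.1, rfl⟩, l, ?_, rfl⟩
    rw [h₂.2, ← h₁.2, List.length_map]
  · rintro ⟨_, ⟨y, hy, rfl⟩, l, hl, rfl⟩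
    refine ⟨y.1, l.map Prod.fst, rfl, ?_⟩
    change y.2 :: l.map Prod.snd = _
    rw [hl, List.length_map, show y.2 = .sepHead from hy]

theorem isRegular_isFlag :
    Language.IsRegular ({l | IsFlag (l.map Prod.fst) (l.map Prod.snd)} : Language (A × Label q)) := by
  refine Language.IsRegular.of_mem_iff ((Language.isRegular_ofLetters {y : A × Label q | y.2 = .flag}).kstar) fun l => ?_
  rw [Language.mem_kstar_ofLetters_snd]
  change _ = _ ↔ _
  rw [List.length_map]

theorem isRegular_isSearch :
    Language.IsRegular
      ({l | S.IsSearch (l.map Prod.fst) (l.map Prod.snd)} : Language (A × Label q)) := by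
  refine Language.IsRegular.of_mem_iff ((Language.isRegular_ofLetters {y : A × Label q | y.2 = .base}).kstar.add
    (Language.isRegular_exists fun x =>
      (Language.isRegular_ofLetters {y : A × Label q | y.2 = .err x}).kstar.mul
      ((Language.isRegular_ofLetters {y : A × Label q | y.2 = .base ∧ y.1 ∈ S.trig x}).mul
      (Language.isRegular_ofLetters {y : A × Label q | y.2 = .base}).kstar))) fun l => ?_
  refine or_congr (Iff.trans ?_ Language.mem_kstar_ofLetters_snd.symm) ?_
  · rw [List.length_map]
  change _ ↔ ∃ x, l ∈ _
  simp only [Language.mem_mul]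
  refine exists_congr fun x => ?_
  simp only [Language.mem_kstar_ofLetters_snd]
  constructor
  · rintro ⟨u, a, v, h₁, ha, h₂⟩
    obtain ⟨l₁, m, rfl, rfl, hm⟩ := List.map_eq_append_iff.1 h₁
    obtain ⟨y, l₂, rfl, rfl, rfl⟩ := List.map_eq_cons_iff.1 hm
    rw [List.map_append, List.map_cons, List.replicate_succ] at h₂
    obtain ⟨h₂, h₃⟩ := List.append_inj h₂ (by simp)
    simp only [List.cons.injEq, List.length_map] at h₂ h₃
    exact ⟨l₁, h₂, y :: l₂, ⟨[y], ⟨y, ⟨h₃.1, ha⟩, rfl⟩, l₂, h₃.2, rfl⟩, rfl⟩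
  · rintro ⟨l₁, h₁, _, ⟨_, ⟨y, ⟨hy, ha⟩, rfl⟩, l₂, h₂, rfl⟩, rfl⟩
    refine ⟨l₁.map Prod.fst, y.1, l₂.map Prod.fst, by simp, ha, ?_⟩
    simp [h₁, h₂, hy, List.replicate_succ]

theorem isRegular_pairs : Language.IsRegular ({l | l.map Prod.fst ∈ S.words ∧
    (IsSep (l.map Prod.fst) (l.map Prod.snd) ∨ IsFlag (l.map Prod.fst) (l.map Prod.snd) ∨
      S.IsSearch (l.map Prod.fst) (l.map Prod.snd))} : Language (A × Label q)) :=
  (S.isRegular_words.preimage_map _).inf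
    (isRegular_isSep.add (isRegular_isFlag.add S.isRegular_isSearch))

/-- Regularity of the label patterns and of the slot languages is all that the presentation theorem
needs. -/
theorem exists_wordCondition [Finite A] : ∃ (M N : Type) (_ : Finite M) (_ : Finite N)
    (R : WordCondition A (Label q) M N), ∀ x, R.Holds x ↔ S.Valid x := by
  obtain ⟨M, hM, step, init, acc, h⟩ := S.isRegular_pairs.exists_foldr
  choose N hN slotStep slotInit slotAcc hslot using fun y : A × Label q =>
    (S.isRegular_slotCond y.1 y.2).exists_foldr
  -- A slot is evaluated before its letter and label are seen, so the automata for all pairs run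
  -- simultaneously, and the letter node selects the relevant one.
  refine ⟨M, ∀ y, N y, inferInstance, inferInstance,
    ⟨step, init, {m | acc m}, fun b p y => slotStep y b (p y), fun y => slotInit y,
      fun a g => {p | slotAcc (a, g) (p (a, g))}⟩, fun x => ?_⟩
  have hfold : ∀ (v : List Bool) y, v.foldr (fun b (p : ∀ y, N y) y => slotStep y b (p y))
      (fun y => slotInit y) y = v.foldr (slotStep y) (slotInit y) := by
    intro v y
    induction v with
    | nil => rfl
    | cons b v ih => rw [List.foldr_cons, List.foldr_cons, ih]
  rw [WordCondition.Holds, Valid, ← and_assoc]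
  refine and_congr ?_ (forall₂_congr fun y _ => ?_)
  · refine (h _).symm.trans ?_
    change List.map _ _ ∈ _ ∧ _ ↔ _
    rw [List.map_map, List.map_map]
    rfl
  · rw [hslot (y.1, y.2.1)]
    exact iff_of_eq (congrArg (slotAcc (y.1, y.2.1)) (hfold _ _))

end ErrorSystem

end TreeAutomatic

/-! ### The linear orders of a system of errors -/

namespace TreeAutomatic

open Ordinal Set
open scoped Computability

theorem HasType.of_iff {α : Type} [LinearOrder α] {p r : α → Prop} {a : Ordinal.{0}}
    (h : HasType {x // p x} a) (hr : ∀ x, r x ↔ p x) : HasType {x // r x} a := by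
  obtain rfl : r = p := funext fun x => propext (hr x)
  exact h

theorem HasType.subtype_subtype {α : Type} [LinearOrder α] {p p' : α → Prop} {r : α → Prop}
    {a : Ordinal.{0}} (h : HasType {x // r x} a) (hr : ∀ x, r x ↔ p x ∧ p' x) :
    HasType {x : {x // p x} // p' x.1} a := by
  obtain rfl : r = fun x => p x ∧ p' x := funext fun x => propext (hr x)
  exact h.congr ⟨Equiv.subtypeSubtypeEquivSubtypeInter p p', Iff.rfl⟩

namespace ErrorSystem

variable {A : Type} {q : ℕ} (S : ErrorSystem A q)

/-- The first label of a separator. -/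
def Starts (x : SlottedWord A (Label q)) : Prop := x.labels.head? = some .sepHead

/-- The valid words whose labels are `flag` only if the word belongs to `T`. -/
def carrier (T : Set (List A)) : Set (SlottedWord A (Label q)) :=
  {x | S.Valid x ∧ (.flag ∈ x.labels → x.word ∈ T)}

/-- The elements of the initial segments of the fibers. -/
def sepElt : List A → ℕ → SlottedWord A (Label q)
  | [], _ => ⟨[]⟩
  | a :: v, k => ⟨(a, .sepHead, List.replicate k false ++ [true]) :: v.map fun b => (b, .sep, [])⟩

theorem word_sepElt (w : List A) (k : ℕ) : (sepElt (q := q) w k).word = w := by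
  cases w <;> simp [sepElt, SlottedWord.word, Function.comp_def]

theorem labels_sepElt (a : A) (v : List A) (k : ℕ) :
    (sepElt (q := q) (a :: v) k).labels = .sepHead :: List.replicate v.length .sep := by
  simp [sepElt, SlottedWord.labels, Function.comp_def]

theorem sepElt_mem_carrier {w : List A} (hw : w ∈ S.words) (T : Set (List A)) (k : ℕ) :
    sepElt w k ∈ S.carrier T ∧ Starts (sepElt (q := q) w k) := by
  obtain _ | ⟨a, v⟩ := w
  · exact absurd hw S.nil_notMem
  have hl := labels_sepElt (q := q) a v k
  refine ⟨⟨⟨by rwa [word_sepElt], Or.inl ⟨a, v, word_sepElt _ _, hl⟩, ?_⟩, fun h => ?_⟩, ?_⟩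
  · intro y hy
    rcases List.mem_cons.1 hy with rfl | hy
    · exact Language.append_mem_mul (mem_kstar_ofLetters_singleton.2 ⟨k, rfl⟩) ⟨true, rfl, rfl⟩
    · obtain ⟨b, -, rfl⟩ := List.mem_map.1 hy
      exact rfl
  · rw [hl] at h
    rcases List.mem_cons.1 h with h | h
    · cases h
    · cases List.eq_of_mem_replicate h
  · rw [Starts, hl, List.head?_cons]

variable {S}

theorem Valid.ne_nil {x : SlottedWord A (Label q)} (h : S.Valid x) : x.word ≠ [] := fun h' =>
  S.nil_notMem (h' ▸ h.1)

theorem IsSearch.mem {w : List A} {γ : List (Label q)} (h : S.IsSearch w γ) :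
    γ.length = w.length ∧ ∀ g ∈ γ, .flag < g := by
  obtain rfl | ⟨x, u, a, v, rfl, -, rfl⟩ := h
  · refine ⟨List.length_replicate, fun g hg => ?_⟩
    rw [List.eq_of_mem_replicate hg]
    exact show 2 < 3 by norm_num
  · refine ⟨by simp, fun g hg => ?_⟩
    rcases List.mem_append.1 hg with hg | hg <;> rw [List.eq_of_mem_replicate hg]
    · exact show 2 < 4 + (x : ℕ) by omega
    · exact show 2 < 3 by norm_num

theorem Valid.starts_iff {x : SlottedWord A (Label q)} (h : S.Valid x) :
    Starts x ↔ IsSep x.word x.labels := by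
  constructor
  · intro hs
    obtain ⟨γ, hγ⟩ := List.head?_eq_some_iff.1 hs
    rcases h.2.1 with h' | h' | h'
    · exact h'
    · have : (Label.sepHead : Label q) ∈ x.labels := by simp [hγ]
      rw [h'] at this
      cases List.eq_of_mem_replicate this
    · have := h'.mem.2 .sepHead (by simp [hγ])
      exact absurd this (show ¬ 2 < 0 by norm_num)
  · rintro ⟨a, v, -, h'⟩
    rw [Starts, h', List.head?_cons]

theorem Valid.exists_eq_sepElt {x : SlottedWord A (Label q)} (h : S.Valid x) (hs : Starts x) :
    ∃ k, x = sepElt x.word k := by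
  obtain ⟨a, v, hw, hγ⟩ := h.starts_iff.1 hs
  have hok := h.2.2
  obtain ⟨_ | ⟨⟨b, g, s⟩, l⟩⟩ := x
  · cases hw
  simp only [SlottedWord.word, SlottedWord.labels, List.map_cons, List.cons.injEq] at hw hγ
  obtain ⟨rfl, hw⟩ := hw
  obtain ⟨rfl, hγ⟩ := hγ
  obtain ⟨u, hu, t, ⟨c, rfl, rfl⟩, rfl⟩ := Language.mem_mul.1 (hok _ List.mem_cons_self)
  obtain ⟨k, rfl⟩ := mem_kstar_ofLetters_singleton.1 hu
  refine ⟨k, ?_⟩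
  simp only [SlottedWord.word, List.map_cons, sepElt, SlottedWord.mk.injEq, List.cons.injEq, true_and]
  rw [List.map_map]
  refine (List.map_id l).symm.trans (List.map_congr_left fun y hy => ?_)
  have hsep : y.2.1 = .sep := by
    have : y.2.1 ∈ l.map fun y => y.2.1 := List.mem_map_of_mem hy
    rw [hγ] at this
    exact List.eq_of_mem_replicate this
  have hnil := hok y (List.mem_cons_of_mem _ hy)
  rw [hsep] at hnil
  exact Prod.ext rfl (Prod.ext hsep hnil)

variable [LinearOrder A]

/-- In the order with `false` below `true`, the slots 0ᵏ1 decrease as k grows. This produces ω*. -/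
theorem sepElt_lt_sepElt {w : List A} (hw : w ≠ []) {k m : ℕ} (h : k < m) :
    sepElt (q := q) w m < sepElt w k := by
  obtain ⟨a, v, rfl⟩ := List.exists_cons_of_ne_nil hw
  rw [SlottedWord.lt_iff_of_lenLex_eq
    (congrArg LenLex.mk ((word_sepElt _ _).trans (word_sepElt _ _).symm)), labels_sepElt,
    labels_sepElt, Prod.Lex.toLex_lt_toLex]
  refine Or.inr ⟨rfl, List.cons_lt_cons_iff.2 (Or.inl ?_)⟩
  obtain ⟨d, rfl⟩ := Nat.exists_eq_add_of_lt h
  rw [add_assoc, ← List.replicate_append_replicate, List.append_assoc]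
  refine replicate_append_lt_replicate_append false k ?_
  rw [List.replicate_succ, List.cons_append]
  exact List.cons_lt_cons_iff.2 (Or.inl (by decide))

/-- Labels are compared before slots, and `sepHead` is the least label. -/
theorem starts_of_le {x y : SlottedWord A (Label q)} (hx : S.Valid x) (h : x.lenLex = y.lenLex)
    (hxy : x ≤ y) (hy : Starts y) : Starts x := by
  by_contra hs
  obtain ⟨γ, hγ⟩ := List.head?_eq_some_iff.1 hy
  obtain ⟨g, δ, hδ, hg⟩ : ∃ g δ, x.labels = g :: δ ∧ Label.sepHead < g := by
    have hne : x.labels ≠ [] := by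
      have := hx.ne_nil
      simp only [SlottedWord.word, SlottedWord.labels, ne_eq, List.map_eq_nil_iff] at this ⊢
      exact this
    obtain ⟨g, δ, hδ⟩ := List.exists_cons_of_ne_nil hne
    refine ⟨g, δ, hδ, lt_of_le_of_ne (Nat.zero_le _ : (0 : ℕ) ≤ g.rank) ?_⟩
    rintro rfl
    exact hs (by rw [Starts, hδ, List.head?_cons])
  refine not_lt.2 hxy ((SlottedWord.lt_iff_of_lenLex_eq h.symm).2
    (Prod.Lex.toLex_lt_toLex.2 (Or.inl ?_)))
  change y.labels < x.labels
  rw [hγ, hδ]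
  exact List.cons_lt_cons_iff.2 (Or.inl hg)

theorem lt_of_isFlag_of_isSearch {x y : SlottedWord A (Label q)} (hx : x.word ≠ [])
    (h : x.lenLex = y.lenLex) (hf : IsFlag x.word x.labels) (hs : S.IsSearch y.word y.labels) :
    x < y := by
  have hw : x.word = y.word := congrArg LenLex.toList h
  refine (SlottedWord.lt_iff_of_lenLex_eq h).2 (Prod.Lex.toLex_lt_toLex.2 (Or.inl ?_))
  change x.labels < y.labels
  obtain ⟨a, v, hv⟩ := List.exists_cons_of_ne_nil hx
  obtain ⟨hl, hm⟩ := hs.mem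
  rw [← hw, hv] at hl
  obtain ⟨g, δ, hδ⟩ := List.exists_cons_of_length_eq_add_one hl
  rw [show x.labels = _ from hf, hv, hδ]
  exact List.cons_lt_cons_iff.2 (Or.inl (hm g (by simp [hδ])))

/-! ### The order types of the parts -/

omit [LinearOrder A] in
-- Away from `sepHead`, whose slot language 0*1 is special, admissibility depends on the weights
-- alone.
theorem slotsOk_iff {x : SlottedWord A (Label q)} (hx : .sepHead ∉ x.labels) :
    S.SlotsOk x ↔ List.Forall₂ (fun k l => l ∈ slotLanguage k)
      (List.zipWith S.labelWeight x.word x.labels) x.slots := by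
  obtain ⟨l⟩ := x
  induction l with
  | nil => simp [SlottedWord.slots, SlotsOk, SlottedWord.word]
  | cons y l ih =>
    simp only [SlottedWord.labels, List.map_cons, List.mem_cons, not_or] at hx
    specialize ih hx.2
    simp only [SlotsOk, SlottedWord.word, SlottedWord.labels, SlottedWord.slots, List.map_cons,
      List.zipWith_cons_cons, List.forall₂_cons, List.forall_mem_cons] at ih ⊢
    rw [ih]
    refine and_congr_left' ?_
    obtain ⟨a, g, s⟩ := y
    cases g with
    | sepHead => exact absurd rfl hx.1
    | _ => rfl

omit [LinearOrder A] in
theorem exists_slottedWord {w : List A} {γ : List (Label q)} {v : List (List Bool)}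
    (h₁ : γ.length = w.length) (h₂ : v.length = w.length) :
    ∃ x : SlottedWord A (Label q), x.word = w ∧ x.labels = γ ∧ x.slots = v := by
  refine ⟨⟨w.zip (γ.zip v)⟩, ?_, ?_, ?_⟩
  · exact List.map_fst_zip (by simp [h₁, h₂])
  · change List.map (Prod.fst ∘ Prod.snd) _ = _
    rw [← List.map_map, List.map_snd_zip (by simp [h₁, h₂]), List.map_fst_zip (by simp [h₁, h₂])]
  · change List.map (Prod.snd ∘ Prod.snd) _ = _
    rw [← List.map_map, List.map_snd_zip (by simp [h₁, h₂]), List.map_snd_zip (by simp [h₁, h₂])]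

theorem hasType_of_labels {w : List A} {γ : List (Label q)} (hl : γ.length = w.length)
    (hγ : .sepHead ∉ γ) :
    HasType {x : SlottedWord A (Label q) // x.word = w ∧ x.labels = γ ∧ S.SlotsOk x}
      (ω ^ (((List.zipWith S.labelWeight w γ).sum : ℕ) : Ordinal)) := by
  have hmem : ∀ x : SlottedWord A (Label q), x.word = w → x.labels = γ → (S.SlotsOk x ↔
      List.Forall₂ (fun k l => l ∈ slotLanguage k) (List.zipWith S.labelWeight w γ) x.slots) := by
    rintro x rfl rfl
    exact slotsOk_iff hγ
  have hmono : StrictMono fun x : {x : SlottedWord A (Label q) //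
      x.word = w ∧ x.labels = γ ∧ S.SlotsOk x} =>
      (⟨x.1.slots, (hmem x.1 x.2.1 x.2.2.1).1 x.2.2.2⟩ :
        SlotSeq (List.zipWith S.labelWeight w γ)) := by
    rintro ⟨x, hx⟩ ⟨y, hy⟩ h
    have := (SlottedWord.lt_iff_of_lenLex_eq (congrArg LenLex.mk (hx.1.trans hy.1.symm))).1 h
    rw [hx.2.1, hy.2.1, Prod.Lex.toLex_lt_toLex] at this
    exact (this.resolve_left (lt_irrefl _)).2
  refine (hasType_slotSeq _ ?_).congr (hmono.orderIsoOfSurjective _ ?_)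
  · intro k hk
    obtain ⟨a, g, rfl⟩ : ∃ a g, S.labelWeight a g = k := by
      rw [← List.map_uncurry_zip_eq_zipWith] at hk
      obtain ⟨y, -, hy⟩ := List.mem_map.1 hk
      exact ⟨_, _, hy⟩
    exact S.labelWeight_le a g
  · rintro ⟨v, hv⟩
    obtain ⟨x, h₁, h₂, h₃⟩ := exists_slottedWord (v := v) hl (by
      rw [← hv.length_eq, List.length_zipWith, hl, min_self])
    exact ⟨⟨x, h₁, h₂, (hmem x h₁ h₂).2 (h₃ ▸ hv)⟩, Subtype.ext h₃⟩

/-- There are finitely many label sequences of the given length, and labels are compared before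
slots. So the set embeds into a finite sum of copies of ω^K. -/
theorem exists_hasType_of_labels_mem {w : List A} {Γ : Set (List (Label q))} {K : ℕ}
    (hl : ∀ γ ∈ Γ, γ.length = w.length) (hΓ : ∀ γ ∈ Γ, .sepHead ∉ γ)
    (hK : ∀ γ ∈ Γ, (List.zipWith S.labelWeight w γ).sum ≤ K) :
    ∃ (n : ℕ) (X : Ordinal.{0}), X ≤ ω ^ (K : Ordinal) * n ∧
      HasType {x : SlottedWord A (Label q) // x.word = w ∧ x.labels ∈ Γ ∧ S.SlotsOk x} X := by
  have : Finite Γ := ((List.finite_length_eq (Label q) w.length).subset hl).to_subtype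
  obtain ⟨n, hn⟩ := HasType.of_finite (α := Γ)
  have e : ∀ γ : Γ, Nonempty ({x : SlottedWord A (Label q) //
      x.word = w ∧ x.labels = γ ∧ S.SlotsOk x} ↪o (ω ^ (K : Ordinal.{0})).ToType) := fun γ =>
    ⟨(hasType_of_labels (S := S) (hl γ γ.2) (hΓ γ γ.2)).some.toOrderEmbedding.trans
      (type_le_iff.1 (by
        rw [type_toType, type_toType]
        exact opow_le_opow_right omega0_pos (Nat.cast_le.2 (hK γ γ.2)))).some.toOrderEmbedding⟩
  let f : {x : SlottedWord A (Label q) // x.word = w ∧ x.labels ∈ Γ ∧ S.SlotsOk x} →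
      Γ ×ₗ (ω ^ (K : Ordinal.{0})).ToType := fun x =>
    toLex (⟨x.1.labels, x.2.2.1⟩, (e ⟨x.1.labels, x.2.2.1⟩).some ⟨x.1, x.2.1, rfl, x.2.2.2⟩)
  have hf : StrictMono f := by
    have key : ∀ (γ δ : Γ) (_ : γ = δ) x y, x.1 < y.1 → (e γ).some x < (e δ).some y := by
      rintro γ _ rfl x y h
      exact (e γ).some.strictMono h
    rintro ⟨x, hx⟩ ⟨y, hy⟩ h
    rw [Prod.Lex.toLex_lt_toLex]
    have := (SlottedWord.lt_iff_of_lenLex_eq (congrArg LenLex.mk (hx.1.trans hy.1.symm))).1 h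
    rcases Prod.Lex.toLex_lt_toLex.1 this with h' | ⟨h', -⟩
    · exact Or.inl h'
    · exact Or.inr ⟨Subtype.ext h', key _ _ (Subtype.ext h') _ _ h⟩
  have hprod := hn.prod_lex (β := (ω ^ (K : Ordinal.{0})).ToType) ⟨OrderIso.refl _⟩
  have := hprod.wellFoundedLT
  have := hf.wellFoundedLT
  have hX := HasType.of_typeLT (α := {x : SlottedWord A (Label q) //
    x.word = w ∧ x.labels ∈ Γ ∧ S.SlotsOk x}) rfl
  exact ⟨n, _, hX.le_of_embedding hprod (OrderEmbedding.ofStrictMono f hf), hX⟩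

end ErrorSystem

end TreeAutomatic

namespace TreeAutomatic

open Ordinal Set
open scoped Computability

namespace ErrorSystem

variable {A : Type} {q : ℕ} {S : ErrorSystem A q}

theorem sum_zipWith_replicate {g : Label q} (hg : ∀ a, S.labelWeight a g = 1) (w : List A) :
    (List.zipWith S.labelWeight w (List.replicate w.length g)).sum = w.length := by
  induction w with
  | nil => rfl
  | cons a w ih =>
    rw [List.length_cons, List.replicate_succ, List.zipWith_cons_cons, List.sum_cons, ih, hg,
      add_comm]

/-- The trigger letter already carries `base`, so the exponent exceeds the length of the word
exactly when the weights of `u` sum to more than the length of `u`. -/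
theorem sum_zipWith_err (x : Fin q) (u : List A) (a : A) (v : List A) :
    (List.zipWith S.labelWeight (u ++ a :: v)
      (List.replicate u.length (.err x) ++ List.replicate (v.length + 1) .base)).sum =
      (u.map (S.wt x)).sum + (v.length + 1) := by
  rw [List.zipWith_append (by simp), List.sum_append]
  congr 1
  · induction u with
    | nil => rfl
    | cons b u ih =>
      rw [List.length_cons, List.replicate_succ, List.zipWith_cons_cons, List.sum_cons, ih,
        List.map_cons, List.sum_cons]
      rfl
  · exact sum_zipWith_replicate (S := S) (g := .base) (fun _ => rfl) (a :: v)

variable [LinearOrder A]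

theorem le_of_hasType_search {w : List A} {γ : List (Label q)} (h : S.IsSearch w γ)
    {X : Ordinal.{0}} (hX : HasType {x : SlottedWord A (Label q) //
      x.word = w ∧ S.IsSearch w x.labels ∧ S.SlotsOk x} X) :
    ω ^ (((List.zipWith S.labelWeight w γ).sum : ℕ) : Ordinal) ≤ X := by
  have hγ : .sepHead ∉ γ := fun h' => absurd (h.mem.2 _ h') (show ¬ 2 < 0 by norm_num)
  refine (hasType_of_labels (S := S) h.mem.1 hγ).le_of_embedding hX
    (OrderEmbedding.ofStrictMono (fun x => ⟨x.1, x.2.1, by rwa [x.2.2.1], x.2.2.2⟩) fun _ _ h => h)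

/-- An error contributes one summand whose exponent exceeds the length of w. Without errors there
are finitely many summands with exponent at most that length, and a finite multiple of ω^|w| stays
below ω^(|w|+1). -/
theorem exists_hasType_search (S : ErrorSystem A q) (w : List A) :
    ∃ X : Ordinal.{0}, HasType {x : SlottedWord A (Label q) //
      x.word = w ∧ S.IsSearch w x.labels ∧ S.SlotsOk x} X ∧ ω ^ (w.length : Ordinal) ≤ X ∧
      (S.Bad w ↔ ω ^ ((w.length + 1 : ℕ) : Ordinal) ≤ X) := by
  have hsep : ∀ γ, S.IsSearch w γ → .sepHead ∉ γ := fun γ h h' =>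
    absurd (h.mem.2 _ h') (show ¬ 2 < 0 by norm_num)
  -- The crude bound 2|w|, from weights of at most 2, serves only to show that the order type
  -- exists.
  obtain ⟨-, X, -, hX⟩ := exists_hasType_of_labels_mem (S := S) (w := w) (Γ := {γ | S.IsSearch w γ})
    (K := 2 * w.length) (fun γ h => h.mem.1) hsep (fun γ h => by
      refine (List.sum_le_card_nsmul _ 2 fun k hk => ?_).trans ?_
      · rw [← List.map_uncurry_zip_eq_zipWith] at hk
        obtain ⟨y, -, rfl⟩ := List.mem_map.1 hk
        exact S.labelWeight_le _ _
      · rw [List.length_zipWith, h.mem.1, min_self, _root_.smul_eq_mul, mul_comm])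
  refine ⟨X, hX, ?_, ?_, ?_⟩
  · have := le_of_hasType_search (S := S) (w := w) (Or.inl rfl) hX
    rwa [sum_zipWith_replicate fun _ => rfl] at this
  · rintro ⟨x, u, a, v, rfl, ha, h⟩
    refine le_trans ?_ (le_of_hasType_search (Or.inr ⟨x, u, a, v, rfl, ha, rfl⟩) hX)
    rw [sum_zipWith_err]
    refine opow_le_opow_right omega0_pos (Nat.cast_le.2 ?_)
    simp only [List.length_append, List.length_cons]
    omega
  · contrapose!
    intro hbad
    obtain ⟨n, X', hle, hX'⟩ := exists_hasType_of_labels_mem (S := S) (w := w)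
      (Γ := {γ | S.IsSearch w γ}) (K := w.length) (fun γ h => h.mem.1) hsep (by
        rintro γ (rfl | ⟨x, u, a, v, rfl, ha, rfl⟩)
        · rw [sum_zipWith_replicate fun _ => rfl]
        · rw [sum_zipWith_err, List.length_append, List.length_cons]
          refine Nat.add_le_add_right ?_ _
          by_contra h
          exact hbad ⟨x, u, a, v, rfl, ha, not_le.1 h⟩)
    rw [hX.eq_of_orderIso hX' (OrderIso.refl _)]
    refine hle.trans_lt (opow_mul_lt_opow (natCast_lt_omega0 n) ?_)
    exact_mod_cast Nat.lt_succ_self _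

omit [LinearOrder A] in
theorem not_isFlag_of_isSearch {w : List A} (hw : w ≠ []) {γ : List (Label q)}
    (h : S.IsSearch w γ) : ¬ IsFlag w γ := by
  intro hf
  obtain ⟨a, v, rfl⟩ := List.exists_cons_of_ne_nil hw
  exact absurd (h.mem.2 .flag (by rw [show γ = _ from hf]; simp)) (lt_irrefl _)

omit [LinearOrder A] in
theorem mem_carrier_and_iff {T : Set (List A)} {w : List A} (hw : w ∈ S.words)
    (x : SlottedWord A (Label q)) : (x ∈ S.carrier T ∧ x.lenLex = ⟨w⟩ ∧ ¬ Starts x) ↔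
      x.word = w ∧ (S.IsSearch w x.labels ∨ w ∈ T ∧ IsFlag w x.labels) ∧ S.SlotsOk x := by
  have hne : w ≠ [] := fun h => S.nil_notMem (h ▸ hw)
  constructor
  · rintro ⟨⟨hx, hf⟩, hxw, hs⟩
    obtain rfl : x.word = w := congrArg LenLex.toList hxw
    refine ⟨rfl, ?_, hx.2.2⟩
    rcases hx.2.1 with h | h | h
    · exact absurd (hx.starts_iff.2 h) hs
    · obtain ⟨a, v, hv⟩ := List.exists_cons_of_ne_nil hne
      exact Or.inr ⟨hf (by rw [show x.labels = _ from h, hv]; simp), h⟩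
    · exact Or.inl h
  · rintro ⟨rfl, h, hok⟩
    have hx : S.Valid x := ⟨hw, Or.inr (h.elim Or.inr fun h => Or.inl h.2), hok⟩
    refine ⟨⟨hx, fun h' => ?_⟩, rfl, fun hs => ?_⟩
    · rcases h with h | h
      · exact absurd (h.mem.2 _ h') (lt_irrefl _)
      · exact h.1
    · obtain ⟨γ, hγ⟩ := List.head?_eq_some_iff.1 hs
      have hmem : Label.sepHead ∈ x.labels := by simp [hγ]
      rcases h with h | ⟨-, h⟩
      · exact absurd (h.mem.2 _ hmem) (show ¬ 2 < 0 by norm_num)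
      · rw [show x.labels = _ from h] at hmem
        cases List.eq_of_mem_replicate hmem

/-- The part above the separator in the fiber of a word outside `T`. -/
theorem hasType_carrier_of_notMem {T : Set (List A)} {w : List A} (hw : w ∈ S.words) (hT : w ∉ T)
    {X : Ordinal.{0}} (hX : HasType {x : SlottedWord A (Label q) //
      x.word = w ∧ S.IsSearch w x.labels ∧ S.SlotsOk x} X) :
    HasType {x // x ∈ S.carrier T ∧ x.lenLex = ⟨w⟩ ∧ ¬ Starts x} X :=
  hX.of_iff fun x => by simp [mem_carrier_and_iff hw, hT]

/-- The part above the separator in the fiber of a word in `T`. -/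
theorem hasType_carrier_of_mem {T : Set (List A)} {w : List A} (hw : w ∈ S.words) (hT : w ∈ T)
    {X : Ordinal.{0}} (hX : HasType {x : SlottedWord A (Label q) //
      x.word = w ∧ S.IsSearch w x.labels ∧ S.SlotsOk x} X) :
    HasType {x // x ∈ S.carrier T ∧ x.lenLex = ⟨w⟩ ∧ ¬ Starts x} (ω ^ (w.length : Ordinal) + X) := by
  have hne : w ≠ [] := fun h => S.nil_notMem (h ▸ hw)
  refine HasType.of_iff (p := fun x : SlottedWord A (Label q) => x.word = w ∧
    (S.IsSearch w x.labels ∨ IsFlag w x.labels) ∧ S.SlotsOk x) ?_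
    fun x => by simp [mem_carrier_and_iff hw, hT]
  refine HasType.add_of_upper (fun x => S.IsSearch w x.1.labels) ?_ ?_ ?_
  · rintro ⟨x, hx, _, _⟩ ⟨y, hy, hy', _⟩ hxy h
    by_contra hs
    have hf : IsFlag y.word y.labels := by
      rw [hy]
      exact hy'.resolve_left hs
    have hs' : S.IsSearch x.word x.labels := by
      rw [hx]
      exact h
    exact not_lt.2 hxy (lt_of_isFlag_of_isSearch (hy ▸ hne)
      (congrArg LenLex.mk (hy.trans hx.symm)) hf hs')
  · have := hasType_of_labels (S := S) (w := w) (γ := List.replicate w.length .flag)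
      List.length_replicate (fun h => by cases List.eq_of_mem_replicate h)
    rw [sum_zipWith_replicate fun _ => rfl] at this
    refine this.subtype_subtype (p := fun x => x.word = w ∧
      (S.IsSearch w x.labels ∨ IsFlag w x.labels) ∧ S.SlotsOk x)
      (p' := fun x => ¬ S.IsSearch w x.labels) fun x => ?_
    constructor
    · rintro ⟨h₁, h₂, h₃⟩
      exact ⟨⟨h₁, Or.inr h₂, h₃⟩, fun h => not_isFlag_of_isSearch hne h h₂⟩
    · rintro ⟨⟨h₁, h₂, h₃⟩, h⟩
      exact ⟨h₁, h₂.resolve_left h, h₃⟩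
  · refine hX.subtype_subtype (p := fun x => x.word = w ∧
      (S.IsSearch w x.labels ∨ IsFlag w x.labels) ∧ S.SlotsOk x)
      (p' := fun x => S.IsSearch w x.labels) fun x => ?_
    exact ⟨fun h => ⟨⟨h.1, Or.inl h.2.1, h.2.2⟩, h.2.1⟩, fun h => ⟨h.1.1, h.2, h.1.2.2⟩⟩

/-- The part above the separator in a fiber has an order type. -/
theorem exists_hasType_carrier (S : ErrorSystem A q) (T : Set (List A)) (w : List A) :
    ∃ X : Ordinal.{0}, HasType {x // x ∈ S.carrier T ∧ x.lenLex = ⟨w⟩ ∧ ¬ Starts x} X := by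
  by_cases hw : w ∈ S.words
  · obtain ⟨X, hX, -⟩ := S.exists_hasType_search w
    by_cases hT : w ∈ T
    · exact ⟨_, hasType_carrier_of_mem hw hT hX⟩
    · exact ⟨_, hasType_carrier_of_notMem hw hT hX⟩
  · have : IsEmpty {x // x ∈ S.carrier T ∧ x.lenLex = ⟨w⟩ ∧ ¬ Starts x} :=
      ⟨fun x => by
        have h := x.2.1.1.1
        rw [show x.1.word = w from congrArg LenLex.toList x.2.2.1] at h
        exact hw h⟩
    obtain ⟨n, hn⟩ := HasType.of_finite
      (α := {x // x ∈ S.carrier T ∧ x.lenLex = ⟨w⟩ ∧ ¬ Starts x})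
    exact ⟨n, hn⟩

theorem isBlockSum_carrier (S : ErrorSystem A q) (T : Set (List A)) :
    IsBlockSum SlottedWord.lenLex Starts (S.carrier T) where
  lower x hx y _ h hxy hs := starts_of_le hx.1 h hxy hs
  exists_lt x hx hs := by
    obtain ⟨k, hk⟩ := hx.1.exists_eq_sepElt hs
    have h := S.sepElt_mem_carrier hx.1.1 T (k + 1)
    exact ⟨_, h.1, (sepElt_lt_sepElt hx.1.ne_nil k.lt_succ_self).trans_eq hk.symm,
      congrArg LenLex.mk (word_sepElt _ _), h.2⟩
  finite_above x hx hs := by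
    obtain ⟨k, hk⟩ := hx.1.exists_eq_sepElt hs
    refine ((finite_Iic k).image (sepElt x.word)).subset ?_
    rintro y ⟨hy, hys, hyx, hxy⟩
    have hw : y.word = x.word := congrArg LenLex.toList hyx
    obtain ⟨m, hm⟩ := hy.1.exists_eq_sepElt hys
    rw [hw] at hm
    refine ⟨m, mem_Iic.2 (not_lt.1 fun hlt => ?_), hm.symm⟩
    have := sepElt_lt_sepElt (q := q) hx.1.ne_nil hlt
    rw [← hm, ← hk] at this
    exact not_lt.2 hxy this
  isWF i := by
    obtain ⟨X, hX⟩ := S.exists_hasType_carrier T i.toList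
    exact hX.wellFoundedLT.wf
  exists_mem x hx := by
    have h := S.sepElt_mem_carrier hx.1.1 T 0
    exact ⟨_, h.1, congrArg LenLex.mk (word_sepElt _ _), h.2⟩

omit [LinearOrder A] in
theorem image_carrier (S : ErrorSystem A q) (T : Set (List A)) :
    SlottedWord.lenLex '' S.carrier T = {i | i.toList ∈ S.words} := by
  ext i
  constructor
  · rintro ⟨x, hx, rfl⟩
    exact hx.1.1
  · intro h
    exact ⟨_, (S.sepElt_mem_carrier h T 0).1, congrArg LenLex.mk (word_sepElt _ _)⟩

theorem scattered_carrier [Finite A] (S : ErrorSystem A q) (T : Set (List A)) :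
    Scattered (S.carrier T) :=
  (S.isBlockSum_carrier T).scattered SlottedWord.monotone_lenLex

/-- The additional initial segments of the fibers can be recognized if and only if the
corresponding words contain no errors. -/
theorem nonempty_orderIso_carrier_iff [Finite A] (S : ErrorSystem A q) (T : Set (List A)) :
    Nonempty (S.carrier T ≃o S.carrier ∅) ↔ ∀ w ∈ S.words, w ∈ T → S.Bad w := by
  constructor
  · rintro ⟨φ⟩ w hw hT
    obtain ⟨X, hX, hle, hbad⟩ := S.exists_hasType_search w
    obtain ⟨k, m, h⟩ := (S.isBlockSum_carrier T).exists_natCast_add_eq SlottedWord.monotone_lenLex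
      (S.isBlockSum_carrier ∅) ((S.image_carrier T).trans (S.image_carrier ∅).symm) φ
      (i := ⟨w⟩) (by rw [image_carrier]; exact hw) (hasType_carrier_of_mem hw hT hX)
      (hasType_carrier_of_notMem hw (notMem_empty w) hX)
    -- Nonempty words make both ordinals infinite, so the finite left summands k and m are absorbed.
    have hω : ω ≤ ω ^ (w.length : Ordinal.{0}) := by
      have hne : 0 < w.length :=
        List.length_pos_iff.2 fun h => S.nil_notMem (h ▸ hw)
      conv_lhs => rw [← opow_one ω]
      exact opow_le_opow_right omega0_pos (by exact_mod_cast hne)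
    rw [natCast_add_of_omega0_le (hω.trans le_self_add),
      natCast_add_of_omega0_le (hω.trans hle), add_eq_right_iff_mul_omega0_le] at h
    rw [hbad, Nat.cast_add, Nat.cast_one, opow_add, opow_one]
    exact h
  · intro h
    refine (S.isBlockSum_carrier T).nonempty_orderIso SlottedWord.monotone_lenLex
      (S.isBlockSum_carrier ∅) (fun x hs => and_congr_right fun hx => ?_) fun i => ?_
    · have : Label.flag ∉ x.labels := fun hf => by
        obtain ⟨a, v, -, hγ⟩ := hx.starts_iff.1 hs
        rw [hγ] at hf
        rcases List.mem_cons.1 hf with hf | hf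
        · cases hf
        · cases List.eq_of_mem_replicate hf
      simp [this]
    · obtain ⟨w⟩ := i
      by_cases hw : w ∈ S.words ∧ w ∈ T
      · obtain ⟨X, hX, -, hbad⟩ := S.exists_hasType_search w
        refine ⟨X, ?_, hasType_carrier_of_notMem hw.1 (notMem_empty w) hX⟩
        have := hasType_carrier_of_mem hw.1 hw.2 hX
        rwa [add_eq_right_iff_mul_omega0_le.2] at this
        have := hbad.1 (h w hw.1 hw.2)
        rwa [Nat.cast_add, Nat.cast_one, opow_add, opow_one] at this
      · obtain ⟨X, hX⟩ := S.exists_hasType_carrier T w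
        refine ⟨X, hX, hX.of_iff fun x => and_congr_left fun hx => and_congr_right fun hv => ?_⟩
        obtain rfl : x.word = w := congrArg LenLex.toList hx.1
        have : x.word ∉ T := fun h => hw ⟨hv.1, h⟩
        simp [this]

end ErrorSystem

end TreeAutomatic

/-! ### Presentations determine linear orders up to isomorphism -/

namespace TreeAutomatic

open scoped Computability

/-- The algebra of trees. -/
def TreeAlgebra.free (α : Type) : TreeAlgebra α (BinaryTree α) := ⟨.nil, .node⟩

theorem TreeAlgebra.fold_free {α : Type} (t : BinaryTree α) : (free α).fold t = t := by
  induction t with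
  | nil => rfl
  | node a l r hl hr => rw [fold, hl, hr]; rfl

/-- Evaluating the two components in the free algebra gives back the two trees. -/
theorem conv_inj {α : Type} {s t s' t' : BinaryTree α} (h : conv s t = conv s' t') :
    s = s' ∧ t = t' := by
  have h₁ := congrArg (TreeAlgebra.free α).onFst.fold h
  have h₂ := congrArg (TreeAlgebra.free α).onSnd.fold h
  rw [TreeAlgebra.fold_onFst, TreeAlgebra.fold_onFst, TreeAlgebra.fold_free, TreeAlgebra.fold_free] at h₁
  rw [TreeAlgebra.fold_onSnd, TreeAlgebra.fold_onSnd, TreeAlgebra.fold_free, TreeAlgebra.fold_free] at h₂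
  exact ⟨h₁, h₂⟩

namespace Presentation

variable {P : Presentation} {L₁ L₂ : Type} [LinearOrder L₁] [LinearOrder L₂]

theorem Presents.congr (h : P.Presents L₁) (φ : L₂ ≃o L₁) : P.Presents L₂ := by
  obtain ⟨U, R, e, he, hP⟩ := h
  exact ⟨U, R, φ.toEquiv.trans e, fun x y => φ.le_iff_le.symm.trans (he _ _), hP⟩

theorem IsPresentationOf.rel_iff {U : Set (BinaryTree ℕ)} {R : BinaryTree ℕ → BinaryTree ℕ → Prop}
    (h : P.IsPresentationOf U R) (s t : U) : R s t ↔ conv s.1 t.1 ∈ P.relAut.language := by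
  rw [h.2.2.2]
  constructor
  · exact fun h => ⟨s, s.2, t, t.2, h, rfl⟩
  · rintro ⟨s', -, t', -, h, he⟩
    obtain ⟨h₁, h₂⟩ := conv_inj he
    rwa [h₁, h₂]

/-- The two languages determine the universe and, by injectivity of convolution, the relation on it.
-/
theorem Presents.nonempty_orderIso (h₁ : P.Presents L₁) (h₂ : P.Presents L₂) :
    Nonempty (L₁ ≃o L₂) := by
  obtain ⟨U₁, R₁, e₁, he₁, hP₁⟩ := h₁
  obtain ⟨U₂, R₂, e₂, he₂, hP₂⟩ := h₂
  obtain rfl : U₁ = U₂ := hP₁.2.2.1.symm.trans hP₂.2.2.1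
  refine ⟨⟨e₁.trans e₂.symm, fun {x y} => ?_⟩⟩
  rw [he₁, he₂, hP₁.rel_iff, hP₂.rel_iff]
  simp

end Presentation

/-! ### Reduction of the halting problem -/

open CounterProgram in
-- The only obstacle to execution is a zero test, and the counter seen by it is the initial value
-- plus the sum of all earlier effects. Letters without an action contribute 0.
theorem exists_exec_iff {A : Type} (f : A → Option Act) (w : List A) (c : ℕ → ℤ) :
    (∃ d, Exec (w.filterMap f) c d) ↔ ∀ u a v j, w = u ++ a :: v → f a = some (.test j) →
      c j + (u.map fun b => (f b).elim 0 Act.effect j).sum = 0 := by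
  induction w generalizing c with
  | nil => simp [Exec]
  | cons b w ih =>
    have hsplit : (∃ d, Exec ((b :: w).filterMap f) c d) ↔
        (∀ j, f b = some (.test j) → c j = 0) ∧
          ∃ d, Exec (w.filterMap f) (c + (f b).elim 0 Act.effect) d := by
      cases hb : f b with
      | none => simp [hb]
      | some a =>
        simp only [List.filterMap_cons, hb, Exec, Option.elim_some, exists_and_left]
        refine and_congr_left' ?_
        cases a <;> simp [Act.Enabled]
    rw [hsplit, ih]
    constructor
    · rintro ⟨h₁, h₂⟩ u a v j h ha
      obtain _ | ⟨b', u⟩ := u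
      · obtain ⟨rfl, rfl⟩ := List.cons_eq_cons.1 h
        simpa using h₁ j ha
      · obtain ⟨rfl, rfl⟩ := List.cons_eq_cons.1 h
        have := h₂ u a v j rfl ha
        rw [Pi.add_apply] at this
        rw [List.map_cons, List.sum_cons, ← add_assoc]
        exact this
    · intro h
      refine ⟨fun j hj => by simpa using h [] b w j rfl hj, fun u a v j hw ha => ?_⟩
      have := h (b :: u) a v j (by rw [hw, List.cons_append]) ha
      rw [List.map_cons, List.sum_cons, ← add_assoc] at this
      exact this

namespace ErrorSystem

variable {A : Type} {q : ℕ}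

theorem IsSep.flag_notMem {w : List A} {γ : List (Label q)} (h : IsSep w γ) : .flag ∉ γ := by
  obtain ⟨a, v, -, rfl⟩ := h
  intro hf
  rcases List.mem_cons.1 hf with hf | hf
  · cases hf
  · cases List.eq_of_mem_replicate hf

/-- Marking the letter `e` with the label `flag` suffices: in a flagged word every letter has this
label and `e` occurs exactly once, so the mark tells the position of `e`. Words with other labels
have no mark and are admitted for every n. -/
theorem exists_presentation_carrier [LinearOrder A] [Finite A] (S : ErrorSystem A q) (e : A)
    (he : ∀ w ∈ S.words, ∃! i : ℕ, w[i]? = some e) :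
    ∃ P : ℕ → Presentation, Computable P ∧
      ∀ n, (P n).Presents (S.carrier {w | w[n]? = some e}) := by
  obtain ⟨M, N, _, _, R, hR⟩ := S.exists_wordCondition
  obtain ⟨P, hP, h⟩ := exists_presentation_slottedWord R {y | y = (e, Label.flag)}
  refine ⟨P, hP, fun n => ?_⟩
  have heq : S.carrier {w | w[n]? = some e} =
      {x | R.Holds x ∧ OnlyAt {y | y = (e, Label.flag)} n x} := by
    ext x
    refine (and_congr_right fun hx => ?_).trans (and_congr_left' (hR x).symm)
    have hword : ∀ i : ℕ, x.word[i]? = x.toList[i]?.map fun y => y.1 := fun i => List.getElem?_map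
    constructor
    · rintro hf i y hi hy
      obtain ⟨hy₁, hy₂⟩ := Prod.ext_iff.1 (show (y.1, y.2.1) = (e, Label.flag) from hy)
      have hn := hf (List.mem_map.2 ⟨y, List.mem_of_getElem? hi, hy₂⟩)
      refine (he _ hx.1).unique ?_ hn
      rw [hword, hi, Option.map_some, hy₁]
    · intro h hf
      have hflag : IsFlag x.word x.labels := by
        rcases hx.2.1 with h' | h' | h'
        · exact absurd hf h'.flag_notMem
        · exact h'
        · exact absurd (h'.mem.2 _ hf) (lt_irrefl _)
      obtain ⟨i, hi, -⟩ := he _ hx.1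
      have hi' := hi
      rw [hword] at hi'
      obtain ⟨y, hy, hye⟩ := Option.map_eq_some_iff.1 hi'
      have hyf : y.2.1 = .flag := by
        have : y.2.1 ∈ x.labels := List.mem_map.2 ⟨y, List.mem_of_getElem? hy, rfl⟩
        rw [show x.labels = _ from hflag] at this
        exact List.eq_of_mem_replicate this
      exact h i y hy (Prod.ext hye hyf) ▸ hi
  rw [heq]
  exact h n

end ErrorSystem

end TreeAutomatic

/-! ### The system of errors of a counter program -/

namespace TreeAutomatic

open scoped Computability

open CounterProgram

instance (K : ℕ) : Finite {a : Act // a.index < K} := by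
  refine Finite.of_injective (β := Fin 3 × Fin K) (fun a => (match a.1 with
    | .inc _ => 0
    | .dec _ => 1
    | .test _ => 2, ⟨a.1.index, a.2⟩)) ?_
  rintro ⟨_ | _ | _, _⟩ ⟨_ | _ | _, _⟩ h <;> simp_all [Act.index]

/-- The letters of programs with less than `K` counters, and a letter that marks the end of the
input. -/
abbrev Letter (K : ℕ) : Type := Option {a : Act // a.index < K}

namespace Letter

variable {K : ℕ}

/-- The action of a letter. -/
def toAct (a : Letter K) : Option Act := a.map Subtype.val

/-- The change of the counters effected by a letter. -/
def effect (a : Letter K) : ℕ → ℤ := a.toAct.elim 0 Act.effect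

theorem abs_effect_le (a : Letter K) (j : ℕ) : |a.effect j| ≤ 1 := by
  obtain _ | ⟨a, ha⟩ := a
  · simp [effect, toAct]
  · obtain i | i | i := a <;> simp only [effect, toAct, Option.map_some, Option.elim_some, Act.effect]
    · rw [Pi.single_apply]
      split <;> simp
    · rw [Pi.single_apply]
      split <;> simp
    · simp

/-- The letter that increments the counter `0`. -/
def one (hK : 0 < K) : Letter K := some ⟨.inc 0, hK⟩

/-- The action of a letter, where the end marker is replaced by an arbitrary action. -/
def act (a : Letter K) : Act := a.toAct.getD (.inc 0)

/-- The two signs. -/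
def sign (i : Fin 2) : ℤ := if i = 0 then 1 else -1

/-- The weight of a letter with respect to a counter and a sign. -/
def weight (x : Fin (K * 2)) (a : Letter K) : ℕ :=
  (1 + sign (finProdFinEquiv.symm x).2 * a.effect (finProdFinEquiv.symm x).1).toNat

theorem cast_weight (x : Fin (K * 2)) (a : Letter K) : (weight x a : ℤ) =
    1 + sign (finProdFinEquiv.symm x).2 * a.effect (finProdFinEquiv.symm x).1 := by
  have h := abs_le.1 (a.abs_effect_le (finProdFinEquiv.symm x).1)
  rw [weight, Int.toNat_of_nonneg]
  rw [sign]
  split <;> omega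

theorem weight_le (x : Fin (K * 2)) (a : Letter K) : weight x a ≤ 2 := by
  have h := abs_le.1 (a.abs_effect_le (finProdFinEquiv.symm x).1)
  have h' := cast_weight x a
  rw [sign] at h'
  split at h' <;> omega

/-- The excess of the total weight over the length is the signed value of the counter. This converts
a failing zero test into a large exponent. -/
theorem cast_sum_weight (x : Fin (K * 2)) (u : List (Letter K)) :
    ((u.map (weight x)).sum : ℤ) = u.length + sign (finProdFinEquiv.symm x).2 *
      (u.map fun a => a.effect (finProdFinEquiv.symm x).1).sum := by
  induction u with
  | nil => simp
  | cons a u ih =>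
    simp only [List.map_cons, List.sum_cons, List.length_cons, Nat.cast_add, ih, cast_weight]
    push_cast
    ring

end Letter

/-- The codings of runs of the program `L` on inputs given in unary. -/
def runWords (L : Language Act) {K : ℕ} (hK : 0 < K) : Language (Letter K) :=
  let body : Language (Letter K) := {v | v.map Letter.act ∈ L}
  (Language.ofLetters {Letter.one hK})∗ * (Language.ofLetters {none} *
    (body ⊓ (Language.ofLetters {none}ᶜ)∗))

theorem isRegular_runWords {L : Language Act} (hL : L.IsRegular) {K : ℕ} (hK : 0 < K) :
    (runWords L hK).IsRegular :=
  (Language.isRegular_ofLetters _).kstar.mul ((Language.isRegular_ofLetters _).mul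
    ((hL.preimage_map _).inf (Language.isRegular_ofLetters _).kstar))

theorem mem_runWords {L : Language Act} {K : ℕ} {hK : 0 < K} {w : List (Letter K)} :
    w ∈ runWords L hK ↔ ∃ n v, w = List.replicate n (Letter.one hK) ++ none :: v ∧
      v.map Letter.act ∈ L ∧ none ∉ v := by
  simp only [runWords, Language.mem_mul]
  constructor
  · rintro ⟨u, hu, _, ⟨_, ⟨a, rfl, rfl⟩, v, ⟨hv, hv'⟩, rfl⟩, rfl⟩
    rw [Language.mem_kstar_ofLetters] at hu
    refine ⟨u.length, v, ?_, hv, fun h => ?_⟩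
    · rw [← List.eq_replicate_length.2 hu]
      rfl
    exact Language.mem_kstar_ofLetters.1 hv' _ h rfl
  · rintro ⟨n, v, rfl, hv, hv'⟩
    exact ⟨_, Language.mem_kstar_ofLetters.2 fun a ha => List.eq_of_mem_replicate ha, _,
      ⟨[none], ⟨none, rfl, rfl⟩, v, ⟨hv, Language.mem_kstar_ofLetters.2
        fun a ha h => hv' (h ▸ ha)⟩, rfl⟩, rfl⟩

/-- The errors in runs are zero tests of counters that are not zero. -/
def programErrors (L : Language Act) (hL : L.IsRegular) {K : ℕ} (hK : 0 < K) :
    ErrorSystem (Letter K) (K * 2) where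
  words := runWords L hK
  isRegular_words := isRegular_runWords hL hK
  nil_notMem := by
    rw [mem_runWords]
    rintro ⟨n, v, h, -⟩
    simp at h
  wt := Letter.weight
  wt_le := Letter.weight_le
  trig x := {a | a.toAct = some (.test (finProdFinEquiv.symm x).1)}

/-- A nonzero counter is positive after multiplication by one of the two signs, hence two kinds of
errors for each counter. -/
theorem bad_programErrors_iff {L : Language Act} {hL : L.IsRegular} {K : ℕ} {hK : 0 < K}
    (w : List (Letter K)) : (programErrors L hL hK).Bad w ↔
      ¬ ∃ d, Exec (w.filterMap Letter.toAct) 0 d := by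
  rw [exists_exec_iff]
  push Not
  constructor
  · rintro ⟨x, u, a, v, rfl, ha, h⟩
    refine ⟨u, a, v, _, rfl, ha, ?_⟩
    rw [← Nat.cast_lt (α := ℤ)] at h
    change _ < (((u.map (Letter.weight x)).sum : ℕ) : ℤ) at h
    rw [Letter.cast_sum_weight] at h
    intro h0
    rw [Pi.zero_apply, zero_add] at h0
    change (u.map fun a => a.effect (finProdFinEquiv.symm x).1).sum = 0 at h0
    rw [h0] at h
    simp at h
  · rintro ⟨u, a, v, j, rfl, ha, h⟩
    have hj : j < K := by
      obtain _ | ⟨a, hK⟩ := a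
      · simp [Letter.toAct] at ha
      · simp only [Letter.toAct, Option.map_some, Option.some.injEq] at ha
        subst ha
        exact hK
    rw [Pi.zero_apply, zero_add] at h
    obtain ⟨i, hi⟩ : ∃ i, 0 < Letter.sign i * (u.map fun a => a.effect j).sum := by
      rcases lt_or_gt_of_ne h with h | h
      · refine ⟨1, ?_⟩
        change 0 < -1 * (u.map fun a => a.effect j).sum
        rw [neg_one_mul, neg_pos]
        exact h
      · refine ⟨0, ?_⟩
        change 0 < 1 * (u.map fun a => a.effect j).sum
        rw [one_mul]
        exact h
    refine ⟨finProdFinEquiv (⟨j, hj⟩, i), u, a, v, rfl, ?_, ?_⟩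
    · change _ = _
      rw [Equiv.symm_apply_apply]
      exact ha
    · rw [← Nat.cast_lt (α := ℤ)]
      change _ < (((u.map (Letter.weight _)).sum : ℕ) : ℤ)
      rw [Letter.cast_sum_weight, Equiv.symm_apply_apply]
      exact lt_add_of_pos_right _ hi

theorem getElem?_run_eq_none_iff {K n : ℕ} {z : Letter K} (hz : z ≠ none) {v : List (Letter K)}
    (hv : none ∉ v) {i : ℕ} : (List.replicate n z ++ none :: v)[i]? = some none ↔ i = n := by
  constructor
  · intro h
    rcases lt_trichotomy i n with hi | rfl | hi
    · rw [List.getElem?_append_left (by simpa), List.getElem?_replicate_of_lt hi] at h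
      exact absurd (Option.some.inj h) hz
    · rfl
    · obtain ⟨d, rfl⟩ := Nat.exists_eq_add_of_lt hi
      rw [List.getElem?_append_right (by simp; omega), List.length_replicate,
        show n + d + 1 - n = d + 1 by omega, List.getElem?_cons_succ] at h
      exact absurd (List.mem_of_getElem? h) hv
  · rintro rfl
    rw [List.getElem?_append_right (by simp)]
    simp

/-- There is a computable family of presentations of scattered linear orders such that the order
with index `n` is isomorphic to a fixed order if and only if the computation with index `n` does not
halt. -/
theorem exists_presentation_halts : ∃ (P : ℕ → Presentation) (L : ℕ → Type)
    (_ : ∀ n, LinearOrder (L n)) (L' : Type) (_ : LinearOrder L'), Computable P ∧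
      (∀ n, (P n).Presents (L n)) ∧ (∀ n, Scattered (L n)) ∧ Scattered L' ∧
      ∀ n, Nonempty (L n ≃o L') ↔ ¬ Halts n := by
  obtain ⟨L, ⟨hL, K', hK'⟩, hhalt⟩ := exists_program_halts
  obtain ⟨K, hK, hLK⟩ : ∃ K, 0 < K ∧ ∀ w ∈ L, ∀ a ∈ w, a.index < K :=
    ⟨K' + 1, K'.succ_pos, fun w hw a ha => (hK' w hw a ha).trans K'.lt_succ_self⟩
  obtain ⟨f, hf⟩ := exists_injective_nat (Letter K)
  let _ : LinearOrder (Letter K) := LinearOrder.lift' f hf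
  let S := programErrors L hL hK
  obtain ⟨P, hP, hpres⟩ := S.exists_presentation_carrier none fun w hw => by
    obtain ⟨n, v, rfl, -, hv⟩ := mem_runWords.1 hw
    exact ⟨n, (getElem?_run_eq_none_iff (Option.some_ne_none _) hv).2 rfl,
      fun i hi => (getElem?_run_eq_none_iff (Option.some_ne_none _) hv).1 hi⟩
  refine ⟨P, _, fun n => inferInstance, _, inferInstance, hP, hpres,
    fun n => S.scattered_carrier _, S.scattered_carrier ∅, fun n => ?_⟩
  have hmap : ∀ v : List (Letter K), none ∉ v →
      v.filterMap Letter.toAct = v.map Letter.act := by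
    intro v hv
    rw [← List.filterMap_eq_map]
    refine List.filterMap_congr fun a ha => ?_
    obtain _ | a := a
    · exact absurd ha hv
    · rfl
  have hact : ∀ n (v : List (Letter K)), none ∉ v →
      (List.replicate n (Letter.one hK) ++ none :: v).filterMap Letter.toAct =
        List.replicate n (.inc 0) ++ v.map Letter.act := by
    intro n v hv
    rw [List.filterMap_append, List.filterMap_replicate_of_some (f := Letter.toAct) (b := Act.inc 0) rfl,
      List.filterMap_cons_none rfl, hmap v hv]
  rw [S.nonempty_orderIso_carrier_iff, hhalt]
  constructor
  · rintro h ⟨w, hw, d, hd⟩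
    obtain ⟨v, rfl, hv⟩ : ∃ v : List (Letter K),
        v.map Letter.act = w ∧ none ∉ v := by
      -- All actions of the program refer to counters below K, so the run can be written with the
      -- finitely many letters, without using the end marker.
      refine ⟨w.attach.map fun a => some ⟨a.1, hLK w hw a.1 a.2⟩, ?_, by simp⟩
      rw [List.map_map]
      exact List.attach_map_subtype_val w
    refine (bad_programErrors_iff _).1 (h _ (mem_runWords.2 ⟨n, v, rfl, hw, hv⟩)
      ((getElem?_run_eq_none_iff (Option.some_ne_none _) hv).2 rfl)) ⟨d, ?_⟩
    rwa [hact n v hv]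
  · rintro h w hw hn
    refine (bad_programErrors_iff w).2 ?_
    obtain ⟨m, v, rfl, hvL, hv⟩ := mem_runWords.1 hw
    obtain rfl := (getElem?_run_eq_none_iff (Option.some_ne_none _) hv).1 hn
    rintro ⟨d, hd⟩
    rw [hact _ v hv] at hd
    exact h ⟨_, hvL, d, hd⟩

/-- The complement of A is the domain of a partial computable function; its fixed code is paired
with n. -/
theorem exists_computable_halts {A : Set ℕ} (hA : IsPi01 A) :
    ∃ f : ℕ → ℕ, Computable f ∧ ∀ n, n ∈ A ↔ ¬ Halts (f n) := by
  obtain ⟨c, hc⟩ := Nat.Partrec.Code.exists_code.1 (Partrec.nat_iff.1 (hA.map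
    ((Computable.const 0).comp Computable.fst).to₂))
  refine ⟨fun n => Nat.pair (Encodable.encode c) n, ?_, fun n => ?_⟩
  · exact (Primrec₂.natPair.comp (Primrec.const _) Primrec.id).to_comp
  · simp only [Halts, Nat.unpair_pair, Denumerable.ofNat_encode, hc]
    change _ ↔ ¬ ∃ _ : n ∉ A, True
    simp

end TreeAutomatic

/-! ### The hardness results -/

theorem mainTheorem2 :
    (∃ (L : Type) (_ : LinearOrder L), TreeAutomatic.Scattered L ∧
      TreeAutomatic.Pi01Hard {P : TreeAutomatic.Presentation | P.Presents L}) ∧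
    TreeAutomatic.Pi01Hard TreeAutomatic.scatteredIsoProblem ∧
    (∀ X : Set (TreeAutomatic.Presentation × TreeAutomatic.Presentation),
      (∀ (P₁ P₂ : TreeAutomatic.Presentation) (L₁ L₂ : Type)
        [LinearOrder L₁] [LinearOrder L₂],
        TreeAutomatic.Scattered L₁ → TreeAutomatic.Scattered L₂ →
        P₁.Presents L₁ → P₂.Presents L₂ →
        ((P₁, P₂) ∈ X ↔ Nonempty (L₁ ≃o L₂))) →
      TreeAutomatic.Pi01Hard X) := by
  obtain ⟨P, L, _, L', _, hP, hpres, hL, hL', hiso⟩ := TreeAutomatic.exists_presentation_halts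
  -- The full set is Π⁰₁, so its reduction yields some non-halting index n₀. The presentation with
  -- this index presents the fixed order `L'`.
  have huniv : TreeAutomatic.IsPi01 Set.univ := by
    refine Partrec.of_eq Partrec.none fun n => ?_
    exact (Part.assert_neg (not_not.2 (Set.mem_univ n))).symm
  obtain ⟨n₀, hn₀⟩ : ∃ n, ¬ CounterProgram.Halts n := by
    obtain ⟨f, -, hf⟩ := TreeAutomatic.exists_computable_halts huniv
    exact ⟨f 0, (hf 0).1 (Set.mem_univ 0)⟩
  have hpres' : (P n₀).Presents L' := (hpres n₀).congr ((hiso n₀).2 hn₀).some.symm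
  -- The second and the third claim use the same reduction, with the second presentation kept
  -- constant.
  have hred : ∀ X : Set (TreeAutomatic.Presentation × TreeAutomatic.Presentation),
      (∀ n, (P n, P n₀) ∈ X ↔ Nonempty (L n ≃o L')) → TreeAutomatic.Pi01Hard X := by
    intro X hX A hA
    obtain ⟨f, hf, h⟩ := TreeAutomatic.exists_computable_halts hA
    refine ⟨fun n => (P (f n), P n₀), (hP.comp hf).pair (Computable.const _), fun n => ?_⟩
    change n ∈ A ↔ (P (f n), P n₀) ∈ X
    rw [h, ← hiso, hX]
  refine ⟨⟨L', inferInstance, hL', fun A hA => ?_⟩, hred _ fun n => ?_, fun X hX => hred X fun n =>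
    hX _ _ _ _ (hL n) hL' (hpres n) hpres'⟩
  · obtain ⟨f, hf, h⟩ := TreeAutomatic.exists_computable_halts hA
    refine ⟨fun n => P (f n), hP.comp hf, fun n => ?_⟩
    change n ∈ A ↔ (P (f n)).Presents L'
    rw [h, ← hiso]
    exact ⟨fun ⟨φ⟩ => (hpres _).congr φ.symm, fun h => (hpres _).nonempty_orderIso h⟩
  · constructor
    · rintro ⟨L₁, L₂, _, _, -, -, h₁, h₂, ⟨φ⟩⟩
      obtain ⟨φ₁⟩ := (hpres n).nonempty_orderIso h₁
      obtain ⟨φ₂⟩ := h₂.nonempty_orderIso hpres'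
      exact ⟨(φ₁.trans φ).trans φ₂⟩
    · exact fun h => ⟨L n, L', _, _, hL n, hL', hpres n, hpres', h⟩
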